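/- Let $\mathcal S$ be a smooth 3-manifold diffeomorphic to $\mathbb S^3$, and let $\hbar$ be the standard round metric of the unit sphere $\mathbb S^3$, carried to $\mathcal S$ by a fixed diffeomorphism $\mathcal S\to\mathbb S^3$. Let $\mathfrak z_{\eta\alpha\gamma\beta\delta}$ ($\eta,\alpha,\gamma,\beta,\delta\in\{1,2,3\}$) be real constants with the symmetries of the covariant derivative $\nabla_\eta r_{\alpha\gamma\beta\delta}$ of a Riemann tensor, that is, $$\mathfrak z_{\eta\alpha\gamma\beta\delta}=-\mathfrak z_{\eta\gamma\alpha\beta\delta}=-\mathfrak z_{\eta\alpha\gamma\delta\beta}=\mathfrak z_{\eta\beta\delta\alpha\gamma},$$ $$\mathfrak z_{\eta\alpha\gamma\beta\delta}+\mathfrak z_{\eta\alpha\beta\delta\gamma}+\mathfrak z_{\eta\alpha\delta\gamma\beta}=0,\qquad \mathfrak z_{\eta\alpha\gamma\beta\delta}+\mathfrak z_{\alpha\gamma\eta\beta\delta}+\mathfrak z_{\gamma\eta\alpha\beta\delta}=0 .$$ Then there exist a point $i\in\mathcal S$, a smooth function $\omega:\mathcal S\to(0,\infty)$, a smooth chart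 $x=(x^\alpha)$ of $\mathcal S$ around $i$, a number $\varepsilon_0>0$ and smooth Riemannian metrics $\breve h=\breve h_\varepsilon$ on $\mathcal S$, $0<\varepsilon<\varepsilon_0$, such that, writing $\mathcal B_r(i)$ for the open ball of radius $r$ centred at $i$ with respect to the Riemannian distance of $\breve h_\varepsilon$, the following hold for every $\varepsilon\in(0,\varepsilon_0)$: (i) the ball $\mathcal B_\varepsilon(i)$ lies in the domain of the chart $x$, which maps it onto the Euclidean ball $\{|x|<\varepsilon\}$; there $x$ is a system of normal coordinates of $\breve h_\varepsilon$ centred at $i$ (that is, $x(i)=0$, the coordinate frame at $i$ is orthonormal, and the rays through the origin are geodesics), and $$\breve h_{\alpha\beta}=\delta_{\alpha\beta}+\mathfrak z_{\eta\alpha\gamma\beta\delta}\,x^\gamma x^\delta x^\eta\qquad\text{on }\mathcal B_\varepsilon(i)$$ (summation over repeated indices); (ii) $\breve h_\varepsilon=\omega^2\hbar$ on $\mathcal S\setminus\mathcal B_{2\varepsilon}(i)$; (iii) the Yamabe number $$Y(\breve h_\varepsilon)=\inf_{u\in C^\infty(\mathcal S),\,u>0}\ \frac{\int_{\mathcal S}\big(8|du|^2+r[\breve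 h_\varepsilon]\,u^2\big)\,dv}{\big(\int_{\mathcal S}u^6\,dv\big)^{1/3}}$$ is positive, where $r$, $|\cdot|$ and $dv$ are the scalar curvature, the norm and the volume measure of $\breve h_\varepsilon$. Moreover, (iv) $\breve h_\varepsilon\to\omega^2\hbar$ as $\varepsilon\to0$ in the $C^2$ topology: in every smooth chart of $\mathcal S$, the components and their partial derivatives of order at most two converge uniformly on compact subsets of the chart. -/

import Mathlib

open Set Filter Topology MeasureTheory Manifold Bundle
open scoped ContDiff ENNReal

noncomputable section

/-- Constants `z η α γ β δ` with the algebraic symmetries of the components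
`∇_η r_{αγβδ}` of the covariant derivative of a Riemann curvature tensor, `αγ` and `βδ` being the
two antisymmetric pairs. -/
structure HasRiemannDerivSymmetries (z : Fin 3 → Fin 3 → Fin 3 → Fin 3 → Fin 3 → ℝ) : Prop where
  antisymm_left : ∀ η α γ β δ, z η α γ β δ = -z η γ α β δ
  antisymm_right : ∀ η α γ β δ, z η α γ β δ = -z η α γ δ β
  pair_symm : ∀ η α γ β δ, z η α γ β δ = z η β δ α γ
  bianchi_first : ∀ η α γ β δ, z η α γ β δ + z η α β δ γ + z η α δ γ β = 0
  bianchi_second : ∀ η α γ β δ, z η α γ β δ + z α γ η β δ + z γ η α β δ = 0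

/-- The components `δ_{αβ} + z_{ηαγβδ} x^γ x^δ x^η` at the point `x`. -/
def cubicMetric (z : Fin 3 → Fin 3 → Fin 3 → Fin 3 → Fin 3 → ℝ)
    (x : EuclideanSpace ℝ (Fin 3)) (α β : Fin 3) : ℝ :=
  (if α = β then 1 else 0) + ∑ η, ∑ γ, ∑ δ, z η α γ β δ * x γ * x δ * x η

namespace CoordGeometry

/-! Local differential geometry of a field of matrices `G = (g_ij)` on an open subset of `ℝ³`. -/

/-- The partial derivative `∂_i f`. -/
def pderiv (i : Fin 3) (f : EuclideanSpace ℝ (Fin 3) → ℝ) (x : EuclideanSpace ℝ (Fin 3)) : ℝ :=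
  fderiv ℝ f x (EuclideanSpace.single i 1)

/-- Christoffel symbols `Γ^k_ij = ½ g^{kl} (∂_i g_jl + ∂_j g_il - ∂_l g_ij)`. -/
def christoffel (G : EuclideanSpace ℝ (Fin 3) → Matrix (Fin 3) (Fin 3) ℝ) (k i j : Fin 3)
    (x : EuclideanSpace ℝ (Fin 3)) : ℝ :=
  (1 / 2) * ∑ l, (G x)⁻¹ k l *
    (pderiv i (fun y => G y j l) x + pderiv j (fun y => G y i l) x - pderiv l (fun y => G y i j) x)

/-- Ricci tensor `R_jk = ∂_i Γ^i_jk - ∂_k Γ^i_ij + Γ^i_ip Γ^p_jk - Γ^i_kp Γ^p_ij`. -/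
def ricci (G : EuclideanSpace ℝ (Fin 3) → Matrix (Fin 3) (Fin 3) ℝ) (j k : Fin 3)
    (x : EuclideanSpace ℝ (Fin 3)) : ℝ :=
  ∑ i, (pderiv i (christoffel G i j k) x - pderiv k (christoffel G i i j) x
    + ∑ p, (christoffel G i i p x * christoffel G p j k x
      - christoffel G i k p x * christoffel G p i j x))

/-- Scalar curvature `g^{jk} R_jk` (positive on round spheres). -/
def scalarCurvature (G : EuclideanSpace ℝ (Fin 3) → Matrix (Fin 3) (Fin 3) ℝ)
    (x : EuclideanSpace ℝ (Fin 3)) : ℝ :=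
  ∑ j, ∑ k, (G x)⁻¹ j k * ricci G j k x

/-- The curve `c` is a solution of the geodesic equation
`c''^k + Γ^k_ij(c) c'^i c'^j = 0` at the times in `s`. -/
def IsGeodesicOn (G : EuclideanSpace ℝ (Fin 3) → Matrix (Fin 3) (Fin 3) ℝ)
    (c : ℝ → EuclideanSpace ℝ (Fin 3)) (s : Set ℝ) : Prop :=
  ContDiffOn ℝ 2 c s ∧ ∀ t ∈ s, ∀ k : Fin 3,
    deriv (fun τ => deriv (fun σ => c σ k) τ) t
      + ∑ i, ∑ j, christoffel G k i j (c t) * deriv (fun σ => c σ i) t * deriv (fun σ => c σ j) t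
      = 0

end CoordGeometry

section Manifolds

variable (M : Type*) [TopologicalSpace M] [ChartedSpace (EuclideanSpace ℝ (Fin 3)) M]

/-- A (not necessarily continuous) field of bilinear forms on the tangent spaces of a
3-manifold. -/
abbrev BilinField : Type _ :=
  ∀ p : M, TangentSpace (𝓡 3) p →L[ℝ] TangentSpace (𝓡 3) p →L[ℝ] ℝ

/-- Smooth Riemannian metrics on a 3-manifold. -/
abbrev SmoothMetric [IsManifold (𝓡 3) ∞ M] : Type _ :=
  ContMDiffRiemannianMetric (𝓡 3) ∞ (EuclideanSpace ℝ (Fin 3)) (fun p : M => TangentSpace (𝓡 3) p)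

variable {M}

/-- The components `T(∂_i, ∂_j)` of a field of bilinear forms in the chart `e`, as a function on
the target of the chart. -/
def chartCoeff (T : BilinField M) (e : OpenPartialHomeomorph M (EuclideanSpace ℝ (Fin 3)))
    (x : EuclideanSpace ℝ (Fin 3)) : Matrix (Fin 3) (Fin 3) ℝ :=
  Matrix.of fun i j =>
    T (e.symm x)
      (mfderiv (𝓡 3) (𝓡 3) e.symm x (EuclideanSpace.single i (1 : ℝ) : EuclideanSpace ℝ (Fin 3)))
      (mfderiv (𝓡 3) (𝓡 3) e.symm x (EuclideanSpace.single j (1 : ℝ) : EuclideanSpace ℝ (Fin 3)))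

/-- The standard metric of the unit sphere in `ℝ⁴`, induced by the Euclidean inner product and
carried to `M` by an identification `Ψ` of `M` with the sphere. -/
def roundMetric (Ψ : M ≃ₘ⟮𝓡 3, 𝓡 3⟯ (Metric.sphere (0 : EuclideanSpace ℝ (Fin 4)) 1)) :
    BilinField M := fun p =>
  let A : TangentSpace (𝓡 3) p →L[ℝ] EuclideanSpace ℝ (Fin 4) :=
    mfderiv (𝓡 3) 𝓘(ℝ, EuclideanSpace ℝ (Fin 4))
      (fun q : M => (Ψ q : EuclideanSpace ℝ (Fin 4))) p
  let ip : EuclideanSpace ℝ (Fin 4) →L[ℝ] EuclideanSpace ℝ (Fin 4) →L[ℝ] ℝ := innerSL ℝ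
  ((ContinuousLinearMap.precomp ℝ A).comp ip).comp A

theorem roundMetric_apply
    (Ψ : M ≃ₘ⟮𝓡 3, 𝓡 3⟯ (Metric.sphere (0 : EuclideanSpace ℝ (Fin 4)) 1)) (p : M)
    (v w : TangentSpace (𝓡 3) p) :
    roundMetric Ψ p v w =
      inner ℝ (show EuclideanSpace ℝ (Fin 4) from
          mfderiv (𝓡 3) 𝓘(ℝ, EuclideanSpace ℝ (Fin 4))
            (fun q : M => (Ψ q : EuclideanSpace ℝ (Fin 4))) p v)
        (show EuclideanSpace ℝ (Fin 4) from
          mfderiv (𝓡 3) 𝓘(ℝ, EuclideanSpace ℝ (Fin 4))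
            (fun q : M => (Ψ q : EuclideanSpace ℝ (Fin 4))) p w) := rfl

/-- The field `w² T`. -/
def conformalRescale (w : M → ℝ) (T : BilinField M) : BilinField M := fun p => w p ^ 2 • T p

variable [IsManifold (𝓡 3) ∞ M]

/-- The `C²` topology: in every smooth chart, the components and their partial derivatives of
order at most two converge uniformly on compact sets. -/
def TendstoC2 {ι : Type*} (T : ι → BilinField M) (l : Filter ι) (T₀ : BilinField M) : Prop :=
  ∀ e ∈ IsManifold.maximalAtlas (𝓡 3) ∞ M, ∀ K : Set (EuclideanSpace ℝ (Fin 3)),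
    IsCompact K → K ⊆ e.target → ∀ i j : Fin 3, ∀ k ≤ 2,
      TendstoUniformlyOn
        (fun n x => iteratedFDeriv ℝ k (fun y => chartCoeff (T n) e y i j) x)
        (fun x => iteratedFDeriv ℝ k (fun y => chartCoeff T₀ e y i j) x) l K

/-- The Riemannian distance of `h`: the infimum of the `h`-lengths of `C¹` paths. -/
def metricEDist (h : SmoothMetric M) (p q : M) : ℝ≥0∞ :=
  letI : RiemannianBundle (fun p : M => TangentSpace (𝓡 3) p) := ⟨h.toRiemannianMetric⟩
  riemannianEDist (𝓡 3) p q

/-- The open `h`-ball of radius `r` centred at `p`. -/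
def metricBall (h : SmoothMetric M) (p : M) (r : ℝ) : Set M :=
  {q | metricEDist h p q < ENNReal.ofReal r}

/-- The chart `e` is a system of `h`-normal coordinates centred at `p` on the `h`-ball of radius
`r`: it maps this ball onto the coordinate ball of radius `r`, with `p` at the origin, the
coordinate frame is `h`-orthonormal at `p`, and the rays through the origin are `h`-geodesics. -/
structure IsNormalChartOn (h : SmoothMetric M) (p : M) (r : ℝ)
    (e : OpenPartialHomeomorph M (EuclideanSpace ℝ (Fin 3))) : Prop where
  smooth : e ∈ IsManifold.maximalAtlas (𝓡 3) ∞ M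
  ball_subset : metricBall h p r ⊆ e.source
  image_ball : e '' metricBall h p r = Metric.ball 0 r
  center : e p = 0
  orthonormal : chartCoeff h.inner e 0 = 1
  rays : ∀ v : EuclideanSpace ℝ (Fin 3),
    CoordGeometry.IsGeodesicOn (chartCoeff h.inner e) (fun t : ℝ => t • v) {t | ‖t • v‖ < r}

/-- Scalar curvature of `h` at `p`, computed in the preferred chart at `p`. -/
def scalarCurv (h : SmoothMetric M) (p : M) : ℝ :=
  CoordGeometry.scalarCurvature
    (chartCoeff h.inner (chartAt (EuclideanSpace ℝ (Fin 3)) p))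
    (chartAt (EuclideanSpace ℝ (Fin 3)) p p)

/-- `|du|²_h` at `p`: the inverse of the Gram matrix of `h` in a basis of the tangent space,
applied to the components of `du` in that basis. -/
def gradNormSq (h : SmoothMetric M) (u : M → ℝ) (p : M) : ℝ :=
  let b : Fin 3 → TangentSpace (𝓡 3) p :=
    fun i => (EuclideanSpace.single i (1 : ℝ) : EuclideanSpace ℝ (Fin 3))
  let H : Matrix (Fin 3) (Fin 3) ℝ := Matrix.of fun i j => h.inner p (b i) (b j)
  let du : Fin 3 → ℝ := fun i => mfderiv (𝓡 3) 𝓘(ℝ, ℝ) u p (b i)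
  ∑ i, ∑ j, H⁻¹ i j * du i * du j

/-- The Riemannian volume measure of `h`. In a chart it is `√(det g_ij) dx`; these measures agree
on the overlaps of the charts, so that the measure obtained by gluing them is their supremum. -/
def riemVolume [MeasurableSpace M] (h : SmoothMetric M) : Measure M :=
  ⨆ e ∈ IsManifold.maximalAtlas (𝓡 3) ∞ M,
    (((volume : Measure (EuclideanSpace ℝ (Fin 3))).restrict e.target).withDensity
      (fun x => ENNReal.ofReal (Real.sqrt (chartCoeff h.inner e x).det))).map e.symm

/-- The Yamabe quotient `∫ (8 |du|² + r u²) dv / (∫ u⁶ dv)^{1/3}` in dimension three. For `u > 0`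
it is the total scalar curvature of `u⁴ h` divided by the cube root of its volume. -/
def yamabeQuotient [MeasurableSpace M] (h : SmoothMetric M) (u : M → ℝ) : ℝ :=
  (∫ p, (8 * gradNormSq h u p + scalarCurv h p * u p ^ 2) ∂(riemVolume h)) /
    (∫ p, u p ^ 6 ∂(riemVolume h)) ^ (1 / 3 : ℝ)

/-- The Yamabe number: the infimum of the Yamabe quotient over the smooth positive functions,
that is, over the conformal class of `h`. -/
def yamabeNumber [MeasurableSpace M] (h : SmoothMetric M) : ℝ :=
  sInf {Q | ∃ u : M → ℝ, ContMDiff (𝓡 3) 𝓘(ℝ, ℝ) ∞ u ∧ (∀ p, 0 < u p) ∧ Q = yamabeQuotient h u}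

end Manifolds

end

set_option linter.unusedSectionVars false

noncomputable section

/-! Stereographic projection from a pole v turns the round metric into (1 + n)⁻² δ with n = |x|²/4,
and the point i is the antipode of v, at x = 0. The construction rests on the choice of ω: with
`heightFactor`, the metric ω²ħ becomes f²δ with f = (1 + 2n)/(1 + n)² = 1 - n²/(1 + n)²
(`chartCoeff_limit`, `one_sub_ffun_sq`). So the limit metric agrees with δ up to O(|x|⁴), f is at
most 1, and the scalar curvature is nonnegative (`scalarCurvature_limit`).

With a cutoff χ, equal to 1 on the unit ball and supported in the ball of radius two, the metric
`family` is (1 - χ(x/ε)) f²δ + χ(x/ε)(δ + cubic term). It differs from f²δ by ε³ times a smooth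
function of (ε, x/ε) that vanishes for |x| ≥ 2ε. Two derivatives cost ε⁻², so the difference is O(ε)
in C² (`exists_bound_rescaled`). The support stays away from the pole, and the estimate passes to
every other chart (`tendstoC2_of_chart`).

Each antisymmetric pair of indices of z is contracted once with x in the cubic term, so a further
contraction with x gives zero: the metric matrix maps x to x on the ball of radius ε. This makes the
rays geodesics (`isGeodesicOn_ray`) and is the Gauss lemma that identifies metric and coordinate
balls. Rays have length at most |x| since f ≤ 1, and conversely there are functions of |x| with
differential of norm at most 1 that grow by nearly ε (`metricEDist_chart_le`,
`le_metricEDist_of_radial`).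

For the Yamabe number, put ρ = √f. Then -8Δρ = ρ · `potential`, and the energy of a function u for
f²δ is, up to the factor 8, the Euclidean Dirichlet energy of ρu (`integral_gradSq_mul`). The
Sobolev inequality of ℝ³ thus yields a weighted one for the limit metric
(`exists_weighted_sobolev`). As ρu need not have compact support, ρ is first replaced by convex
truncations g(ρ), for which the needed differential inequality persists. The metrics of the family
have the same energy density for |x| > 2ε. For |x| ≤ 2ε their blow-ups tend to the flat metric, so
the gradient terms are comparable and the scalar curvature is at most η/ε² with η as small as
desired (`eventually_familyBounds`). Hölder's inequality on the ball of radius 2ε gains ε², so the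
error is a multiple of η times the L⁶ term and is absorbed (`exists_famEnergy_bound`).

These computations are made in the stereographic chart. That is legitimate because the scalar
curvature is invariant under changes of coordinates (`scalarCurvature_pullback`) and because a chart
that omits a single point carries the whole Riemannian volume (`riemVolume_eq_chartVolume`). -/

/-- Euclidean three-space. -/
abbrev E3 : Type := EuclideanSpace ℝ (Fin 3)

namespace CoordGeometry

/-! ### Matrix calculus -/

/-- A field of matrices all of whose entries are smooth on `U`. -/
def SmoothEntriesOn {X : Type*} [NormedAddCommGroup X] [NormedSpace ℝ X]
    (M : X → Matrix (Fin 3) (Fin 3) ℝ) (U : Set X) : Prop :=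
  ∀ a b, ContDiffOn ℝ ∞ (fun y => M y a b) U

/-- The entrywise partial derivative of a field of matrices. -/
def matDeriv (i : Fin 3) (M : E3 → Matrix (Fin 3) (Fin 3) ℝ) (x : E3) :
    Matrix (Fin 3) (Fin 3) ℝ :=
  Matrix.of fun a b => pderiv i (fun y => M y a b) x

/-- The connection matrices `(Γ_i)^k_j = Γ^k_ij`. -/
def conn (G : E3 → Matrix (Fin 3) (Fin 3) ℝ) (i : Fin 3) (x : E3) : Matrix (Fin 3) (Fin 3) ℝ :=
  Matrix.of fun k j => christoffel G k i j x

/-- The curvature matrices `∂_i Γ_k - ∂_k Γ_i + [Γ_i, Γ_k]`. -/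
def curvMatrix (G : E3 → Matrix (Fin 3) (Fin 3) ℝ) (i k : Fin 3) (x : E3) :
    Matrix (Fin 3) (Fin 3) ℝ :=
  matDeriv i (conn G k) x - matDeriv k (conn G i) x + conn G i x * conn G k x
    - conn G k x * conn G i x

/-- The Jacobian matrix of a map. -/
def jac (φ : E3 → E3) (x : E3) : Matrix (Fin 3) (Fin 3) ℝ :=
  Matrix.of fun a i => pderiv i (fun y => φ y a) x

theorem pderiv_congr {f g : E3 → ℝ} {x : E3} (h : f =ᶠ[𝓝 x] g) (i : Fin 3) :
    pderiv i f x = pderiv i g x := by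
  simp only [pderiv, h.fderiv_eq]

theorem pderiv_add {f g : E3 → ℝ} {x : E3} (hf : DifferentiableAt ℝ f x)
    (hg : DifferentiableAt ℝ g x) (i : Fin 3) :
    pderiv i (fun y => f y + g y) x = pderiv i f x + pderiv i g x := by
  simp [pderiv, fderiv_fun_add hf hg]

theorem pderiv_sub {f g : E3 → ℝ} {x : E3} (hf : DifferentiableAt ℝ f x)
    (hg : DifferentiableAt ℝ g x) (i : Fin 3) :
    pderiv i (fun y => f y - g y) x = pderiv i f x - pderiv i g x := by
  simp [pderiv, fderiv_fun_sub hf hg]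

theorem pderiv_mul {f g : E3 → ℝ} {x : E3} (hf : DifferentiableAt ℝ f x)
    (hg : DifferentiableAt ℝ g x) (i : Fin 3) :
    pderiv i (fun y => f y * g y) x = pderiv i f x * g x + f x * pderiv i g x := by
  simp [pderiv, fderiv_fun_mul hf hg]; ring

theorem pderiv_const (c : ℝ) (x : E3) (i : Fin 3) : pderiv i (fun _ => c) x = 0 := by
  simp [pderiv]

theorem pderiv_const_mul {f : E3 → ℝ} {x : E3} (hf : DifferentiableAt ℝ f x) (c : ℝ)
    (i : Fin 3) : pderiv i (fun y => c * f y) x = c * pderiv i f x := by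
  rw [pderiv_mul (differentiableAt_const c) hf, pderiv_const]; ring

theorem pderiv_sum {ι : Type*} (s : Finset ι) {f : ι → E3 → ℝ} {x : E3}
    (hf : ∀ k ∈ s, DifferentiableAt ℝ (f k) x) (i : Fin 3) :
    pderiv i (fun y => ∑ k ∈ s, f k y) x = ∑ k ∈ s, pderiv i (f k) x := by
  simp [pderiv, fderiv_fun_sum hf]

theorem fderiv_apply_eq_sum_pderiv (f : E3 → ℝ) (x v : E3) :
    fderiv ℝ f x v = ∑ d, v d * pderiv d f x := by
  have hv : v = ∑ d, v d • EuclideanSpace.single d (1 : ℝ) := by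
    ext k; simp [Finset.sum_apply, Pi.single_apply]
  conv_lhs => rw [hv]
  simp [pderiv]

theorem pderiv_comp {f : E3 → ℝ} {φ : E3 → E3} {x : E3} (hf : DifferentiableAt ℝ f (φ x))
    (hφ : DifferentiableAt ℝ φ x) (i : Fin 3) :
    pderiv i (fun y => f (φ y)) x = ∑ d, jac φ x d i * pderiv d f (φ x) := by
  have : fderiv ℝ (fun y => f (φ y)) x = (fderiv ℝ f (φ x)).comp (fderiv ℝ φ x) :=
    fderiv_comp x hf hφ
  rw [pderiv, this, ContinuousLinearMap.comp_apply, fderiv_apply_eq_sum_pderiv]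
  refine Finset.sum_congr rfl fun d _ => ?_
  congr 1
  simp only [jac, Matrix.of_apply, pderiv]
  have h2 : HasFDerivAt (fun y => φ y d) ((EuclideanSpace.proj d : E3 →L[ℝ] ℝ).comp
      (fderiv ℝ φ x)) x :=
    (EuclideanSpace.proj d : E3 →L[ℝ] ℝ).hasFDerivAt.comp x hφ.hasFDerivAt
  rw [h2.fderiv]; rfl

theorem contDiffOn_pderiv {f : E3 → ℝ} {U : Set E3} (hU : IsOpen U) (hf : ContDiffOn ℝ ∞ f U)
    (i : Fin 3) : ContDiffOn ℝ ∞ (pderiv i f) U := by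
  have := hf.fderiv_of_isOpen hU (m := ∞) (by simp)
  exact this.clm_apply contDiffOn_const

theorem pderiv_comm {f : E3 → ℝ} {x : E3} (hf : ContDiffAt ℝ 2 f x) (i j : Fin 3) :
    pderiv i (pderiv j f) x = pderiv j (pderiv i f) x := by
  have hs : IsSymmSndFDerivAt ℝ f x := hf.isSymmSndFDerivAt (by simp)
  have hd : DifferentiableAt ℝ (fderiv ℝ f) x :=
    (hf.fderiv_right (m := 1) (by norm_num)).differentiableAt (by simp)
  have key : ∀ i j, pderiv i (pderiv j f) x =
      fderiv ℝ (fderiv ℝ f) x (EuclideanSpace.single i 1) (EuclideanSpace.single j 1) := by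
    intro i j
    have : HasFDerivAt (pderiv j f) ((ContinuousLinearMap.apply ℝ ℝ
        (EuclideanSpace.single j (1 : ℝ) : E3)).comp (fderiv ℝ (fderiv ℝ f) x)) x :=
      (ContinuousLinearMap.apply ℝ ℝ
        (EuclideanSpace.single j (1 : ℝ) : E3)).hasFDerivAt.comp x hd.hasFDerivAt
    rw [pderiv, this.fderiv]; rfl
  rw [key, key, hs.eq]

theorem SmoothEntriesOn.differentiableAt {M : E3 → Matrix (Fin 3) (Fin 3) ℝ} {U : Set E3}
    (hM : SmoothEntriesOn M U) (hU : IsOpen U) {x : E3} (hx : x ∈ U) (a b : Fin 3) :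
    DifferentiableAt ℝ (fun y => M y a b) x :=
  ((hM a b).differentiableOn (by simp)).differentiableAt (hU.mem_nhds hx)

theorem SmoothEntriesOn.matDeriv {M : E3 → Matrix (Fin 3) (Fin 3) ℝ} {U : Set E3}
    (hM : SmoothEntriesOn M U) (hU : IsOpen U) (i : Fin 3) :
    SmoothEntriesOn (matDeriv i M) U :=
  fun a b => contDiffOn_pderiv hU (hM a b) i

section
variable {X : Type*} [NormedAddCommGroup X] [NormedSpace ℝ X]

theorem SmoothEntriesOn.mul {M N : X → Matrix (Fin 3) (Fin 3) ℝ} {U : Set X}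
    (hM : SmoothEntriesOn M U) (hN : SmoothEntriesOn N U) :
    SmoothEntriesOn (fun y => M y * N y) U := by
  intro a b
  simp only [Matrix.mul_apply]
  exact ContDiffOn.sum fun k _ => (hM a k).mul (hN k b)

theorem SmoothEntriesOn.transpose {M : X → Matrix (Fin 3) (Fin 3) ℝ} {U : Set X}
    (hM : SmoothEntriesOn M U) : SmoothEntriesOn (fun y => (M y).transpose) U :=
  fun a b => hM b a

theorem contDiffOn_det {M : X → Matrix (Fin 3) (Fin 3) ℝ} {U : Set X}
    (hM : SmoothEntriesOn M U) : ContDiffOn ℝ ∞ (fun y => (M y).det) U := by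
  simp only [Matrix.det_apply]
  refine ContDiffOn.sum fun σ _ => ?_
  simp only [Units.smul_def, zsmul_eq_mul]
  exact contDiffOn_const.mul (contDiffOn_prod fun k _ => hM _ _)

/-- Cramer's rule: the entries of the adjugate are determinants of matrices with one row replaced by
a constant one, so smoothness of determinants is enough. -/
theorem SmoothEntriesOn.inv {M : X → Matrix (Fin 3) (Fin 3) ℝ} {U : Set X}
    (hM : SmoothEntriesOn M U) (hdet : ∀ y ∈ U, (M y).det ≠ 0) :
    SmoothEntriesOn (fun y => (M y)⁻¹) U := by
  intro a b
  have h : ∀ y, (M y)⁻¹ a b = (M y).det⁻¹ * (M y).adjugate a b := by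
    intro y; simp [Matrix.inv_def]
  simp only [h, Matrix.adjugate_apply]
  refine ((contDiffOn_det hM).inv hdet).mul (contDiffOn_det ?_)
  intro c d
  by_cases hc : c = b
  · subst hc; simpa using contDiffOn_const
  · simpa [Matrix.updateRow_ne hc] using hM c d

end

theorem matDeriv_congr {M N : E3 → Matrix (Fin 3) (Fin 3) ℝ} {x : E3} (h : M =ᶠ[𝓝 x] N)
    (i : Fin 3) : matDeriv i M x = matDeriv i N x := by
  ext a b
  exact pderiv_congr (h.mono fun y hy => by simp only [hy]) i

theorem matDeriv_mul {M N : E3 → Matrix (Fin 3) (Fin 3) ℝ} {x : E3}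
    (hM : ∀ a b, DifferentiableAt ℝ (fun y => M y a b) x)
    (hN : ∀ a b, DifferentiableAt ℝ (fun y => N y a b) x) (i : Fin 3) :
    matDeriv i (fun y => M y * N y) x = matDeriv i M x * N x + M x * matDeriv i N x := by
  ext a b
  simp only [matDeriv, Matrix.of_apply, Matrix.add_apply, Matrix.mul_apply]
  rw [pderiv_sum (f := fun k y => M y a k * N y k b) _ (fun k _ => (hM a k).mul (hN k b)),
    ← Finset.sum_add_distrib]
  exact Finset.sum_congr rfl fun k _ => pderiv_mul (hM a k) (hN k b) i

theorem matDeriv_add {M N : E3 → Matrix (Fin 3) (Fin 3) ℝ} {x : E3}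
    (hM : ∀ a b, DifferentiableAt ℝ (fun y => M y a b) x)
    (hN : ∀ a b, DifferentiableAt ℝ (fun y => N y a b) x) (i : Fin 3) :
    matDeriv i (fun y => M y + N y) x = matDeriv i M x + matDeriv i N x := by
  ext a b
  exact pderiv_add (hM a b) (hN a b) i

theorem matDeriv_transpose (M : E3 → Matrix (Fin 3) (Fin 3) ℝ) (x : E3) (i : Fin 3) :
    matDeriv i (fun y => (M y).transpose) x = (matDeriv i M x).transpose := rfl

theorem matDeriv_comp {M : E3 → Matrix (Fin 3) (Fin 3) ℝ} {φ : E3 → E3} {x : E3}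
    (hM : ∀ a b, DifferentiableAt ℝ (fun y => M y a b) (φ x)) (hφ : DifferentiableAt ℝ φ x)
    (i : Fin 3) :
    matDeriv i (fun y => M (φ y)) x = ∑ d, jac φ x d i • matDeriv d M (φ x) := by
  ext a b
  simp only [matDeriv, Matrix.of_apply, Matrix.sum_apply, Matrix.smul_apply, smul_eq_mul]
  exact pderiv_comp (hM a b) hφ i

/-! ### Coordinate invariance of the scalar curvature -/

/-- The lowered Christoffel symbols `∂_i g_jl + ∂_j g_il - ∂_l g_ij`, as a matrix in `l, j`. -/
def lowConn (G : E3 → Matrix (Fin 3) (Fin 3) ℝ) (i : Fin 3) (x : E3) :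
    Matrix (Fin 3) (Fin 3) ℝ :=
  Matrix.of fun l j => matDeriv i G x j l + matDeriv j G x i l - matDeriv l G x i j

theorem conn_eq (G : E3 → Matrix (Fin 3) (Fin 3) ℝ) (i : Fin 3) (x : E3) :
    conn G i x = (1 / 2 : ℝ) • ((G x)⁻¹ * lowConn G i x) := by
  ext k j
  simp [conn, christoffel, lowConn, Matrix.mul_apply, matDeriv]

theorem SmoothEntriesOn.conn {G : E3 → Matrix (Fin 3) (Fin 3) ℝ} {U : Set E3} (hU : IsOpen U)
    (hG : SmoothEntriesOn G U) (hdet : ∀ y ∈ U, (G y).det ≠ 0) (i : Fin 3) :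
    SmoothEntriesOn (conn G i) U := by
  intro k j
  simp only [CoordGeometry.conn, Matrix.of_apply]
  unfold christoffel
  refine contDiffOn_const.mul (ContDiffOn.sum fun l _ => (hG.inv hdet k l).mul ?_)
  exact ((contDiffOn_pderiv hU (hG _ _) _).add (contDiffOn_pderiv hU (hG _ _) _)).sub
    (contDiffOn_pderiv hU (hG _ _) _)

theorem christoffel_symm {G : E3 → Matrix (Fin 3) (Fin 3) ℝ} {x : E3}
    (hG : ∀ᶠ y in 𝓝 x, (G y).IsSymm) (k i j : Fin 3) :
    christoffel G k i j x = christoffel G k j i x := by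
  have : ∀ l, pderiv l (fun y => G y i j) x = pderiv l (fun y => G y j i) x := fun l =>
    pderiv_congr (hG.mono fun y hy => by simpa using (hy.apply i j).symm) l
  unfold christoffel
  congr 1
  refine Finset.sum_congr rfl fun l _ => ?_
  rw [this]; ring

/-- In this form the curvature is that of a matrix-valued connection, whose behaviour under a change
of frame is conjugation. The symmetry of the Christoffel symbols in the lower indices reconciles the
index order in `ricci` with that of the commutator. -/
theorem scalarCurvature_eq_sum_curvMatrix {G : E3 → Matrix (Fin 3) (Fin 3) ℝ} {x : E3}
    (hG : ∀ᶠ y in 𝓝 x, (G y).IsSymm) :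
    scalarCurvature G x = ∑ d, ∑ b, (curvMatrix G d b x * (G x)⁻¹) d b := by
  have h1 : ∀ i j k l, pderiv l (christoffel G i j k) x = pderiv l (christoffel G i k j) x :=
    fun i j k l => pderiv_congr (hG.eventually_nhds.mono fun y hy => christoffel_symm hy i j k) l
  have h2 : ∀ j k, ricci G j k x = ∑ i, curvMatrix G i k x i j := by
    intro j k
    unfold ricci
    refine Finset.sum_congr rfl fun i _ => ?_
    simp only [curvMatrix, Matrix.sub_apply, Matrix.add_apply, Matrix.mul_apply, matDeriv, conn,
      Matrix.of_apply, Finset.sum_sub_distrib]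
    rw [h1 i j k i]
    simp only [christoffel_symm hG _ j k]
    ring_nf
  unfold scalarCurvature
  simp only [h2, Matrix.mul_apply, Finset.mul_sum]
  simp only [Fin.sum_univ_three]
  ring

/-- The product rule gives six terms with second derivatives of φ. By the symmetry of these
derivatives and of the metric, four of them cancel and the other two coincide, which explains the
factor 2. -/
theorem lowConn_pullback {G : E3 → Matrix (Fin 3) (Fin 3) ℝ} {φ : E3 → E3} {x : E3}
    (hG : ∀ a b, DifferentiableAt ℝ (fun y => G y a b) (φ x))
    (hsymm : (G (φ x)).IsSymm)
    (hφ : ContDiffAt ℝ ∞ φ x) (i : Fin 3) :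
    lowConn (fun y => (jac φ y).transpose * G (φ y) * jac φ y) i x =
      (2 : ℝ) • ((jac φ x).transpose * G (φ x) * matDeriv i (jac φ) x) +
      ∑ b, jac φ x b i • ((jac φ x).transpose * lowConn G b (φ x) * jac φ x) := by
  have hφd : DifferentiableAt ℝ φ x := hφ.differentiableAt (by simp)
  have hcomp : ∀ a, ContDiffAt ℝ ∞ (fun y => φ y a) x := fun a =>
    (EuclideanSpace.proj a : E3 →L[ℝ] ℝ).contDiff.contDiffAt.comp x hφ
  have hJ : ∀ a b, DifferentiableAt ℝ (fun y => jac φ y a b) x := by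
    intro a b
    have : ContDiffAt ℝ 1 (fderiv ℝ (fun y => φ y a)) x :=
      (hcomp a).fderiv_right (m := 1) (WithTop.coe_le_coe.2 le_top)
    exact (this.clm_apply contDiffAt_const).differentiableAt (by simp)
  have hGφ : ∀ a b, DifferentiableAt ℝ (fun y => G (φ y) a b) x := fun a b =>
    (hG a b).comp x hφd
  have hH : ∀ i a j, matDeriv i (jac φ) x a j = matDeriv j (jac φ) x a i := by
    intro i a j
    exact pderiv_comm ((hcomp a).of_le (WithTop.coe_le_coe.2 le_top)) i j
  have hmul : ∀ a b, DifferentiableAt ℝ (fun y => ((jac φ y).transpose * G (φ y)) a b) x := by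
    intro a b
    simp only [Matrix.mul_apply]
    exact DifferentiableAt.fun_sum fun k _ => (hJ k a).mul (hGφ k b)
  have hD : ∀ i, matDeriv i (fun y => (jac φ y).transpose * G (φ y) * jac φ y) x =
      ((matDeriv i (jac φ) x).transpose * G (φ x) +
        (jac φ x).transpose * (∑ d, jac φ x d i • matDeriv d G (φ x))) * jac φ x +
      (jac φ x).transpose * G (φ x) * matDeriv i (jac φ) x := by
    intro i
    rw [matDeriv_mul hmul hJ, matDeriv_mul (M := fun y => (jac φ y).transpose)
      (fun a b => hJ b a) hGφ, matDeriv_transpose, matDeriv_comp hG hφd]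
  have hs : ∀ a b, G (φ x) a b = G (φ x) b a := fun a b => hsymm.apply b a
  ext l j
  simp only [lowConn, hD, Matrix.of_apply]
  generalize jac φ x = J at *
  generalize G (φ x) = g at *
  generalize hHd : (fun i => matDeriv i (jac φ) x) = H
  generalize hDd : (fun d => matDeriv d G (φ x)) = D
  have e1 : ∀ i, matDeriv i (jac φ) x = H i := fun i => congrFun hHd i
  have e2 : ∀ i, matDeriv i G (φ x) = D i := fun i => congrFun hDd i
  simp only [e1, e2] at hH ⊢
  clear hD hmul hGφ hJ hG e1 e2 hHd hDd hcomp hφd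
  simp only [Matrix.add_apply, Matrix.mul_apply, Matrix.transpose_apply, Matrix.smul_apply,
    smul_eq_mul, Fin.sum_univ_three, Matrix.of_apply, add_mul]
  rw [hs 1 0, hs 2 0, hs 2 1]
  rw [hH j 0 i, hH j 1 i, hH j 2 i, hH l 0 i, hH l 1 i, hH l 2 i, hH l 0 j, hH l 1 j, hH l 2 j]
  ring

theorem isUnit_det_jac_mul {J g : Matrix (Fin 3) (Fin 3) ℝ} (hJ : J.det ≠ 0) :
    J * (J.transpose * g * J)⁻¹ = g⁻¹ * J.transpose⁻¹ := by
  rw [Matrix.mul_inv_rev, Matrix.mul_inv_rev, ← Matrix.mul_assoc,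
    Matrix.mul_nonsing_inv _ (isUnit_iff_ne_zero.2 hJ), Matrix.one_mul]

/-- The transformation law of the connection under a change of coordinates. -/
theorem jac_mul_conn_pullback {G : E3 → Matrix (Fin 3) (Fin 3) ℝ} {φ : E3 → E3} {x : E3}
    (hG : ∀ a b, DifferentiableAt ℝ (fun y => G y a b) (φ x))
    (hsymm : (G (φ x)).IsSymm) (hdet : (G (φ x)).det ≠ 0)
    (hφ : ContDiffAt ℝ ∞ φ x) (hJ : (jac φ x).det ≠ 0) (i : Fin 3) :
    jac φ x * conn (fun y => (jac φ y).transpose * G (φ y) * jac φ y) i x =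
      matDeriv i (jac φ) x + (∑ b, jac φ x b i • conn G b (φ x)) * jac φ x := by
  have hJt : IsUnit (jac φ x).transpose.det := by
    rw [Matrix.det_transpose]; exact isUnit_iff_ne_zero.2 hJ
  have hg := isUnit_iff_ne_zero.2 hdet
  rw [conn_eq, lowConn_pullback hG hsymm hφ, Matrix.mul_smul, ← Matrix.mul_assoc,
    isUnit_det_jac_mul hJ, Matrix.mul_add, Matrix.mul_smul, smul_add, smul_smul]
  congr 1
  · norm_num
    rw [Matrix.mul_assoc (jac φ x).transpose, Matrix.mul_assoc,
      Matrix.nonsing_inv_mul_cancel_left _ _ hJt, Matrix.nonsing_inv_mul_cancel_left _ _ hg]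
  · simp only [conn_eq, Finset.mul_sum, Finset.sum_mul, Finset.smul_sum]
    refine Finset.sum_congr rfl fun b _ => ?_
    rw [Matrix.mul_smul, smul_comm, Matrix.smul_mul, Matrix.smul_mul]
    congr 2
    simp only [Matrix.mul_assoc]
    rw [Matrix.nonsing_inv_mul_cancel_left _ _ hJt]

/-- The transformation law of the curvature under a change of coordinates. -/
theorem jac_mul_curvMatrix_pullback {G : E3 → Matrix (Fin 3) (Fin 3) ℝ} {φ : E3 → E3}
    {U V : Set E3} (hU : IsOpen U) (hV : IsOpen V) (hφ : ContDiffOn ℝ ∞ φ V)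
    (hφV : MapsTo φ V U) (hG : SmoothEntriesOn G U) (hsymm : ∀ y ∈ U, (G y).IsSymm)
    (hdet : ∀ y ∈ U, (G y).det ≠ 0) (hJ : ∀ y ∈ V, (jac φ y).det ≠ 0) {x : E3} (hx : x ∈ V)
    (m i : Fin 3) :
    jac φ x * curvMatrix (fun y => (jac φ y).transpose * G (φ y) * jac φ y) m i x =
      (∑ d, ∑ b, (jac φ x d m * jac φ x b i) • curvMatrix G d b (φ x)) * jac φ x := by
  have hφa : ∀ y ∈ V, ContDiffAt ℝ ∞ φ y := fun y hy => hφ.contDiffAt (hV.mem_nhds hy)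
  have hφd : DifferentiableAt ℝ φ x := (hφa x hx).differentiableAt (by simp)
  have hJs : SmoothEntriesOn (jac φ) V := fun a b =>
    contDiffOn_pderiv hV ((EuclideanSpace.proj a : E3 →L[ℝ] ℝ).contDiff.comp_contDiffOn hφ) b
  have hGφ : SmoothEntriesOn (fun y => G (φ y)) V := fun a b => (hG a b).comp hφ hφV
  set G' : E3 → Matrix (Fin 3) (Fin 3) ℝ :=
    fun y => (jac φ y).transpose * G (φ y) * jac φ y with hG'
  have hG's : SmoothEntriesOn G' V := (hJs.transpose.mul hGφ).mul hJs
  have hG'det : ∀ y ∈ V, (G' y).det ≠ 0 := by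
    intro y hy
    simp only [hG', Matrix.det_mul, Matrix.det_transpose]
    exact mul_ne_zero (mul_ne_zero (hJ y hy) (hdet _ (hφV hy))) (hJ y hy)
  have hconn' : ∀ i, SmoothEntriesOn (conn G' i) V := fun i => hG's.conn hV hG'det i
  have hconn : ∀ i, SmoothEntriesOn (conn G i) U := fun i => hG.conn hU hdet i
  have hlaw : ∀ i, ∀ y ∈ V, jac φ y * conn G' i y =
      matDeriv i (jac φ) y + (∑ b, jac φ y b i • conn G b (φ y)) * jac φ y := fun i y hy =>
    jac_mul_conn_pullback (fun a b => hG.differentiableAt hU (hφV hy) a b) (hsymm _ (hφV hy))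
      (hdet _ (hφV hy)) (hφa y hy) (hJ y hy) i
  set A : Fin 3 → E3 → Matrix (Fin 3) (Fin 3) ℝ :=
    fun i y => ∑ b, jac φ y b i • conn G b (φ y) with hA
  have hAs : ∀ i, SmoothEntriesOn (A i) V := by
    intro i a b
    simp only [hA, Matrix.sum_apply, Matrix.smul_apply, smul_eq_mul]
    exact ContDiffOn.sum fun c _ => (hJs c i).mul ((hconn c a b).comp hφ hφV)
  have dif : ∀ {M : E3 → Matrix (Fin 3) (Fin 3) ℝ}, SmoothEntriesOn M V →
      ∀ a b, DifferentiableAt ℝ (fun y => M y a b) x := fun h a b => h.differentiableAt hV hx a b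
  have hder : ∀ m i, matDeriv m (jac φ) x * conn G' i x + jac φ x * matDeriv m (conn G' i) x =
      matDeriv m (matDeriv i (jac φ)) x +
        (matDeriv m (A i) x * jac φ x + A i x * matDeriv m (jac φ) x) := by
    intro m i
    have h1 := matDeriv_mul (dif hJs) (dif (hconn' i)) m
    have hAJ : SmoothEntriesOn (fun y => A i y * jac φ y) V := (hAs i).mul hJs
    have h2 : matDeriv m (fun y => jac φ y * conn G' i y) x =
        matDeriv m (fun y => matDeriv i (jac φ) y + A i y * jac φ y) x :=
      matDeriv_congr (by filter_upwards [hV.mem_nhds hx] with y hy using hlaw i y hy) m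
    rw [h1, matDeriv_add (dif (hJs.matDeriv hV i)) (dif hAJ),
      matDeriv_mul (dif (hAs i)) (dif hJs)] at h2
    exact h2
  have hthird : matDeriv m (matDeriv i (jac φ)) x = matDeriv i (matDeriv m (jac φ)) x := by
    ext a b
    exact pderiv_comm (((hJs a b).contDiffAt (hV.mem_nhds hx)).of_le
      (WithTop.coe_le_coe.2 le_top)) m i
  have hHsymm : ∀ b, matDeriv m (jac φ) x b i = matDeriv i (jac φ) x b m := by
    intro b
    have : ContDiffAt ℝ ∞ (fun y => φ y b) x :=
      (EuclideanSpace.proj b : E3 →L[ℝ] ℝ).contDiff.contDiffAt.comp x (hφa x hx)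
    exact pderiv_comm (this.of_le (WithTop.coe_le_coe.2 le_top)) m i
  have hdA : ∀ m i, matDeriv m (A i) x = ∑ b, (matDeriv m (jac φ) x b i • conn G b (φ x) +
      jac φ x b i • ∑ d, jac φ x d m • matDeriv d (conn G b) (φ x)) := by
    intro m i
    ext p q
    have hd : ∀ b, DifferentiableAt ℝ (fun y => conn G b (φ y) p q) x := fun b =>
      ((hconn b).differentiableAt hU (hφV hx) p q).comp x hφd
    simp only [matDeriv, hA, Matrix.sum_apply, Matrix.smul_apply, smul_eq_mul, Matrix.of_apply,
      Matrix.add_apply]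
    rw [pderiv_sum (f := fun b y => jac φ y b i * conn G b (φ y) p q) _
      (fun b _ => (dif hJs b i).mul (hd b))]
    refine Finset.sum_congr rfl fun b _ => ?_
    rw [pderiv_mul (dif hJs b i) (hd b),
      pderiv_comp ((hconn b).differentiableAt hU (hφV hx) p q) hφd]
  -- In the antisymmetrization in m and i the terms with second derivatives of φ drop out, so the
  -- curvature of the pulled back connection `A` is the pull-back of the curvature.
  have hcurvA : matDeriv m (A i) x - matDeriv i (A m) x + A m x * A i x - A i x * A m x =
      ∑ d, ∑ b, (jac φ x d m * jac φ x b i) • curvMatrix G d b (φ x) := by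
    rw [hdA m i, hdA i m]
    simp only [hA, curvMatrix, hHsymm, Fin.sum_univ_three, mul_add, add_mul, smul_add, smul_sub,
      smul_smul, Matrix.smul_mul, Matrix.mul_smul]
    module
  rw [← hcurvA]
  have l1 := hlaw m x hx
  have l2 := hlaw i x hx
  have d1 := hder m i
  have d2 := hder i m
  rw [hthird] at d1
  unfold curvMatrix
  -- The transformation law says that `conn G'` and `A` are related by the gauge transformation `jac
  -- φ`. Solving it for the derivative of the Jacobian and substituting into the differentiated law
  -- leaves the gauge covariance of curvature, a noncommutative polynomial identity.
  have hm : matDeriv m (jac φ) x = jac φ x * conn G' m x - A m x * jac φ x := by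
    rw [l1]; exact (add_sub_cancel_right _ _).symm
  have hi : matDeriv i (jac φ) x = jac φ x * conn G' i x - A i x * jac φ x := by
    rw [l2]; exact (add_sub_cancel_right _ _).symm
  rw [hm] at d1
  rw [hi] at d2
  have e1 : jac φ x * matDeriv m (conn G' i) x = _ := eq_sub_of_add_eq' d1
  have e2 : jac φ x * matDeriv i (conn G' m) x = _ := eq_sub_of_add_eq' d2
  rw [Matrix.mul_sub, Matrix.mul_add, Matrix.mul_sub, e1, e2]
  noncomm_ring

/-- The scalar curvature does not depend on the coordinates. -/
theorem scalarCurvature_pullback {G : E3 → Matrix (Fin 3) (Fin 3) ℝ} {φ : E3 → E3}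
    {U V : Set E3} (hU : IsOpen U) (hV : IsOpen V) (hφ : ContDiffOn ℝ ∞ φ V)
    (hφV : MapsTo φ V U) (hG : SmoothEntriesOn G U) (hsymm : ∀ y ∈ U, (G y).IsSymm)
    (hdet : ∀ y ∈ U, (G y).det ≠ 0) (hJ : ∀ y ∈ V, (jac φ y).det ≠ 0) {x : E3} (hx : x ∈ V) :
    scalarCurvature (fun y => (jac φ y).transpose * G (φ y) * jac φ y) x =
      scalarCurvature G (φ x) := by
  rw [scalarCurvature_eq_sum_curvMatrix, scalarCurvature_eq_sum_curvMatrix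
    (by filter_upwards [hU.mem_nhds (hφV hx)] with y hy using hsymm y hy)]
  swap
  · filter_upwards [hV.mem_nhds hx] with y hy
    simp only [Matrix.IsSymm, Matrix.transpose_mul, Matrix.transpose_transpose,
      (hsymm _ (hφV hy)).eq, Matrix.mul_assoc]
  have hJu := isUnit_iff_ne_zero.2 (hJ x hx)
  have hJt : IsUnit (jac φ x).transpose.det := by rwa [Matrix.det_transpose]
  have key : ∀ m i, curvMatrix (fun y => (jac φ y).transpose * G (φ y) * jac φ y) m i x *
      ((jac φ x).transpose * G (φ x) * jac φ x)⁻¹ =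
      (jac φ x)⁻¹ * (∑ d, ∑ b, (jac φ x d m * jac φ x b i) •
        (curvMatrix G d b (φ x) * (G (φ x))⁻¹)) * (jac φ x).transpose⁻¹ := by
    intro m i
    have h := jac_mul_curvMatrix_pullback hU hV hφ hφV hG hsymm hdet hJ hx m i
    have h' : curvMatrix (fun y => (jac φ y).transpose * G (φ y) * jac φ y) m i x =
        (jac φ x)⁻¹ * ((∑ d, ∑ b, (jac φ x d m * jac φ x b i) • curvMatrix G d b (φ x)) *
          jac φ x) := by
      rw [← h, ← Matrix.mul_assoc, Matrix.nonsing_inv_mul _ hJu, Matrix.one_mul]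
    rw [h', Matrix.mul_assoc, Matrix.mul_assoc, isUnit_det_jac_mul (hJ x hx)]
    simp only [Finset.sum_mul, Finset.mul_sum, Matrix.smul_mul, Matrix.mul_smul, Matrix.mul_assoc]
  simp only [key]
  generalize hK : (fun d b => curvMatrix G d b (φ x) * (G (φ x))⁻¹) = K
  have e1 : ∀ d b, curvMatrix G d b (φ x) * (G (φ x))⁻¹ = K d b := fun d b =>
    congrFun (congrFun hK d) b
  simp only [e1]
  -- The contraction over m and i supplies exactly the factors J and Jᵀ that cancel the inverses
  -- left by `key`.
  have hdb : ∀ d b, K d b =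
      jac φ x * ((jac φ x)⁻¹ * K d b * (jac φ x).transpose⁻¹) * (jac φ x).transpose := by
    intro d b
    rw [Matrix.mul_assoc, Matrix.mul_assoc, Matrix.nonsing_inv_mul _ hJt, Matrix.mul_one,
      Matrix.mul_nonsing_inv_cancel_left _ _ hJu]
  calc _ = ∑ d, ∑ b, (jac φ x * ((jac φ x)⁻¹ * K d b * (jac φ x).transpose⁻¹) *
        (jac φ x).transpose) d b := by
        simp only [Finset.sum_mul, Finset.mul_sum, Matrix.smul_mul, Matrix.mul_smul,
          Matrix.sum_apply, Matrix.smul_apply, smul_eq_mul]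
        generalize hL : (fun d b => (jac φ x)⁻¹ * K d b * (jac φ x).transpose⁻¹) = L
        have e2 : ∀ d b, (jac φ x)⁻¹ * K d b * (jac φ x).transpose⁻¹ = L d b := fun d b =>
          congrFun (congrFun hL d) b
        have swap : ∀ F : Fin 3 → Fin 3 → Fin 3 → ℝ,
            ∑ m, ∑ i, ∑ d, F m i d = ∑ d, ∑ m, ∑ i, F m i d := by
          intro F
          exact (Finset.sum_congr rfl fun m _ => Finset.sum_comm).trans Finset.sum_comm
        simp only [e2]
        rw [swap]
        refine Finset.sum_congr rfl fun d _ => ?_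
        rw [swap]
        refine Finset.sum_congr rfl fun b _ => ?_
        simp only [Matrix.mul_apply, Matrix.transpose_apply, Finset.sum_mul]
        rw [Finset.sum_comm]
        exact Finset.sum_congr rfl fun m _ => Finset.sum_congr rfl fun i _ => by ring
    _ = ∑ d, ∑ b, K d b d b :=
        Finset.sum_congr rfl fun d _ => Finset.sum_congr rfl fun b _ => by rw [← hdb]

end CoordGeometry
namespace CoordGeometry

/-! ### Conformally flat metrics -/

/-- For F = f² the hypothesis says that `p` is the logarithmic derivative of f. Stating it as a
product relation keeps logarithms out. -/
theorem christoffel_conformal {F : E3 → ℝ} {p : Fin 3 → E3 → ℝ} {x : E3}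
    (hF : DifferentiableAt ℝ F x) (hF0 : F x ≠ 0)
    (hp : ∀ i, pderiv i F x = 2 * F x * p i x) (k i j : Fin 3) :
    christoffel (fun y => F y • (1 : Matrix (Fin 3) (Fin 3) ℝ)) k i j x =
      p i x * (1 : Matrix (Fin 3) (Fin 3) ℝ) j k + p j x * (1 : Matrix (Fin 3) (Fin 3) ℝ) i k -
        p k x * (1 : Matrix (Fin 3) (Fin 3) ℝ) i j := by
  have hd : ∀ l a b, pderiv l (fun y => (F y • (1 : Matrix (Fin 3) (Fin 3) ℝ)) a b) x =
      2 * F x * p l x * (1 : Matrix (Fin 3) (Fin 3) ℝ) a b := by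
    intro l a b
    simp only [Matrix.smul_apply, smul_eq_mul]
    rw [pderiv_mul hF (differentiableAt_const _), pderiv_const, hp]; ring
  have hinv : (F x • (1 : Matrix (Fin 3) (Fin 3) ℝ))⁻¹ = (F x)⁻¹ • 1 := by
    apply Matrix.inv_eq_right_inv
    rw [Matrix.smul_mul, Matrix.mul_smul, smul_smul, mul_inv_cancel₀ hF0]; simp
  unfold christoffel
  simp only [hd, hinv]
  simp only [Matrix.smul_apply, smul_eq_mul]
  rw [Finset.sum_eq_single k]
  · rw [Matrix.one_apply_eq]; field_simp
  · intro b _ hb; rw [Matrix.one_apply_ne hb.symm]; ring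
  · simp

/-- The scalar curvature of a conformally flat metric in dimension three. -/
theorem scalarCurvature_conformal {F : E3 → ℝ} {p : Fin 3 → E3 → ℝ}
    (hF : Differentiable ℝ F) (hF0 : ∀ y, F y ≠ 0)
    (hpd : ∀ i, Differentiable ℝ (p i))
    (hp : ∀ i y, pderiv i F y = 2 * F y * p i y) (x : E3) :
    scalarCurvature (fun y => F y • (1 : Matrix (Fin 3) (Fin 3) ℝ)) x =
      (F x)⁻¹ * (-4 * ∑ i, pderiv i (p i) x - 2 * ∑ i, p i x ^ 2) := by
  have hc : ∀ k i j, christoffel (fun y => F y • (1 : Matrix (Fin 3) (Fin 3) ℝ)) k i j =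
      fun y => p i y * (1 : Matrix (Fin 3) (Fin 3) ℝ) j k
        + p j y * (1 : Matrix (Fin 3) (Fin 3) ℝ) i k
        - p k y * (1 : Matrix (Fin 3) (Fin 3) ℝ) i j := fun k i j => funext fun y =>
    christoffel_conformal (hF y) (hF0 y) (fun i => hp i y) k i j
  have hdc : ∀ l k i j, pderiv l (fun y => p i y * (1 : Matrix (Fin 3) (Fin 3) ℝ) j k
        + p j y * (1 : Matrix (Fin 3) (Fin 3) ℝ) i k
        - p k y * (1 : Matrix (Fin 3) (Fin 3) ℝ) i j) x =
      pderiv l (p i) x * (1 : Matrix (Fin 3) (Fin 3) ℝ) j k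
        + pderiv l (p j) x * (1 : Matrix (Fin 3) (Fin 3) ℝ) i k
        - pderiv l (p k) x * (1 : Matrix (Fin 3) (Fin 3) ℝ) i j := by
    intro l k i j
    have h1 : ∀ m (c : ℝ), DifferentiableAt ℝ (fun y => p m y * c) x := fun m c =>
      (hpd m x).mul_const c
    have h2 : ∀ m (c : ℝ), pderiv l (fun y => p m y * c) x = pderiv l (p m) x * c := by
      intro m c
      rw [pderiv_mul (hpd m x) (differentiableAt_const _), pderiv_const]; ring
    rw [pderiv_sub ((h1 _ _).fun_add (h1 _ _)) (h1 _ _), pderiv_add (h1 _ _) (h1 _ _), h2, h2, h2]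
  have hinv : (F x • (1 : Matrix (Fin 3) (Fin 3) ℝ))⁻¹ = (F x)⁻¹ • 1 := by
    apply Matrix.inv_eq_right_inv
    rw [Matrix.smul_mul, Matrix.mul_smul, smul_smul, mul_inv_cancel₀ (hF0 x)]; simp
  unfold scalarCurvature ricci
  simp only [hc, hdc, hinv]
  simp only [Matrix.smul_apply, smul_eq_mul, Fin.sum_univ_three, Matrix.one_apply]
  simp only [Fin.isValue, reduceIte, show ((0 : Fin 3) = 1) = False by decide,
    show ((0 : Fin 3) = 2) = False by decide, show ((1 : Fin 3) = 0) = False by decide,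
    show ((1 : Fin 3) = 2) = False by decide, show ((2 : Fin 3) = 0) = False by decide,
    show ((2 : Fin 3) = 1) = False by decide, if_false, mul_one, mul_zero]
  ring

/-! ### Dependence on parameters -/

/-- Joint smoothness in the parameter and the point, up to and including ε = 0, is what later makes
the estimates for the blown up metrics uniform on compact sets. A partial derivative in space is the
total derivative in a direction (0, eᵢ). -/
theorem contDiffOn_pderiv_param {f : ℝ × E3 → ℝ} {U : Set (ℝ × E3)} (hU : IsOpen U)
    (hf : ContDiffOn ℝ ∞ f U) (i : Fin 3) :
    ContDiffOn ℝ ∞ (fun q : ℝ × E3 => pderiv i (fun y => f (q.1, y)) q.2) U := by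
  have h1 : ContDiffOn ℝ ∞ (fun q => fderiv ℝ f q ((0 : ℝ), EuclideanSpace.single i (1 : ℝ))) U :=
    (hf.fderiv_of_isOpen hU (m := ∞) (by simp)).clm_apply contDiffOn_const
  refine h1.congr fun q hq => ?_
  have hd : DifferentiableAt ℝ f (q.1, q.2) :=
    (hf.differentiableOn (by simp)).differentiableAt (hU.mem_nhds hq)
  have h2 : HasFDerivAt (fun y => f (q.1, y))
      ((fderiv ℝ f (q.1, q.2)).comp (ContinuousLinearMap.inr ℝ ℝ E3)) q.2 :=
    hd.hasFDerivAt.comp q.2 (hasFDerivAt_prodMk_right q.1 q.2)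
  simp [pderiv, h2.fderiv]

theorem contDiffOn_christoffel_param {G : ℝ × E3 → Matrix (Fin 3) (Fin 3) ℝ} {U : Set (ℝ × E3)}
    (hU : IsOpen U) (hG : SmoothEntriesOn G U) (hdet : ∀ q ∈ U, (G q).det ≠ 0) (k i j : Fin 3) :
    ContDiffOn ℝ ∞ (fun q : ℝ × E3 => christoffel (fun y => G (q.1, y)) k i j q.2) U := by
  unfold christoffel
  refine contDiffOn_const.mul (ContDiffOn.sum fun l _ => (hG.inv hdet k l).mul ?_)
  exact ((contDiffOn_pderiv_param hU (hG _ _) _).add (contDiffOn_pderiv_param hU (hG _ _) _)).sub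
    (contDiffOn_pderiv_param hU (hG _ _) _)

theorem contDiffOn_scalarCurvature_param {G : ℝ × E3 → Matrix (Fin 3) (Fin 3) ℝ}
    {U : Set (ℝ × E3)}
    (hU : IsOpen U) (hG : SmoothEntriesOn G U) (hdet : ∀ q ∈ U, (G q).det ≠ 0) :
    ContDiffOn ℝ ∞ (fun q : ℝ × E3 => scalarCurvature (fun y => G (q.1, y)) q.2) U := by
  have hc := fun k i j => contDiffOn_christoffel_param hU hG hdet k i j
  unfold scalarCurvature ricci
  refine ContDiffOn.sum fun j _ => ContDiffOn.sum fun k _ => (hG.inv hdet j k).mul ?_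
  refine ContDiffOn.sum fun i _ => ContDiffOn.add ?_ (ContDiffOn.sum fun p _ => ?_)
  · exact (contDiffOn_pderiv_param hU (hc i j k) i).sub (contDiffOn_pderiv_param hU (hc i i j) k)
  · exact ((hc _ _ _).mul (hc _ _ _)).sub ((hc _ _ _).mul (hc _ _ _))

theorem continuousOn_scalarCurvature {G : E3 → Matrix (Fin 3) (Fin 3) ℝ} {U : Set E3}
    (hU : IsOpen U) (hG : SmoothEntriesOn G U) (hdet : ∀ q ∈ U, (G q).det ≠ 0) :
    ContinuousOn (scalarCurvature G) U := by
  have h := contDiffOn_scalarCurvature_param (G := fun q : ℝ × E3 => G q.2)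
    (U := univ ×ˢ U) (isOpen_univ.prod hU)
    (fun a b => (hG a b).comp contDiffOn_snd fun q hq => hq.2) fun q hq => hdet _ hq.2
  exact h.continuousOn.comp (f := fun y : E3 => ((0 : ℝ), y)) (by fun_prop) fun y hy => ⟨trivial, hy⟩

theorem scalarCurvature_congr {G G' : E3 → Matrix (Fin 3) (Fin 3) ℝ} {x : E3}
    (h : G =ᶠ[𝓝 x] G') : scalarCurvature G x = scalarCurvature G' x := by
  have h0 : ∀ k i j, christoffel G k i j =ᶠ[𝓝 x] christoffel G' k i j := by
    intro k i j
    filter_upwards [h.eventually_nhds] with y hy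
    have hyy : G =ᶠ[𝓝 y] G' := hy
    have e : ∀ l a b, pderiv l (fun z => G z a b) y = pderiv l (fun z => G' z a b) y :=
      fun l a b => pderiv_congr (hyy.mono fun z hz => by simp only [hz]) l
    unfold christoffel
    simp only [e, hyy.eq_of_nhds]
  have h1 : ∀ k i j l, pderiv l (christoffel G k i j) x = pderiv l (christoffel G' k i j) x :=
    fun k i j l => pderiv_congr (h0 k i j) l
  unfold scalarCurvature ricci
  simp only [h1, (h0 _ _ _).eq_of_nhds, h.eq_of_nhds]

/-! ### Scaling -/

/-- Christoffel symbols and the Ricci tensor ignore constant factors; only the inverse metric in the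
trace feels them. Singular matrices cause no exception, since their inverse is zero by convention.
-/
theorem scalarCurvature_const_smul {G : E3 → Matrix (Fin 3) (Fin 3) ℝ} {c : ℝ} (hc : c ≠ 0)
    (hG : ∀ a b, Differentiable ℝ (fun y => G y a b)) (x : E3) :
    scalarCurvature (fun y => c • G y) x = c⁻¹ * scalarCurvature G x := by
  have hinv : ∀ y, (c • G y)⁻¹ = c⁻¹ • (G y)⁻¹ := by
    intro y
    by_cases h : IsUnit (G y).det
    · exact Matrix.inv_smul' _ (Units.mk0 c hc) h
    · rw [Matrix.nonsing_inv_apply_not_isUnit _ h, Matrix.nonsing_inv_apply_not_isUnit, smul_zero]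
      rw [Matrix.det_smul]
      intro h'
      exact h (isUnit_of_mul_isUnit_right h')
  have h0 : ∀ k i j, christoffel (fun y => c • G y) k i j = christoffel G k i j := by
    intro k i j
    ext y
    unfold christoffel
    congr 1
    refine Finset.sum_congr rfl fun l _ => ?_
    simp only [hinv, Matrix.smul_apply, smul_eq_mul]
    simp only [pderiv_const_mul (hG _ _ y)]
    field_simp
  unfold scalarCurvature ricci
  simp only [h0, hinv, Matrix.smul_apply, smul_eq_mul, Finset.mul_sum, mul_assoc]

theorem jac_const_smul (ε : ℝ) (x : E3) : jac (fun y => ε • y) x = ε • 1 := by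
  ext a i
  have h : HasFDerivAt (fun y : E3 => (ε • y) a) (ε • (EuclideanSpace.proj a : E3 →L[ℝ] ℝ)) x :=
    (EuclideanSpace.proj a : E3 →L[ℝ] ℝ).hasFDerivAt.const_smul ε
  simp only [jac, Matrix.of_apply, pderiv, h.fderiv]
  simp [Matrix.one_apply]

/-- The scalar curvature of a metric blown up at the origin. -/
theorem scalarCurvature_comp_smul {G : E3 → Matrix (Fin 3) (Fin 3) ℝ} {ε : ℝ} (hε : ε ≠ 0)
    (hG : SmoothEntriesOn G univ) (hsymm : ∀ y, (G y).IsSymm) (hdet : ∀ y, (G y).det ≠ 0)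
    (x : E3) : scalarCurvature (fun y => G (ε • y)) x = ε ^ 2 * scalarCurvature G (ε • x) := by
  have hsm : ContDiff ℝ ∞ (fun y : E3 => ε • y) := contDiff_const_smul ε
  have h := scalarCurvature_pullback (φ := fun y => ε • y) isOpen_univ isOpen_univ
    hsm.contDiffOn (mapsTo_univ _ _) hG (fun y _ => hsymm y)
    (fun y _ => hdet y) (fun y _ => by simp [jac_const_smul, hε]) (mem_univ x)
  rw [← h]
  have e : (fun y : E3 => (jac (fun y => ε • y) y).transpose * G (ε • y) * jac (fun y => ε • y) y) =
      fun y => (ε ^ 2) • G (ε • y) := by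
    ext1 y
    simp [jac_const_smul, smul_smul, sq]
  have hd : ∀ a b, Differentiable ℝ (fun y => G (ε • y) a b) := fun a b =>
    ((contDiffOn_univ.1 (hG a b)).differentiable (by simp)).comp (hsm.differentiable (by simp))
  rw [e, scalarCurvature_const_smul (pow_ne_zero 2 hε) hd, mul_inv_cancel_left₀ (pow_ne_zero 2 hε)]

end CoordGeometry
section Charts
open CoordGeometry

variable {M : Type*} [TopologicalSpace M] [ChartedSpace (EuclideanSpace ℝ (Fin 3)) M]

/-! ### Fields of bilinear forms in charts -/

/-- The pull-back of a field `B` of bilinear forms on a vector space along a map `F`. -/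
def pullField {V : Type*} [NormedAddCommGroup V] [NormedSpace ℝ V] (F : M → V)
    (B : M → V →L[ℝ] V →L[ℝ] ℝ) : BilinField M := fun p =>
  let A : TangentSpace (𝓡 3) p →L[ℝ] V := mfderiv (𝓡 3) 𝓘(ℝ, V) F p
  ((ContinuousLinearMap.precomp ℝ A).comp (B p)).comp A

variable [IsManifold (𝓡 3) ∞ M]

/-- Read in the trivialization at `x₀`, the field is `B` composed on both sides with the derivative
of `F` in tangent coordinates. The round metric and the metrics prescribed in a chart are both of
this kind. -/
theorem contMDiffAt_pullField {V : Type*} [NormedAddCommGroup V] [NormedSpace ℝ V] {F : M → V}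
    {B : M → V →L[ℝ] V →L[ℝ] ℝ} {x₀ : M} (hF : ContMDiffAt (𝓡 3) 𝓘(ℝ, V) ∞ F x₀)
    (hB : ContMDiffAt (𝓡 3) 𝓘(ℝ, V →L[ℝ] V →L[ℝ] ℝ) ∞ B x₀) :
    ContMDiffAt (𝓡 3) ((𝓡 3).prod 𝓘(ℝ, E3 →L[ℝ] E3 →L[ℝ] ℝ)) ∞
      (fun p => TotalSpace.mk' (E3 →L[ℝ] E3 →L[ℝ] ℝ)
        (E := fun p : M => TangentSpace (𝓡 3) p →L[ℝ] TangentSpace (𝓡 3) p →L[ℝ] ℝ)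
        p (pullField F B p)) x₀ := by
  rw [contMDiffAt_section]
  have h1 := hF.mfderiv_const (m := ∞) (by simp)
  have h2 : ContMDiffAt (𝓡 3) 𝓘(ℝ, E3 →L[ℝ] E3 →L[ℝ] ℝ) ∞ (fun p =>
      let A := inTangentCoordinates (𝓡 3) 𝓘(ℝ, V) id F (mfderiv (𝓡 3) 𝓘(ℝ, V) F) x₀ p
      ((ContinuousLinearMap.precomp ℝ A).comp (B p)).comp A) x₀ :=
    ((h1.clm_precomp (F₃ := ℝ)).clm_comp hB).clm_comp h1
  refine h2.congr_of_eventuallyEq ?_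
  filter_upwards [(trivializationAt E3 (TangentSpace (𝓡 3) : M → Type _) x₀).open_baseSet.mem_nhds
    (FiberBundle.mem_baseSet_trivializationAt' x₀)] with p hp
  ext v w
  rw [hom_trivializationAt_apply]
  rw [inCoordinates_apply_eq₂ (E₃ := fun _ : M => ℝ) hp hp (by simp)]
  have hs : ∀ v, (trivializationAt E3 (TangentSpace (𝓡 3) : M → Type _) x₀).symm p v =
      (trivializationAt E3 (TangentSpace (𝓡 3) : M → Type _) x₀).symmL ℝ p v := fun v =>
    (Trivialization.symmL_apply _ hp v).symm
  simp only [ContinuousLinearMap.inCoordinates, inTangentCoordinates, hs]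
  simp [pullField]
  rfl

/-- The derivative of the inverse of a chart, as a map of the model space. -/
def chartFrame (e : OpenPartialHomeomorph M E3) (x : E3) : E3 →L[ℝ] E3 :=
  mfderiv (𝓡 3) (𝓡 3) e.symm x

/-- The derivative of a chart, as a map of the model space. -/
def chartCoframe (e : OpenPartialHomeomorph M E3) (p : M) : E3 →L[ℝ] E3 :=
  mfderiv (𝓡 3) (𝓡 3) e p

/-- A field of bilinear forms, with the tangent spaces identified with the model space. -/
def fieldVal (T : BilinField M) (p : M) (v w : E3) : ℝ := T p v w

omit [IsManifold (𝓡 3) ∞ M] in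
theorem chartCoeff_eq (T : BilinField M) (e : OpenPartialHomeomorph M E3) (x : E3) (i j : Fin 3) :
    chartCoeff T e x i j = fieldVal T (e.symm x) (chartFrame e x (EuclideanSpace.single i 1))
      (chartFrame e x (EuclideanSpace.single j 1)) := rfl

variable {e e' : OpenPartialHomeomorph M E3}

omit [IsManifold (𝓡 3) ∞ M] in
theorem mdifferentiableAt_chart_symm (he : e ∈ IsManifold.maximalAtlas (𝓡 3) ∞ M) {x : E3}
    (hx : x ∈ e.target) : MDifferentiableAt (𝓡 3) (𝓡 3) e.symm x :=
  ((contMDiffOn_symm_of_mem_maximalAtlas he).contMDiffAt (e.open_target.mem_nhds hx)).mdifferentiableAt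
    (by simp)

omit [IsManifold (𝓡 3) ∞ M] in
theorem mdifferentiableAt_chart (he : e ∈ IsManifold.maximalAtlas (𝓡 3) ∞ M) {p : M}
    (hp : p ∈ e.source) : MDifferentiableAt (𝓡 3) (𝓡 3) e p :=
  ((contMDiffOn_of_mem_maximalAtlas he).contMDiffAt (e.open_source.mem_nhds hp)).mdifferentiableAt
    (by simp)

theorem chartCoframe_chartFrame (he : e ∈ IsManifold.maximalAtlas (𝓡 3) ∞ M) {x : E3}
    (hx : x ∈ e.target) (v : E3) : chartCoframe e (e.symm x) (chartFrame e x v) = v := by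
  have h1 := mdifferentiableAt_chart_symm he hx
  have h2 := mdifferentiableAt_chart he (e.map_target hx)
  have h3 := mfderiv_comp x h2 h1
  have h4 : mfderiv (𝓡 3) (𝓡 3) (e ∘ e.symm) x = ContinuousLinearMap.id ℝ _ := by
    rw [← mfderiv_id]
    apply Filter.EventuallyEq.mfderiv_eq
    filter_upwards [e.open_target.mem_nhds hx] with y hy using e.right_inv hy
  rw [h4] at h3
  exact (congrArg (fun L : E3 →L[ℝ] E3 => L v) h3).symm

theorem chartFrame_chartCoframe (he : e ∈ IsManifold.maximalAtlas (𝓡 3) ∞ M) {p : M}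
    (hp : p ∈ e.source) (v : E3) : chartFrame e (e p) (chartCoframe e p v) = v := by
  have h1 := mdifferentiableAt_chart_symm he (e.map_source hp)
  have h2 := mdifferentiableAt_chart he hp
  have h3 := mfderiv_comp p h1 h2
  have h4 : mfderiv (𝓡 3) (𝓡 3) (e.symm ∘ e) p = ContinuousLinearMap.id ℝ _ := by
    rw [← mfderiv_id]
    apply Filter.EventuallyEq.mfderiv_eq
    filter_upwards [e.open_source.mem_nhds hp] with y hy using e.left_inv hy
  rw [h4] at h3
  exact (congrArg (fun L : E3 →L[ℝ] E3 => L v) h3).symm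

omit [IsManifold (𝓡 3) ∞ M] in
/-- The bilinear form at a point as a continuous bilinear form on the model space. -/
theorem fieldVal_eq_sum (T : BilinField M) (p : M) (L : E3 →L[ℝ] E3) (v w : E3) :
    fieldVal T p (L v) (L w) = ∑ i, ∑ j, v i * w j *
      fieldVal T p (L (EuclideanSpace.single i 1)) (L (EuclideanSpace.single j 1)) := by
  have hv : ∀ v : E3, L v = ∑ d, v d • L (EuclideanSpace.single d (1 : ℝ)) := by
    intro v
    conv_lhs => rw [show v = ∑ d, v d • EuclideanSpace.single d (1 : ℝ) by
      ext k; simp [Finset.sum_apply, Pi.single_apply]]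
    simp
  let b : E3 →L[ℝ] E3 →L[ℝ] ℝ := T p
  change b (L v) (L w) = ∑ i, ∑ j, v i * w j *
    b (L (EuclideanSpace.single i 1)) (L (EuclideanSpace.single j 1))
  rw [hv v, hv w]
  simp only [map_sum, map_smul, sum_apply, smul_apply, smul_eq_mul, Finset.mul_sum, mul_assoc]
  rw [Finset.sum_comm]
  exact Finset.sum_congr rfl fun _ _ => Finset.sum_congr rfl fun _ _ => by ring

omit [IsManifold (𝓡 3) ∞ M] in
theorem fieldVal_chartFrame (T : BilinField M) (e : OpenPartialHomeomorph M E3) (x v w : E3) :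
    fieldVal T (e.symm x) (chartFrame e x v) (chartFrame e x w) =
      ∑ i, ∑ j, v i * w j * chartCoeff T e x i j :=
  fieldVal_eq_sum T _ _ v w

theorem fieldVal_eq_chartCoeff (he : e ∈ IsManifold.maximalAtlas (𝓡 3) ∞ M) (T : BilinField M)
    {p : M} (hp : p ∈ e.source) (v w : E3) :
    fieldVal T p v w = ∑ i, ∑ j, chartCoframe e p v i * chartCoframe e p w j *
      chartCoeff T e (e p) i j := by
  rw [← fieldVal_chartFrame, e.left_inv hp, chartFrame_chartCoframe he hp,
    chartFrame_chartCoframe he hp]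

theorem chartFrame_change (he : e ∈ IsManifold.maximalAtlas (𝓡 3) ∞ M)
    (he' : e' ∈ IsManifold.maximalAtlas (𝓡 3) ∞ M) {y : E3} (hy : y ∈ e'.target)
    (hy' : e'.symm y ∈ e.source) (v : E3) :
    chartFrame e' y v = chartFrame e (e (e'.symm y)) (fderiv ℝ (fun z => e (e'.symm z)) y v) := by
  have h1 := mdifferentiableAt_chart_symm he' hy
  have h2 := mdifferentiableAt_chart he hy'
  have h3 := mfderiv_comp y h2 h1
  have h4 : fderiv ℝ (fun z => e (e'.symm z)) y v = chartCoframe e (e'.symm y) (chartFrame e' y v) := by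
    rw [← mfderiv_eq_fderiv]
    exact congrArg (fun L : E3 →L[ℝ] E3 => L v) h3
  rw [h4, chartFrame_chartCoframe he hy']

omit [IsManifold (𝓡 3) ∞ M] in
theorem contDiffOn_transition (he : e ∈ IsManifold.maximalAtlas (𝓡 3) ∞ M)
    (he' : e' ∈ IsManifold.maximalAtlas (𝓡 3) ∞ M) :
    ContDiffOn ℝ ∞ (fun z => e (e'.symm z)) (e'.target ∩ e'.symm ⁻¹' e.source) := by
  rw [← contMDiffOn_iff_contDiffOn]
  exact (contMDiffOn_of_mem_maximalAtlas he).comp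
    ((contMDiffOn_symm_of_mem_maximalAtlas he').mono inter_subset_left) fun z hz => hz.2

omit [ChartedSpace (EuclideanSpace ℝ (Fin 3)) M] [IsManifold (𝓡 3) ∞ M] in
theorem isOpen_transition_source : IsOpen (e'.target ∩ e'.symm ⁻¹' e.source) :=
  e'.symm.isOpen_inter_preimage e.open_source

theorem jac_apply_of_differentiableAt {φ : E3 → E3} {x : E3} (hφ : DifferentiableAt ℝ φ x)
    (a i : Fin 3) : jac φ x a i = fderiv ℝ φ x (EuclideanSpace.single i 1) a := by
  have h2 : HasFDerivAt (fun y => φ y a) ((EuclideanSpace.proj a : E3 →L[ℝ] ℝ).comp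
      (fderiv ℝ φ x)) x :=
    (EuclideanSpace.proj a : E3 →L[ℝ] ℝ).hasFDerivAt.comp x hφ.hasFDerivAt
  simp only [jac, Matrix.of_apply, pderiv, h2.fderiv]; rfl

/-- The transformation law of the components of a field of bilinear forms. -/
theorem chartCoeff_change (he : e ∈ IsManifold.maximalAtlas (𝓡 3) ∞ M)
    (he' : e' ∈ IsManifold.maximalAtlas (𝓡 3) ∞ M) (T : BilinField M) {y : E3}
    (hy : y ∈ e'.target) (hy' : e'.symm y ∈ e.source) :
    chartCoeff T e' y = (jac (fun z => e (e'.symm z)) y).transpose *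
      chartCoeff T e (e (e'.symm y)) * jac (fun z => e (e'.symm z)) y := by
  have hd : DifferentiableAt ℝ (fun z => e (e'.symm z)) y :=
    ((contDiffOn_transition he he').differentiableOn (by simp)).differentiableAt
      (isOpen_transition_source.mem_nhds ⟨hy, hy'⟩)
  ext i j
  rw [chartCoeff_eq, chartFrame_change he he' hy hy', chartFrame_change he he' hy hy']
  conv_lhs => rw [← e.left_inv hy']
  rw [e.left_inv hy']
  have := fieldVal_chartFrame T e (e (e'.symm y))
    (fderiv ℝ (fun z => e (e'.symm z)) y (EuclideanSpace.single i 1))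
    (fderiv ℝ (fun z => e (e'.symm z)) y (EuclideanSpace.single j 1))
  rw [e.left_inv hy'] at this
  rw [this]
  simp only [Matrix.mul_apply, Matrix.transpose_apply, jac_apply_of_differentiableAt hd,
    Finset.sum_mul]
  rw [Finset.sum_comm]
  exact Finset.sum_congr rfl fun a _ => Finset.sum_congr rfl fun b _ => by ring

/-- A vector in the kernel of the Jacobian would be killed by `chartFrame e'`, which has the left
inverse `chartCoframe e'`. -/
theorem jac_transition_det_ne_zero (he : e ∈ IsManifold.maximalAtlas (𝓡 3) ∞ M)
    (he' : e' ∈ IsManifold.maximalAtlas (𝓡 3) ∞ M) {y : E3}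
    (hy : y ∈ e'.target) (hy' : e'.symm y ∈ e.source) :
    (jac (fun z => e (e'.symm z)) y).det ≠ 0 := by
  have hd : DifferentiableAt ℝ (fun z => e (e'.symm z)) y :=
    ((contDiffOn_transition he he').differentiableOn (by simp)).differentiableAt
      (isOpen_transition_source.mem_nhds ⟨hy, hy'⟩)
  intro h0
  obtain ⟨v, hv, hv0⟩ := Matrix.exists_mulVec_eq_zero_iff.2 h0
  have h1 : fderiv ℝ (fun z => e (e'.symm z)) y (WithLp.toLp 2 v) = 0 := by
    ext a
    have := congrFun hv0 a
    simp only [Matrix.mulVec, dotProduct, jac_apply_of_differentiableAt hd] at this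
    have hs : WithLp.toLp 2 v = ∑ d, v d • EuclideanSpace.single d (1 : ℝ) := by
      ext k; simp [Finset.sum_apply, Pi.single_apply]
    rw [hs]
    simp only [map_sum, map_smul]
    simpa [mul_comm] using this
  have h2 := chartFrame_change he he' hy hy' (WithLp.toLp 2 v)
  rw [h1, map_zero] at h2
  have h3 := chartCoframe_chartFrame he' hy (WithLp.toLp 2 v)
  rw [h2, map_zero] at h3
  exact hv (by simpa using congrArg WithLp.ofLp h3.symm)

/-! ### Smooth metrics in charts -/

theorem contMDiffAt_chartFrame (he : e ∈ IsManifold.maximalAtlas (𝓡 3) ∞ M) {x : E3}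
    (hx : x ∈ e.target) (v : E3) :
    ContMDiffAt (𝓡 3) (𝓡 3).tangent ∞ (fun x => (TotalSpace.mk' E3 (e.symm x)
      (chartFrame e x v : TangentSpace (𝓡 3) (e.symm x)) : TangentBundle (𝓡 3) M)) x := by
  have h0 : ContMDiffAt (𝓡 3) (𝓡 3) ∞ e.symm x :=
    (contMDiffOn_symm_of_mem_maximalAtlas he).contMDiffAt (e.open_target.mem_nhds hx)
  have h1 := h0.mfderiv_const (m := ∞) (by simp)
  have h2 : ContMDiffAt (𝓡 3) (𝓡 3).tangent ∞ (fun x : EuclideanSpace ℝ (Fin 3) => (TotalSpace.mk' E3 x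
      (v : TangentSpace (𝓡 3) x) : TangentBundle (𝓡 3) (EuclideanSpace ℝ (Fin 3)))) x := by
    exact (contMDiffAt_vectorSpace_iff_contDiffAt (V := fun _ => v)).2 contDiffAt_const
  exact ContMDiffAt.clm_apply_of_inCoordinates (b₁ := id) (b₂ := e.symm)
    (ϕ := fun x => mfderiv (𝓡 3) (𝓡 3) e.symm x) h1 h2 h0

theorem SmoothMetric.smoothEntriesOn (h : SmoothMetric M)
    (he : e ∈ IsManifold.maximalAtlas (𝓡 3) ∞ M) :
    SmoothEntriesOn (chartCoeff h.inner e) e.target := by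
  intro i j x hx
  apply ContDiffAt.contDiffWithinAt
  rw [← contMDiffAt_iff_contDiffAt]
  have h0 : ContMDiffAt (𝓡 3) (𝓡 3) ∞ e.symm x :=
    (contMDiffOn_symm_of_mem_maximalAtlas he).contMDiffAt (e.open_target.mem_nhds hx)
  have : ContMDiffAt (𝓡 3) ((𝓡 3).prod 𝓘(ℝ)) ∞
      (fun x ↦ TotalSpace.mk' ℝ (E := Bundle.Trivial M ℝ) (e.symm x) (h.inner (e.symm x)
        (chartFrame e x (EuclideanSpace.single i 1) : TangentSpace (𝓡 3) (e.symm x))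
        (chartFrame e x (EuclideanSpace.single j 1) : TangentSpace (𝓡 3) (e.symm x)))) x := by
    apply ContMDiffAt.clm_bundle_apply₂ (F₁ := E3) (F₂ := E3)
    · exact ContMDiffAt.comp x h.contMDiff.contMDiffAt h0
    · exact contMDiffAt_chartFrame he hx _
    · exact contMDiffAt_chartFrame he hx _
  simp only [contMDiffAt_totalSpace] at this
  exact this.2

theorem SmoothMetric.chartCoeff_symm (h : SmoothMetric M) (e : OpenPartialHomeomorph M E3)
    (x : E3) : (chartCoeff h.inner e x).IsSymm := by
  ext i j
  exact h.symm _ _ _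

theorem SmoothMetric.posDef_chartCoeff (h : SmoothMetric M)
    (he : e ∈ IsManifold.maximalAtlas (𝓡 3) ∞ M) {x : E3} (hx : x ∈ e.target) :
    (chartCoeff h.inner e x).PosDef := by
  rw [Matrix.posDef_iff_dotProduct_mulVec]
  refine ⟨by
    rw [Matrix.IsHermitian, Matrix.conjTranspose_eq_transpose_of_trivial]
    exact (h.chartCoeff_symm e x).eq, fun v hv => ?_⟩
  have h1 := fieldVal_chartFrame h.inner e x (WithLp.toLp 2 v) (WithLp.toLp 2 v)
  have h2 : chartFrame e x (WithLp.toLp 2 v) ≠ 0 := by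
    intro h0
    have h3 := chartCoframe_chartFrame he hx (WithLp.toLp 2 v)
    rw [h0, map_zero] at h3
    exact hv (by simpa using congrArg WithLp.ofLp h3.symm)
  have h4 := h.pos (e.symm x) _ h2
  have h5 : star v ⬝ᵥ (chartCoeff h.inner e x).mulVec v =
      ∑ i, ∑ j, v i * v j * chartCoeff h.inner e x i j := by
    simp only [dotProduct, Matrix.mulVec, Finset.mul_sum, star_trivial]
    exact Finset.sum_congr rfl fun a _ => Finset.sum_congr rfl fun b _ => by ring
  rw [h5, ← h1]
  exact h4

/-- The definition uses a chart that changes with the point in an uncontrolled way. Coordinate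
invariance allows one fixed chart, and with it continuity and explicit computation. -/
theorem scalarCurv_eq (h : SmoothMetric M) (he : e ∈ IsManifold.maximalAtlas (𝓡 3) ∞ M) {p : M}
    (hp : p ∈ e.source) :
    scalarCurv h p = scalarCurvature (chartCoeff h.inner e) (e p) := by
  unfold scalarCurv
  set e' := chartAt (EuclideanSpace ℝ (Fin 3)) p with he'd
  have he' : e' ∈ IsManifold.maximalAtlas (𝓡 3) ∞ M := IsManifold.chart_mem_maximalAtlas p
  have hp' : p ∈ e'.source := mem_chart_source _ p
  have hy : e' p ∈ e'.target ∩ e'.symm ⁻¹' e.source := by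
    refine ⟨e'.map_source hp', ?_⟩
    rw [mem_preimage, e'.left_inv hp']; exact hp
  have hev : chartCoeff h.inner e' =ᶠ[𝓝 (e' p)] fun y =>
      (jac (fun z => e (e'.symm z)) y).transpose *
        chartCoeff h.inner e (e (e'.symm y)) * jac (fun z => e (e'.symm z)) y := by
    filter_upwards [isOpen_transition_source.mem_nhds hy] with y hy
    exact chartCoeff_change he he' _ hy.1 hy.2
  rw [scalarCurvature_congr hev, scalarCurvature_pullback (U := e.target) e.open_target
    isOpen_transition_source (contDiffOn_transition he he') (fun y hy => e.map_source hy.2)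
    (h.smoothEntriesOn he) (fun y _ => h.chartCoeff_symm e y)
    (fun y hy => (h.posDef_chartCoeff he hy).det_pos.ne')
    (fun y hy => jac_transition_det_ne_zero he he' hy.1 hy.2) hy, e'.left_inv hp']

theorem continuous_scalarCurv (h : SmoothMetric M) : Continuous (scalarCurv h) := by
  rw [continuous_iff_continuousAt]
  intro p
  set e := chartAt (EuclideanSpace ℝ (Fin 3)) p
  have he : e ∈ IsManifold.maximalAtlas (𝓡 3) ∞ M := IsManifold.chart_mem_maximalAtlas p
  have hp : p ∈ e.source := mem_chart_source _ p
  have hc : ContinuousOn (scalarCurvature (chartCoeff h.inner e)) e.target :=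
    continuousOn_scalarCurvature e.open_target (h.smoothEntriesOn he)
      fun y hy => (h.posDef_chartCoeff he hy).det_pos.ne'
  have h1 : ContinuousAt (fun q => scalarCurvature (chartCoeff h.inner e) (e q)) p :=
    ContinuousAt.comp (g := scalarCurvature (chartCoeff h.inner e)) (hc.continuousAt (e.open_target.mem_nhds (e.map_source hp)))
      (e.continuousAt hp)
  refine h1.congr ?_
  filter_upwards [e.open_source.mem_nhds hp] with q hq using (scalarCurv_eq h he hq).symm

end Charts
section Integration
open CoordGeometry

variable {M : Type*} [TopologicalSpace M] [ChartedSpace (EuclideanSpace ℝ (Fin 3)) M]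
  [IsManifold (𝓡 3) ∞ M] {e e' : OpenPartialHomeomorph M E3}

/-! ### The gradient in charts -/

/-- The components of a differential change by Pᵀ and the inverse Gram matrix by P⁻¹ and its
transpose, so the factors cancel. -/
theorem sum_inv_congruence {P H : Matrix (Fin 3) (Fin 3) ℝ} (hP : P.det ≠ 0) (d : Fin 3 → ℝ) :
    ∑ i, ∑ j, (P.transpose * H * P)⁻¹ i j * (∑ a, P a i * d a) * (∑ a, P a j * d a) =
      ∑ i, ∑ j, H⁻¹ i j * d i * d j := by
  have hPu := isUnit_iff_ne_zero.2 hP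
  have hPt : IsUnit P.transpose.det := by rwa [Matrix.det_transpose]
  have key : ∀ (A : Matrix (Fin 3) (Fin 3) ℝ) (c : Fin 3 → ℝ),
      ∑ i, ∑ j, A i j * c i * c j = c ⬝ᵥ A.mulVec c := by
    intro A c
    simp only [dotProduct, Matrix.mulVec, Finset.mul_sum]
    exact Finset.sum_congr rfl fun _ _ => Finset.sum_congr rfl fun _ _ => by ring
  have hc : (fun i => ∑ a, P a i * d a) = P.transpose.mulVec d := rfl
  rw [key (P.transpose * H * P)⁻¹ (fun i => ∑ a, P a i * d a), key, hc, Matrix.mul_inv_rev,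
    Matrix.mul_inv_rev, Matrix.mulVec_mulVec, Matrix.mulVec_transpose,
    ← Matrix.dotProduct_mulVec, Matrix.mulVec_mulVec, ← Matrix.mul_assoc P, ← Matrix.mul_assoc P,
    Matrix.mul_nonsing_inv _ hPu, Matrix.one_mul, Matrix.mul_assoc,
    Matrix.nonsing_inv_mul _ hPt, Matrix.mul_one]

/-- The squared norm of the gradient in coordinates. -/
def coordGradSq (G : E3 → Matrix (Fin 3) (Fin 3) ℝ) (v : E3 → ℝ) (x : E3) : ℝ :=
  ∑ i, ∑ j, (G x)⁻¹ i j * pderiv i v x * pderiv j v x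

theorem gradNormSq_eq (h : SmoothMetric M) (he : e ∈ IsManifold.maximalAtlas (𝓡 3) ∞ M) {p : M}
    (hp : p ∈ e.source) {u : M → ℝ} (hu : MDifferentiableAt (𝓡 3) 𝓘(ℝ, ℝ) u p) :
    gradNormSq h u p = coordGradSq (chartCoeff h.inner e) (fun x => u (e.symm x)) (e p) := by
  set P : Matrix (Fin 3) (Fin 3) ℝ := Matrix.of fun a i =>
    chartFrame e (e p) (EuclideanSpace.single i 1) a with hP
  set H : Matrix (Fin 3) (Fin 3) ℝ := Matrix.of fun i j =>
    fieldVal h.inner p (EuclideanSpace.single i 1) (EuclideanSpace.single j 1) with hH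
  have hx := e.map_source hp
  have hPdet : P.det ≠ 0 := by
    intro h0
    obtain ⟨v, hv, hv0⟩ := Matrix.exists_mulVec_eq_zero_iff.2 h0
    have h1 : chartFrame e (e p) (WithLp.toLp 2 v) = 0 := by
      ext a
      have := congrFun hv0 a
      simp only [Matrix.mulVec, dotProduct, hP, Matrix.of_apply] at this
      have hs : WithLp.toLp 2 v = ∑ d, v d • EuclideanSpace.single d (1 : ℝ) := by
        ext k; simp [Finset.sum_apply, Pi.single_apply]
      rw [hs]
      simp only [map_sum, map_smul]
      simpa [mul_comm] using this
    have h3 := chartCoframe_chartFrame he hx (WithLp.toLp 2 v)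
    rw [h1, map_zero] at h3
    exact hv (by simpa using congrArg WithLp.ofLp h3.symm)
  have hG : chartCoeff h.inner e (e p) = P.transpose * H * P := by
    ext i j
    have := fieldVal_eq_sum h.inner p (ContinuousLinearMap.id ℝ E3)
      (chartFrame e (e p) (EuclideanSpace.single i 1))
      (chartFrame e (e p) (EuclideanSpace.single j 1))
    simp only [ContinuousLinearMap.id_apply] at this
    rw [chartCoeff_eq, e.left_inv hp, this]
    simp only [Matrix.mul_apply, Matrix.transpose_apply, hP, hH, Matrix.of_apply, Finset.sum_mul]
    rw [Finset.sum_comm]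
    exact Finset.sum_congr rfl fun a _ => Finset.sum_congr rfl fun b _ => by ring
  let du : E3 →L[ℝ] ℝ := mfderiv (𝓡 3) 𝓘(ℝ, ℝ) u p
  have hdu : ∀ i, pderiv i (fun x => u (e.symm x)) (e p) =
      ∑ a, P a i * du (EuclideanSpace.single a 1) := by
    intro i
    have h1 := mdifferentiableAt_chart_symm he hx
    have hu' : MDifferentiableAt (𝓡 3) 𝓘(ℝ, ℝ) u (e.symm (e p)) := by rwa [e.left_inv hp]
    have h3 := mfderiv_comp (e p) hu' h1
    have h4 : fderiv ℝ (fun x => u (e.symm x)) (e p) (EuclideanSpace.single i 1) =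
        (mfderiv (𝓡 3) 𝓘(ℝ, ℝ) u (e.symm (e p)) : E3 →L[ℝ] ℝ)
          (chartFrame e (e p) (EuclideanSpace.single i 1)) := by
      rw [← mfderiv_eq_fderiv]
      exact congrArg (fun L : E3 →L[ℝ] ℝ => L (EuclideanSpace.single i 1)) h3
    rw [pderiv, h4, e.left_inv hp]
    change du _ = _
    set c := chartFrame e (e p) (EuclideanSpace.single i 1)
    conv_lhs => rw [show c = ∑ d, c d • EuclideanSpace.single d (1 : ℝ) by
      ext k; simp [Finset.sum_apply, Pi.single_apply]]
    simp [hP, c]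
  unfold coordGradSq
  simp only [hdu, hG]
  rw [sum_inv_congruence hPdet]
  rfl

theorem continuous_gradNormSq (h : SmoothMetric M) {u : M → ℝ}
    (hu : ContMDiff (𝓡 3) 𝓘(ℝ, ℝ) ∞ u) : Continuous (gradNormSq h u) := by
  rw [continuous_iff_continuousAt]
  intro p
  set e := chartAt (EuclideanSpace ℝ (Fin 3)) p
  have he : e ∈ IsManifold.maximalAtlas (𝓡 3) ∞ M := IsManifold.chart_mem_maximalAtlas p
  have hp : p ∈ e.source := mem_chart_source _ p
  have hv : ContDiffOn ℝ ∞ (fun x => u (e.symm x)) e.target := by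
    rw [← contMDiffOn_iff_contDiffOn]
    exact hu.comp_contMDiffOn (contMDiffOn_symm_of_mem_maximalAtlas he)
  have hc : ContinuousOn (coordGradSq (chartCoeff h.inner e) fun x => u (e.symm x)) e.target := by
    unfold coordGradSq
    refine continuousOn_finsetSum _ fun i _ => continuousOn_finsetSum _ fun j _ => ?_
    exact ((((h.smoothEntriesOn he).inv (fun y hy => (h.posDef_chartCoeff he hy).det_pos.ne')
      i j).continuousOn).mul (contDiffOn_pderiv e.open_target hv i).continuousOn).mul
      (contDiffOn_pderiv e.open_target hv j).continuousOn
  have h1 : ContinuousAt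
      (fun q => coordGradSq (chartCoeff h.inner e) (fun x => u (e.symm x)) (e q)) p :=
    ContinuousAt.comp (g := coordGradSq (chartCoeff h.inner e) fun x => u (e.symm x))
      (hc.continuousAt (e.open_target.mem_nhds (e.map_source hp))) (e.continuousAt hp)
  refine h1.congr ?_
  filter_upwards [e.open_source.mem_nhds hp] with q hq using
    (gradNormSq_eq h he hq ((hu q).mdifferentiableAt (by simp))).symm

/-! ### The volume measure in a chart -/

theorem det_fderiv_eq_jac {φ : E3 → E3} {x : E3} (hφ : DifferentiableAt ℝ φ x) :
    (fderiv ℝ φ x).det = (jac φ x).det := by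
  have h : LinearMap.toMatrix (EuclideanSpace.basisFun (Fin 3) ℝ).toBasis
      (EuclideanSpace.basisFun (Fin 3) ℝ).toBasis (fderiv ℝ φ x : E3 →ₗ[ℝ] E3) = jac φ x := by
    ext a i
    rw [LinearMap.toMatrix_apply, jac_apply_of_differentiableAt hφ]
    simp
  rw [ContinuousLinearMap.det, ← LinearMap.det_toMatrix (EuclideanSpace.basisFun (Fin 3) ℝ).toBasis,
    h]

/-- The density of the Riemannian volume in a chart. -/
def volDensity (h : SmoothMetric M) (e : OpenPartialHomeomorph M E3) (x : E3) : ℝ :=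
  Real.sqrt (chartCoeff h.inner e x).det

/-- The contribution of a chart to the Riemannian volume. -/
def chartVolume [MeasurableSpace M] (h : SmoothMetric M) (e : OpenPartialHomeomorph M E3) :
    Measure M :=
  (((volume : Measure (EuclideanSpace ℝ (Fin 3))).restrict e.target).withDensity
      (fun x => ENNReal.ofReal (volDensity h e x))).map e.symm

variable [MeasurableSpace M] [BorelSpace M]

theorem aemeasurable_chart_symm (h : SmoothMetric M) (e : OpenPartialHomeomorph M E3) :
    AEMeasurable e.symm (((volume : Measure (EuclideanSpace ℝ (Fin 3))).restrict
      e.target).withDensity (fun x => ENNReal.ofReal (volDensity h e x))) :=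
  (e.continuousOn_symm.aemeasurable e.open_target.measurableSet).mono_ac
    (withDensity_absolutelyContinuous _ _)

theorem chartVolume_apply (h : SmoothMetric M) (e : OpenPartialHomeomorph M E3) {A : Set M}
    (hA : MeasurableSet A) : chartVolume h e A =
      ∫⁻ x in e.symm ⁻¹' A ∩ e.target, ENNReal.ofReal (volDensity h e x) := by
  rw [chartVolume, Measure.map_apply_of_aemeasurable (aemeasurable_chart_symm h e) hA,
    withDensity_apply', Measure.restrict_restrict' e.open_target.measurableSet]

omit [MeasurableSpace M] [BorelSpace M] in
theorem volDensity_change (h : SmoothMetric M) (he : e ∈ IsManifold.maximalAtlas (𝓡 3) ∞ M)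
    (he' : e' ∈ IsManifold.maximalAtlas (𝓡 3) ∞ M) {y : E3}
    (hy : y ∈ e'.target) (hy' : e'.symm y ∈ e.source) :
    volDensity h e' y =
      |(jac (fun z => e (e'.symm z)) y).det| * volDensity h e (e (e'.symm y)) := by
  rw [volDensity, chartCoeff_change he he' _ hy hy', Matrix.det_mul, Matrix.det_mul,
    Matrix.det_transpose, mul_right_comm, ← sq, Real.sqrt_mul (sq_nonneg _), Real.sqrt_sq_eq_abs]
  rfl

theorem measurableSet_preimage_chart_symm (e : OpenPartialHomeomorph M E3) {A : Set M}
    (hA : MeasurableSet A) : MeasurableSet (e.symm ⁻¹' A ∩ e.target) := by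
  have h : Measurable (e.target.domRestrict e.symm) := e.continuousOn_symm.domRestrict.measurable
  have := e.open_target.measurableSet.subtype_image (h hA)
  convert this using 1
  ext x
  simp [and_comm, Set.domRestrict]

/-- On the overlap of the two domains the densities match by the change of variables formula. What
`e` misses is at most one point, which is a null set in the chart `e'`. -/
theorem chartVolume_le (h : SmoothMetric M) (he : e ∈ IsManifold.maximalAtlas (𝓡 3) ∞ M)
    (he' : e' ∈ IsManifold.maximalAtlas (𝓡 3) ∞ M) {N : M} (hN : (e.source)ᶜ ⊆ {N}) :
    chartVolume h e' ≤ chartVolume h e := by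
  refine Measure.le_iff.2 fun A hA => ?_
  rw [chartVolume_apply h e' hA, chartVolume_apply h e hA]
  set φ : E3 → E3 := fun z => e (e'.symm z) with hφ
  set B := e'.symm ⁻¹' A ∩ e'.target with hB
  set W := e'.target ∩ e'.symm ⁻¹' e.source with hW
  have hWo : IsOpen W := isOpen_transition_source
  have hBm : MeasurableSet B := measurableSet_preimage_chart_symm e' hA
  have hnull : volume (B \ W) = 0 := by
    refine measure_mono_null (t := {e' N}) ?_ (measure_singleton _)
    rintro y ⟨⟨_, hy⟩, hyW⟩
    have h1 : e'.symm y ∉ e.source := fun h => hyW ⟨hy, h⟩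
    have h2 : e'.symm y = N := hN h1
    rw [mem_singleton_iff, ← h2, e'.right_inv hy]
  have hae : (B ∩ W : Set E3) =ᵐ[volume] B := by
    refine (inter_subset_left.eventuallyLE).antisymm ?_
    rw [ae_le_set]
    rwa [sdiff_self_inter]
  rw [← setLIntegral_congr hae]
  have hφd : ∀ y ∈ W, DifferentiableAt ℝ φ y := fun y hy =>
    ((contDiffOn_transition he he').differentiableOn (by simp)).differentiableAt (hWo.mem_nhds hy)
  have hinj : InjOn φ W := by
    intro a ha b hb hab
    have h1 := e.injOn ha.2 hb.2 hab
    exact e'.symm.injOn ha.1 hb.1 h1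
  have himg := lintegral_image_eq_lintegral_abs_det_fderiv_mul volume
    (hBm.inter hWo.measurableSet) (f := φ) (f' := fun y => fderiv ℝ φ y)
    (fun y hy => (hφd y hy.2).hasFDerivAt.hasFDerivWithinAt) (hinj.mono inter_subset_right)
    (fun x => ENNReal.ofReal (volDensity h e x))
  calc ∫⁻ y in B ∩ W, ENNReal.ofReal (volDensity h e' y)
      = ∫⁻ y in B ∩ W, ENNReal.ofReal |(fderiv ℝ φ y).det| *
          ENNReal.ofReal (volDensity h e (φ y)) := by
        refine setLIntegral_congr_fun (hBm.inter hWo.measurableSet) fun y hy => ?_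
        rw [volDensity_change h he he' hy.2.1 hy.2.2, det_fderiv_eq_jac (hφd y hy.2),
          ENNReal.ofReal_mul (abs_nonneg _)]
    _ = ∫⁻ x in φ '' (B ∩ W), ENNReal.ofReal (volDensity h e x) := himg.symm
    _ ≤ _ := by
        refine lintegral_mono_set ?_
        rintro _ ⟨y, hy, rfl⟩
        refine ⟨?_, e.map_source hy.2.2⟩
        rw [mem_preimage, e.left_inv hy.2.2]
        exact hy.1.1

/-- The Riemannian volume is given by a single chart that covers all but one point. -/
theorem riemVolume_eq_chartVolume (h : SmoothMetric M)
    (he : e ∈ IsManifold.maximalAtlas (𝓡 3) ∞ M) {N : M} (hN : (e.source)ᶜ ⊆ {N}) :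
    riemVolume h = chartVolume h e :=
  le_antisymm (iSup₂_le fun _ he' => chartVolume_le h he he' hN)
    (le_iSup₂ (f := fun e (_ : e ∈ IsManifold.maximalAtlas (𝓡 3) ∞ M) => chartVolume h e) e he)

theorem continuous_volDensity (h : SmoothMetric M)
    (he : e ∈ IsManifold.maximalAtlas (𝓡 3) ∞ M) (ht : e.target = univ) :
    Continuous (volDensity h e) := by
  have := (contDiffOn_det (h.smoothEntriesOn he)).continuousOn
  rw [ht, continuousOn_univ] at this
  exact this.sqrt

theorem integral_riemVolume (h : SmoothMetric M) (he : e ∈ IsManifold.maximalAtlas (𝓡 3) ∞ M)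
    (ht : e.target = univ) {N : M} (hN : (e.source)ᶜ ⊆ {N}) {f : M → ℝ} (hf : Continuous f) :
    ∫ p, f p ∂(riemVolume h) = ∫ x, f (e.symm x) * volDensity h e x := by
  have hm := (continuous_volDensity h he ht).measurable
  rw [riemVolume_eq_chartVolume h he hN, chartVolume,
    integral_map (aemeasurable_chart_symm h e) hf.aestronglyMeasurable, ht, Measure.restrict_univ]
  have h1 : (fun x => ENNReal.ofReal (volDensity h e x)) =
      fun x => ((Real.toNNReal (volDensity h e x) : NNReal) : ℝ≥0∞) := rfl
  rw [h1, integral_withDensity_eq_integral_smul hm.real_toNNReal]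
  refine integral_congr_ae (ae_of_all _ fun x => ?_)
  simp only [NNReal.smul_def, smul_eq_mul]
  rw [Real.coe_toNNReal (volDensity h e x) (Real.sqrt_nonneg _), mul_comm]

end Integration
section Construction
open CoordGeometry

variable {M : Type*} [TopologicalSpace M] [ChartedSpace (EuclideanSpace ℝ (Fin 3)) M]
  [IsManifold (𝓡 3) ∞ M] {e e' : OpenPartialHomeomorph M E3}

/-! ### Metrics defined through a chart -/

/-- The bilinear form with a given matrix. -/
def matBilin (A : Matrix (Fin 3) (Fin 3) ℝ) : E3 →L[ℝ] E3 →L[ℝ] ℝ :=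
  ∑ i, ∑ j, A i j • (EuclideanSpace.proj i : E3 →L[ℝ] ℝ).smulRight
    (EuclideanSpace.proj j : E3 →L[ℝ] ℝ)

theorem matBilin_apply (A : Matrix (Fin 3) (Fin 3) ℝ) (v w : E3) :
    matBilin A v w = ∑ i, ∑ j, v i * w j * A i j := by
  simp only [matBilin, sum_apply, smul_apply, ContinuousLinearMap.smulRight_apply, smul_eq_mul]
  exact Finset.sum_congr rfl fun _ _ => Finset.sum_congr rfl fun _ _ => by
    simp; ring

/-- The field of bilinear forms with given components in a chart. -/
def fromChart (e : OpenPartialHomeomorph M E3) (A : E3 → Matrix (Fin 3) (Fin 3) ℝ) :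
    BilinField M :=
  pullField e fun p => matBilin (A (e p))

theorem fieldVal_fromChart (e : OpenPartialHomeomorph M E3) (A : E3 → Matrix (Fin 3) (Fin 3) ℝ)
    (p : M) (v w : E3) : fieldVal (fromChart e A) p v w =
      ∑ i, ∑ j, chartCoframe e p v i * chartCoframe e p w j * A (e p) i j := by
  have h : fieldVal (fromChart e A) p v w =
    matBilin (A (e p)) (chartCoframe e p v) (chartCoframe e p w) := rfl
  rw [h, matBilin_apply]

theorem chartCoeff_fromChart (he : e ∈ IsManifold.maximalAtlas (𝓡 3) ∞ M)
    (A : E3 → Matrix (Fin 3) (Fin 3) ℝ) {x : E3} (hx : x ∈ e.target) :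
    chartCoeff (fromChart e A) e x = A x := by
  ext i j
  rw [chartCoeff_eq, fieldVal_fromChart, chartCoframe_chartFrame he hx,
    chartCoframe_chartFrame he hx, e.right_inv hx]
  simp

theorem fromChart_chartCoeff (he : e ∈ IsManifold.maximalAtlas (𝓡 3) ∞ M) (T : BilinField M)
    {p : M} (hp : p ∈ e.source) {A : E3 → Matrix (Fin 3) (Fin 3) ℝ}
    (hA : A (e p) = chartCoeff T e (e p)) : fromChart e A p = T p := by
  have h : ∀ v w : E3, fieldVal (fromChart e A) p v w = fieldVal T p v w := fun v w => by
    rw [fieldVal_fromChart, fieldVal_eq_chartCoeff he T hp, hA]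
  exact ContinuousLinearMap.ext fun v => ContinuousLinearMap.ext fun w => h v w

theorem contDiffAt_smul_const {X W : Type*} [NormedAddCommGroup X] [NormedSpace ℝ X]
    [NormedAddCommGroup W] [NormedSpace ℝ W] {c : X → ℝ} {x : X} (hc : ContDiffAt ℝ ∞ c x)
    (b : W) : ContDiffAt ℝ ∞ (fun y => c y • b) x :=
  hc.smul contDiffAt_const

theorem contMDiffAt_fromChart (he : e ∈ IsManifold.maximalAtlas (𝓡 3) ∞ M)
    {A : E3 → Matrix (Fin 3) (Fin 3) ℝ} (hA : SmoothEntriesOn A e.target) {p : M}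
    (hp : p ∈ e.source) :
    ContMDiffAt (𝓡 3) ((𝓡 3).prod 𝓘(ℝ, E3 →L[ℝ] E3 →L[ℝ] ℝ)) ∞
      (fun p => TotalSpace.mk' (E3 →L[ℝ] E3 →L[ℝ] ℝ)
        (E := fun p : M => TangentSpace (𝓡 3) p →L[ℝ] TangentSpace (𝓡 3) p →L[ℝ] ℝ)
        p (fromChart e A p)) p := by
  have h1 : ContMDiffAt (𝓡 3) (𝓡 3) ∞ e p := contMDiffAt_of_mem_maximalAtlas he hp
  have h2 : ContDiffAt ℝ ∞ (fun x => matBilin (A x)) (e p) := by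
    unfold matBilin
    refine ContDiffAt.sum fun i _ => ContDiffAt.sum fun j _ => ?_
    exact contDiffAt_smul_const ((hA i j).contDiffAt (e.open_target.mem_nhds (e.map_source hp))) _
  exact contMDiffAt_pullField h1
    (ContMDiffAt.comp (g := fun x => matBilin (A x)) p h2.contMDiffAt h1)

/-- By compactness the form has a positive minimum on the unit sphere, and homogeneity turns this
into a bound for the norm on its unit ball. -/
theorem isVonNBounded_of_pos {b : E3 →L[ℝ] E3 →L[ℝ] ℝ} (hb : ∀ v, v ≠ 0 → 0 < b v v) :
    Bornology.IsVonNBounded ℝ {v : E3 | b v v < 1} := by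
  rw [NormedSpace.isVonNBounded_iff, isBounded_iff_forall_norm_le]
  have hc : Continuous fun v : E3 => b v v := b.continuous.clm_apply continuous_id
  obtain ⟨v₀, hv₀, hmin⟩ := (isCompact_sphere (0 : E3) 1).exists_isMinOn
    (NormedSpace.sphere_nonempty.2 zero_le_one) hc.continuousOn
  have hv₀' : v₀ ≠ 0 := by
    rintro rfl
    simp at hv₀
  have hm := hb v₀ hv₀'
  refine ⟨Real.sqrt (1 / b v₀ v₀), fun v hv => ?_⟩
  by_cases h0 : v = 0
  · subst h0; simp
  have hn : 0 < ‖v‖ := norm_pos_iff.2 h0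
  have h1 : b v₀ v₀ ≤ b (‖v‖⁻¹ • v) (‖v‖⁻¹ • v) := hmin (by
    simp [norm_smul, hn.ne'])
  simp only [map_smul, smul_apply, smul_eq_mul] at h1
  apply Real.le_sqrt_of_sq_le
  rw [le_div_iff₀ hm]
  have h2 : b v v < 1 := hv
  have h3 : ‖v‖⁻¹ * (‖v‖⁻¹ * b v v) * ‖v‖ ^ 2 = b v v := by field_simp
  nlinarith [mul_le_mul_of_nonneg_right h1 (sq_nonneg ‖v‖)]

open Classical in
/-- The field given by components in a chart on its domain, and by `T` elsewhere. -/
def patchField (e : OpenPartialHomeomorph M E3) (A : E3 → Matrix (Fin 3) (Fin 3) ℝ)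
    (T : BilinField M) : BilinField M := fun p => if p ∈ e.source then fromChart e A p else T p

theorem patchField_of_mem (A : E3 → Matrix (Fin 3) (Fin 3) ℝ)
    (T : BilinField M) {p : M} (hp : p ∈ e.source) : patchField e A T p = fromChart e A p :=
  if_pos hp

theorem patchField_eq (he : e ∈ IsManifold.maximalAtlas (𝓡 3) ∞ M) (T : BilinField M)
    {A : E3 → Matrix (Fin 3) (Fin 3) ℝ} {p : M}
    (h : p ∈ e.source → A (e p) = chartCoeff T e (e p)) : patchField e A T p = T p := by
  by_cases hp : p ∈ e.source
  · rw [patchField_of_mem A T hp, fromChart_chartCoeff he T hp (h hp)]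
  · exact if_neg hp

theorem chartCoeff_patchField (he : e ∈ IsManifold.maximalAtlas (𝓡 3) ∞ M)
    (A : E3 → Matrix (Fin 3) (Fin 3) ℝ) (T : BilinField M) {x : E3} (hx : x ∈ e.target) :
    chartCoeff (patchField e A T) e x = A x := by
  rw [← chartCoeff_fromChart he A hx]
  ext i j
  simp only [chartCoeff_eq, fieldVal, patchField_of_mem A T (e.map_target hx)]

/-- The smooth metric with prescribed components in a chart, equal to a given one outside of
a compact subset of the domain of the chart. -/
def patchMetric [T2Space M] (he : e ∈ IsManifold.maximalAtlas (𝓡 3) ∞ M)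
    {A : E3 → Matrix (Fin 3) (Fin 3) ℝ} (hA : SmoothEntriesOn A e.target)
    (hAs : ∀ x ∈ e.target, (A x).IsSymm) (hAp : ∀ x ∈ e.target, (A x).PosDef)
    {T : BilinField M} (hTs : ∀ p (v w : E3), fieldVal T p v w = fieldVal T p w v)
    (hTp : ∀ p (v : E3), v ≠ 0 → 0 < fieldVal T p v v)
    (hT : ContMDiff (𝓡 3) ((𝓡 3).prod 𝓘(ℝ, E3 →L[ℝ] E3 →L[ℝ] ℝ)) ∞
      (fun p => TotalSpace.mk' (E3 →L[ℝ] E3 →L[ℝ] ℝ)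
        (E := fun p : M => TangentSpace (𝓡 3) p →L[ℝ] TangentSpace (𝓡 3) p →L[ℝ] ℝ) p (T p)))
    {K : Set E3} (hK : IsCompact K) (hKe : K ⊆ e.target)
    (hAT : ∀ x ∈ e.target, x ∉ K → A x = chartCoeff T e x) : SmoothMetric M :=
  have hpos : ∀ p (v : E3), v ≠ 0 → 0 < fieldVal (patchField e A T) p v v := by
    intro p v hv
    by_cases hp : p ∈ e.source
    · have h1 : fieldVal (patchField e A T) p v v = fieldVal (fromChart e A) p v v := by
        simp only [fieldVal, patchField_of_mem A T hp]
      rw [h1, fieldVal_fromChart]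
      have h2 : (chartCoframe e p v).ofLp ≠ 0 := by
        intro h0
        have h3 := chartFrame_chartCoframe he hp v
        rw [show chartCoframe e p v = 0 by ext k; exact congrFun h0 k, map_zero] at h3
        exact hv h3.symm
      have h3 := (Matrix.posDef_iff_dotProduct_mulVec.1 (hAp _ (e.map_source hp))).2 h2
      convert! h3 using 1
      simp only [dotProduct, Matrix.mulVec, Finset.mul_sum, star_trivial]
      exact Finset.sum_congr rfl fun a _ => Finset.sum_congr rfl fun b _ => by ring
    · have h1 : fieldVal (patchField e A T) p v v = fieldVal T p v v := by
        simp only [fieldVal, patchField_eq he T (fun h => absurd h hp)]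
      rw [h1]; exact hTp p v hv
  have hsymm : ∀ p (v w : E3), fieldVal (patchField e A T) p v w =
      fieldVal (patchField e A T) p w v := by
    intro p v w
    by_cases hp : p ∈ e.source
    · have h1 : ∀ v w : E3, fieldVal (patchField e A T) p v w = fieldVal (fromChart e A) p v w :=
        fun v w => by simp only [fieldVal, patchField_of_mem A T hp]
      rw [h1, h1, fieldVal_fromChart, fieldVal_fromChart, Finset.sum_comm]
      refine Finset.sum_congr rfl fun i _ => Finset.sum_congr rfl fun j _ => ?_
      rw [(hAs _ (e.map_source hp)).apply]; ring
    · have h1 : ∀ v w : E3, fieldVal (patchField e A T) p v w = fieldVal T p v w := fun v w => by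
        simp only [fieldVal, patchField_eq he T (fun h => absurd h hp)]
      rw [h1, h1]; exact hTs p v w
  { inner := patchField e A T
    symm := fun p v w => hsymm p v w
    pos := fun p v hv => hpos p v hv
    isVonNBounded := fun p => isVonNBounded_of_pos (b := patchField e A T p) (hpos p)
    contMDiff := by
      intro p
      by_cases hp : p ∈ e.source
      · refine (contMDiffAt_fromChart he hA hp).congr_of_eventuallyEq ?_
        filter_upwards [e.open_source.mem_nhds hp] with q hq
        rw [patchField_of_mem A T hq]
      -- The compact image of `K` is closed in a Hausdorff space. A point outside the chart
      -- therefore has a neighbourhood in which the patched field is `T`, and smoothness is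
      -- inherited from `T`.
      · have hcl : IsClosed (e.symm '' K) :=
          (hK.image_of_continuousOn (e.continuousOn_symm.mono hKe)).isClosed
        refine (hT p).congr_of_eventuallyEq ?_
        have hpK : p ∈ (e.symm '' K)ᶜ := by
          rintro ⟨x, hx, rfl⟩
          exact hp (e.map_target (hKe hx))
        filter_upwards [hcl.isOpen_compl.mem_nhds hpK] with q hq
        rw [patchField_eq he T]
        intro hqs
        refine hAT _ (e.map_source hqs) fun hqK => hq ⟨_, hqK, e.left_inv hqs⟩ }

theorem chartCoeff_pullField {V : Type*} [NormedAddCommGroup V] [NormedSpace ℝ V]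
    (he : e ∈ IsManifold.maximalAtlas (𝓡 3) ∞ M) {F : M → V} {B : M → V →L[ℝ] V →L[ℝ] ℝ}
    {x : E3} (hx : x ∈ e.target) (hF : MDifferentiableAt (𝓡 3) 𝓘(ℝ, V) F (e.symm x))
    (i j : Fin 3) : chartCoeff (pullField F B) e x i j = B (e.symm x)
      (fderiv ℝ (fun y => F (e.symm y)) x (EuclideanSpace.single i 1))
      (fderiv ℝ (fun y => F (e.symm y)) x (EuclideanSpace.single j 1)) := by
  have h3 := mfderiv_comp x hF (mdifferentiableAt_chart_symm he hx)
  have h4 : ∀ v : E3, fderiv ℝ (fun y => F (e.symm y)) x v =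
      (mfderiv (𝓡 3) 𝓘(ℝ, V) F (e.symm x) : E3 →L[ℝ] V) (chartFrame e x v) := by
    intro v
    rw [← mfderiv_eq_fderiv]
    exact congrArg (fun L : E3 →L[ℝ] V => L v) h3
  rw [h4, h4]
  rfl

end Construction

section Sphere
open CoordGeometry

/-! ### Stereographic coordinates -/

/-- Euclidean four-space. -/
abbrev E4 : Type := EuclideanSpace ℝ (Fin 4)

/-- The derivative in the direction a is a combination of L a, L x and v. In the inner product the
multiples of ⟨x, a⟩⟨x, b⟩ cancel, which is the conformality of stereographic projection. -/
theorem inner_fderiv_stereographic {V : Type*} [NormedAddCommGroup V] [InnerProductSpace ℝ V]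
    {L : E3 →L[ℝ] V} {v : V} (hL : ∀ a b, inner ℝ (L a) (L b) = inner ℝ a b) (hv : ‖v‖ = 1)
    (hvL : ∀ a, inner ℝ v (L a) = 0) (x a b : E3) :
    inner ℝ (fderiv ℝ (fun y => (‖y‖ ^ 2 + 4)⁻¹ • ((4 : ℝ) • L y + (‖y‖ ^ 2 - 4) • v)) x a)
      (fderiv ℝ (fun y => (‖y‖ ^ 2 + 4)⁻¹ • ((4 : ℝ) • L y + (‖y‖ ^ 2 - 4) • v)) x b) =
      (4 / (‖x‖ ^ 2 + 4)) ^ 2 * inner ℝ a b := by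
  have hN : ‖x‖ ^ 2 + 4 ≠ 0 := by positivity
  have hsq : HasFDerivAt (fun y : E3 => ‖y‖ ^ 2) ((2 : ℝ) • innerSL ℝ x) x := by
    have h := (hasStrictFDerivAt_norm_sq x).hasFDerivAt
    have h2 : ((2 : ℝ) • innerSL ℝ x : E3 →L[ℝ] ℝ) = 2 • innerSL ℝ x := by
      ext a; simp [two_smul]
    rw [h2]; exact h
  have h1 := (hasDerivAt_inv hN).comp_hasFDerivAt x (hsq.add_const 4)
  have h2 : HasFDerivAt (fun y => (4 : ℝ) • L y + (‖y‖ ^ 2 - 4) • v)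
      ((4 : ℝ) • L + ((2 : ℝ) • innerSL ℝ x).smulRight v) x :=
    (L.hasFDerivAt.const_smul (4 : ℝ)).add ((hsq.sub_const 4).smul_const v)
  have h3 := h1.smul h2
  have h4 : ∀ a, fderiv ℝ (fun y => (‖y‖ ^ 2 + 4)⁻¹ • ((4 : ℝ) • L y + (‖y‖ ^ 2 - 4) • v)) x a =
      (4 / (‖x‖ ^ 2 + 4)) • L a - (8 * inner ℝ x a / (‖x‖ ^ 2 + 4) ^ 2) • L x +
      (16 * inner ℝ x a / (‖x‖ ^ 2 + 4) ^ 2) • v := by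
    intro a
    have h5 : HasFDerivAt (fun y => (‖y‖ ^ 2 + 4)⁻¹ • ((4 : ℝ) • L y + (‖y‖ ^ 2 - 4) • v)) _ x := h3
    rw [h5.fderiv]
    simp only [add_apply, smul_apply, ContinuousLinearMap.smulRight_apply, innerSL_apply_apply,
      Function.comp_apply, smul_eq_mul]
    match_scalars
    · field_simp
    · field_simp; ring
    · field_simp; ring
  rw [h4, h4]
  have hvv : inner ℝ v v = 1 := by rw [real_inner_self_eq_norm_sq, hv]; norm_num
  have hLv : ∀ a, inner ℝ (L a) v = 0 := fun a => by rw [real_inner_comm, hvL]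
  simp only [inner_add_left, inner_add_right, inner_sub_left, inner_sub_right, inner_smul_left,
    inner_smul_right, hL, hvL, hLv, hvv, real_inner_self_eq_norm_sq, real_inner_comm x a]
  simp only [conj_trivial]
  field_simp
  ring

variable {S : Type*} [TopologicalSpace S] [ChartedSpace (EuclideanSpace ℝ (Fin 3)) S]
  [IsManifold (𝓡 3) ∞ S]
  (Ψ : S ≃ₘ⟮𝓡 3, 𝓡 3⟯ (Metric.sphere (0 : EuclideanSpace ℝ (Fin 4)) 1))

/-- The stereographic chart with pole `v`. -/
def stereoChart (v : Metric.sphere (0 : E4) 1) : OpenPartialHomeomorph S E3 :=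
  haveI := Fact.mk (@finrank_euclideanSpace_fin ℝ _ 4)
  Ψ.toHomeomorph.toOpenPartialHomeomorph ≫ₕ stereographic' 3 v

variable (v : Metric.sphere (0 : E4) 1)

theorem stereoChart_mem : stereoChart Ψ v ∈ IsManifold.maximalAtlas (𝓡 3) ∞ S := by
  have := Fact.mk (@finrank_euclideanSpace_fin ℝ _ 4)
  have hst : stereographic' 3 v ∈ IsManifold.maximalAtlas (𝓡 3) ∞ (Metric.sphere (0 : E4) 1) :=
    IsManifold.subset_maximalAtlas ⟨v, rfl⟩
  apply OpenPartialHomeomorph.mem_maximalAtlas_of_contMDiffOn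
  · exact (contMDiffOn_of_mem_maximalAtlas hst).comp Ψ.contMDiff.contMDiffOn
      (fun p hp => by simpa [stereoChart] using hp)
  · exact Ψ.symm.contMDiff.comp_contMDiffOn ((contMDiffOn_symm_of_mem_maximalAtlas hst).mono
      (fun p hp => by simp))

theorem stereoChart_target : (stereoChart Ψ v).target = univ := by
  have := Fact.mk (@finrank_euclideanSpace_fin ℝ _ 4)
  simp [stereoChart]

theorem stereoChart_source : (stereoChart Ψ v).source = {Ψ.symm v}ᶜ := by
  have := Fact.mk (@finrank_euclideanSpace_fin ℝ _ 4)
  ext p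
  have : p = Ψ.symm v ↔ Ψ p = v := by
    constructor
    · rintro rfl; exact Ψ.apply_symm_apply v
    · rintro rfl; exact (Ψ.symm_apply_apply p).symm
  simp [stereoChart, this]

theorem stereoChart_neg : stereoChart Ψ v (Ψ.symm (-v)) = 0 := by
  have := Fact.mk (@finrank_euclideanSpace_fin ℝ _ 4)
  have : stereographic' 3 v (-v) = 0 := by
    dsimp [stereographic']
    simp
  simpa [stereoChart] using this

theorem exists_stereoChart_symm : ∃ L : E3 →L[ℝ] E4,
    (∀ a b, inner ℝ (L a) (L b) = inner ℝ a b) ∧ (∀ a, inner ℝ (v : E4) (L a) = 0) ∧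
    ∀ x, (Ψ ((stereoChart Ψ v).symm x) : E4) =
      (‖x‖ ^ 2 + 4)⁻¹ • ((4 : ℝ) • L x + (‖x‖ ^ 2 - 4) • (v : E4)) := by
  have := Fact.mk (@finrank_euclideanSpace_fin ℝ _ 4)
  let U : (Submodule.span ℝ {(v : E4)})ᗮ ≃ₗᵢ[ℝ] E3 :=
    (OrthonormalBasis.fromOrthogonalSpanSingleton 3 (ne_zero_of_mem_unit_sphere v)).repr
  refine ⟨(Submodule.span ℝ {(v : E4)})ᗮ.subtypeL.comp
    (U.symm.toContinuousLinearEquiv : E3 →L[ℝ] (Submodule.span ℝ {(v : E4)})ᗮ), ?_, ?_, ?_⟩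
  · intro a b
    exact U.symm.inner_map_map a b
  · intro a
    exact Submodule.mem_orthogonal_singleton_iff_inner_right.1 (U.symm a).2
  · intro x
    have h1 : Ψ ((stereoChart Ψ v).symm x) = (stereographic' 3 v).symm x := by
      simp [stereoChart]
    have hn : ‖(U.symm x : E4)‖ = ‖x‖ := U.symm.norm_map x
    rw [h1, stereographic'_symm_apply]
    simp only [smul_add]
    change (‖(U.symm x : E4)‖ ^ 2 + 4)⁻¹ • (4 : ℝ) • (U.symm x : E4) +
      (‖(U.symm x : E4)‖ ^ 2 + 4)⁻¹ • (‖(U.symm x : E4)‖ ^ 2 - 4) • (v : E4) = _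
    rw [hn]
    rfl

theorem contMDiff_coe_diffeo :
    ContMDiff (𝓡 3) 𝓘(ℝ, E4) ∞ (fun p : S => (Ψ p : E4)) := by
  have := Fact.mk (@finrank_euclideanSpace_fin ℝ _ 4)
  exact (contMDiff_coe_sphere (E := E4) (n := 3)).comp Ψ.contMDiff

theorem conformalRescale_roundMetric (w : S → ℝ) : conformalRescale w (roundMetric Ψ) =
    pullField (fun p : S => (Ψ p : E4)) 
      (fun p => w p ^ 2 • (innerSL ℝ : E4 →L[ℝ] E4 →L[ℝ] ℝ)) := by
  ext p a b
  rfl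

theorem chartCoeff_conformal_round (w : S → ℝ) (x : E3) :
    chartCoeff (conformalRescale w (roundMetric Ψ)) (stereoChart Ψ v) x =
      (w ((stereoChart Ψ v).symm x) * (4 / (‖x‖ ^ 2 + 4))) ^ 2 • 1 := by
  ext i j
  obtain ⟨L, hL, hvL, hLx⟩ := exists_stereoChart_symm Ψ v
  rw [conformalRescale_roundMetric, chartCoeff_pullField (stereoChart_mem Ψ v)
    (by rw [stereoChart_target]; trivial)
    ((contMDiff_coe_diffeo Ψ _).mdifferentiableAt (by simp))]
  simp only [hLx, smul_apply, smul_eq_mul, Matrix.smul_apply]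
  change w _ ^ 2 * inner ℝ (_ : E4) (_ : E4) = _
  rw [inner_fderiv_stereographic hL (norm_eq_of_mem_sphere v) hvL, mul_pow, mul_assoc]
  congr 2
  simp [Matrix.one_apply, EuclideanSpace.inner_single_left]

theorem conformal_round_pos {w : S → ℝ} (hw : ∀ p, 0 < w p) (p : S) (a : E3) (ha : a ≠ 0) :
    0 < fieldVal (conformalRescale w (roundMetric Ψ)) p a a := by
  have := Fact.mk (@finrank_euclideanSpace_fin ℝ _ 4)
  -- The pole antipodal to the given point puts the point inside the domain of the chart.
  set e := stereoChart Ψ (-(Ψ p)) with he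
  have hp : p ∈ e.source := by
    rw [he, stereoChart_source]
    intro h
    rw [mem_singleton_iff] at h
    have h1 : Ψ p = -(Ψ p) := by
      conv_lhs => rw [h]
      exact Ψ.apply_symm_apply _
    exact ne_neg_of_mem_unit_sphere ℝ (Ψ p) h1
  rw [fieldVal_eq_chartCoeff (stereoChart_mem Ψ _) _ hp, chartCoeff_conformal_round]
  have hne : chartCoframe e p a ≠ 0 := by
    intro h0
    have h3 := chartFrame_chartCoframe (stereoChart_mem Ψ _) hp a
    rw [h0, map_zero] at h3
    exact ha h3.symm
  set c := chartCoframe e p a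
  have h5 : ∑ i, ∑ j, c i * c j * ((w (e.symm (e p)) * (4 / (‖e p‖ ^ 2 + 4))) ^ 2 •
      (1 : Matrix (Fin 3) (Fin 3) ℝ)) i j =
      (w (e.symm (e p)) * (4 / (‖e p‖ ^ 2 + 4))) ^ 2 * ‖c‖ ^ 2 := by
    rw [EuclideanSpace.norm_sq_eq c]
    generalize ‖e p‖ ^ 2 = n
    simp [Matrix.one_apply, Fin.sum_univ_three]
    ring
  rw [h5]
  have := hw (e.symm (e p))
  have := norm_pos_iff.2 hne
  positivity

theorem contMDiff_conformal_round {w : S → ℝ} (hw : ContMDiff (𝓡 3) 𝓘(ℝ, ℝ) ∞ w) :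
    ContMDiff (𝓡 3) ((𝓡 3).prod 𝓘(ℝ, E3 →L[ℝ] E3 →L[ℝ] ℝ)) ∞
      (fun p => TotalSpace.mk' (E3 →L[ℝ] E3 →L[ℝ] ℝ)
        (E := fun p : S => TangentSpace (𝓡 3) p →L[ℝ] TangentSpace (𝓡 3) p →L[ℝ] ℝ) p
        (conformalRescale w (roundMetric Ψ) p)) := by
  intro p
  rw [conformalRescale_roundMetric]
  refine contMDiffAt_pullField (contMDiff_coe_diffeo Ψ p) ?_
  exact ((hw p).pow 2).smul contMDiffAt_const

/-! ### The conformal factor ω -/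

/-- The conformal factor: an affine function of the height on the sphere. -/
def heightFactor (p : S) : ℝ := 3 / 2 + inner ℝ (v : E4) (Ψ p : E4) / 2

theorem heightFactor_pos (p : S) : 0 < heightFactor Ψ v p := by
  have h1 := abs_real_inner_le_norm (v : E4) (Ψ p : E4)
  rw [norm_eq_of_mem_sphere, norm_eq_of_mem_sphere] at h1
  have := abs_le.1 h1
  unfold heightFactor
  linarith [this.1]

theorem contMDiff_heightFactor : ContMDiff (𝓡 3) 𝓘(ℝ, ℝ) ∞ (heightFactor Ψ v) := by
  have h1 : ContDiff ℝ ∞ (fun y : E4 => 3 / 2 + inner ℝ (v : E4) y / 2) :=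
    contDiff_const.add (((innerSL ℝ (v : E4)).contDiff).div_const 2)
  exact ContMDiff.comp (I' := 𝓘(ℝ, E4)) (g := fun y : E4 => 3 / 2 + inner ℝ (v : E4) y / 2)
    (f := fun p : S => (Ψ p : E4)) h1.contMDiff (contMDiff_coe_diffeo Ψ)

/-- The conformal factor of the limit metric in stereographic coordinates. -/
def ffun (x : E3) : ℝ := (1 + ‖x‖ ^ 2 / 2) / (1 + ‖x‖ ^ 2 / 4) ^ 2

/-- The coefficients 3/2 and 1/2 of `heightFactor` are tuned so that, with n = |x|²/4, it equals (1
+ 2n)/(1 + n). The product with the stereographic factor 1/(1 + n) then has no term of order |x|²,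
and the limit metric is flat up to order four at the origin. -/
theorem chartCoeff_limit (x : E3) :
    chartCoeff (conformalRescale (heightFactor Ψ v) (roundMetric Ψ)) (stereoChart Ψ v) x =
      ffun x ^ 2 • 1 := by
  rw [chartCoeff_conformal_round]
  obtain ⟨L, hL, hvL, hLx⟩ := exists_stereoChart_symm Ψ v
  have hvv : inner ℝ (v : E4) (v : E4) = 1 := by
    rw [real_inner_self_eq_norm_sq, norm_eq_of_mem_sphere]; norm_num
  rw [heightFactor, hLx, inner_smul_right, inner_add_right, inner_smul_right, inner_smul_right,
    hvL, hvv, ffun]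
  congr 2
  have : ‖x‖ ^ 2 + 4 ≠ 0 := by positivity
  have : 1 + ‖x‖ ^ 2 / 4 ≠ 0 := by positivity
  field_simp
  ring

end Sphere
section Cubic
open CoordGeometry

/-! ### The cubic term -/

/-- The cubic form `z η α γ β δ a^γ b^δ c^η`, polarized. -/
def polarCubic (z : Fin 3 → Fin 3 → Fin 3 → Fin 3 → Fin 3 → ℝ) (a b c : E3) (α β : Fin 3) : ℝ :=
  ∑ η, ∑ γ, ∑ δ, z η α γ β δ * a γ * b δ * c η

/-- The matrix of the cubic term. -/
def cubicTerm (z : Fin 3 → Fin 3 → Fin 3 → Fin 3 → Fin 3 → ℝ) (x : E3) :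
    Matrix (Fin 3) (Fin 3) ℝ := Matrix.of fun α β => polarCubic z x x x α β

variable {z : Fin 3 → Fin 3 → Fin 3 → Fin 3 → Fin 3 → ℝ}

theorem one_add_cubicTerm (x : E3) (α β : Fin 3) :
    (1 + cubicTerm z x) α β = cubicMetric z x α β := by
  simp [cubicTerm, cubicMetric, polarCubic, Matrix.one_apply]

theorem sum_sum_antisymm {A : Fin 3 → Fin 3 → ℝ} (hA : ∀ i j, A i j = -A j i) (a : E3) :
    ∑ i, ∑ j, A i j * a i * a j = 0 := by
  have h : ∑ i, ∑ j, A i j * a i * a j = -∑ i, ∑ j, A i j * a i * a j := by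
    conv_lhs => rw [Finset.sum_comm]
    rw [← Finset.sum_neg_distrib]
    refine Finset.sum_congr rfl fun i _ => ?_
    rw [← Finset.sum_neg_distrib]
    refine Finset.sum_congr rfl fun j _ => ?_
    rw [hA j i]; ring
  linarith

/-- Only the pair (α, γ) matters: the sum vanishes as soon as α meets the vector in the slot of γ,
whatever fills the other slots. This freedom is needed after differentiation, when the three slots
hold different vectors. -/
theorem polarCubic_contract_left (hz : HasRiemannDerivSymmetries z) (a b c : E3) (β : Fin 3) :
    ∑ α, polarCubic z a b c α β * a α = 0 := by
  have h : ∑ α, polarCubic z a b c α β * a α =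
      ∑ η, ∑ δ, b δ * c η * ∑ α, ∑ γ, z η α γ β δ * a α * a γ := by
    simp only [polarCubic, Fin.sum_univ_three]; ring
  rw [h]
  refine Finset.sum_eq_zero fun η _ => Finset.sum_eq_zero fun δ _ => ?_
  rw [sum_sum_antisymm (fun α γ => hz.antisymm_left η α γ β δ), mul_zero]

theorem polarCubic_contract_right (hz : HasRiemannDerivSymmetries z) (a b c : E3) (α : Fin 3) :
    ∑ β, polarCubic z a b c α β * b β = 0 := by
  have h : ∑ β, polarCubic z a b c α β * b β =
      ∑ η, ∑ γ, a γ * c η * ∑ β, ∑ δ, z η α γ β δ * b β * b δ := by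
    simp only [polarCubic, Fin.sum_univ_three]; ring
  rw [h]
  refine Finset.sum_eq_zero fun η _ => Finset.sum_eq_zero fun δ _ => ?_
  rw [sum_sum_antisymm (fun β γ => hz.antisymm_right η α δ β γ), mul_zero]

theorem polarCubic_smul (t : ℝ) (a b c : E3) (α β : Fin 3) :
    polarCubic z (t • a) b c α β = t * polarCubic z a b c α β ∧
    polarCubic z a (t • b) c α β = t * polarCubic z a b c α β ∧
    polarCubic z a b (t • c) α β = t * polarCubic z a b c α β := by
  refine ⟨?_, ?_, ?_⟩ <;>
  · simp only [polarCubic, Finset.mul_sum]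
    refine Finset.sum_congr rfl fun _ _ => Finset.sum_congr rfl fun _ _ =>
      Finset.sum_congr rfl fun _ _ => ?_
    simp; ring

theorem polarCubic_swap (hz : HasRiemannDerivSymmetries z) (a b c : E3) (α β : Fin 3) :
    polarCubic z a b c α β = polarCubic z b a c β α := by
  simp only [polarCubic]
  refine Finset.sum_congr rfl fun η _ => ?_
  rw [Finset.sum_comm]
  refine Finset.sum_congr rfl fun γ _ => Finset.sum_congr rfl fun δ _ => ?_
  rw [hz.pair_symm]; ring

theorem cubicTerm_isSymm (hz : HasRiemannDerivSymmetries z) (x : E3) : (cubicTerm z x).IsSymm :=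
  Matrix.IsSymm.ext fun α β => polarCubic_swap hz x x x β α

theorem cubicTerm_smul (t : ℝ) (x : E3) : cubicTerm z (t • x) = t ^ 3 • cubicTerm z x := by
  ext α β
  simp only [cubicTerm, Matrix.of_apply, Matrix.smul_apply, smul_eq_mul]
  rw [(polarCubic_smul t _ _ _ α β).1, (polarCubic_smul t _ _ _ α β).2.1,
    (polarCubic_smul t _ _ _ α β).2.2]
  ring

/-- This is the Gauss lemma for the prescribed metric: δ plus the cubic term maps x to x. -/
theorem cubicTerm_radial (hz : HasRiemannDerivSymmetries z) (x : E3) (α : Fin 3) :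
    ∑ β, cubicTerm z x α β * x β = 0 :=
  polarCubic_contract_right hz x x x α

theorem contDiff_cubicTerm (α β : Fin 3) : ContDiff ℝ ∞ (fun x => cubicTerm z x α β) := by
  simp only [cubicTerm, Matrix.of_apply, polarCubic]
  refine ContDiff.sum fun η _ => ContDiff.sum fun γ _ => ContDiff.sum fun δ _ => ?_
  fun_prop

theorem pderiv_cubicTerm (i α β : Fin 3) (x : E3) :
    pderiv i (fun y => cubicTerm z y α β) x =
      polarCubic z (EuclideanSpace.single i 1) x x α β +
      polarCubic z x (EuclideanSpace.single i 1) x α β +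
      polarCubic z x x (EuclideanSpace.single i 1) α β := by
  have hp : ∀ k, HasFDerivAt (fun y : E3 => y k) (EuclideanSpace.proj k : E3 →L[ℝ] ℝ) x :=
    fun k => (EuclideanSpace.proj k : E3 →L[ℝ] ℝ).hasFDerivAt
  have h : HasFDerivAt (fun y => cubicTerm z y α β) _ x :=
    HasFDerivAt.fun_sum (u := Finset.univ) fun η _ => HasFDerivAt.fun_sum (u := Finset.univ)
      fun γ _ => HasFDerivAt.fun_sum (u := Finset.univ) fun δ _ =>
        (((hp γ).const_mul (z η α γ β δ)).mul (hp δ)).mul (hp η)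
  rw [pderiv, h.fderiv]
  simp only [polarCubic, sum_apply, ← Finset.sum_add_distrib]
  refine Finset.sum_congr rfl fun η _ => Finset.sum_congr rfl fun γ _ =>
    Finset.sum_congr rfl fun δ _ => ?_
  simp
  ring_nf

theorem sum_pderiv_cubicTerm (v x : E3) (α β : Fin 3) :
    ∑ i, pderiv i (fun y => cubicTerm z y α β) x * v i =
      polarCubic z v x x α β + polarCubic z x v x α β + polarCubic z x x v α β := by
  simp only [pderiv_cubicTerm]
  simp only [polarCubic, Fin.sum_univ_three]
  simp
  ring

theorem sum_pderiv_cubicTerm_self (hz : HasRiemannDerivSymmetries z) (t : ℝ) (v : E3)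
    (l : Fin 3) :
    ∑ j, (∑ i, pderiv i (fun y => cubicTerm z y j l) (t • v) * v i) * v j = 0 := by
  have h : ∀ j, (∑ i, pderiv i (fun y => cubicTerm z y j l) (t • v) * v i) * v j =
      3 * t ^ 2 * (polarCubic z v v v j l * v j) := by
    intro j
    rw [sum_pderiv_cubicTerm]
    simp only [(polarCubic_smul t _ _ _ j l).1, (polarCubic_smul t _ _ _ j l).2.1,
      (polarCubic_smul t _ _ _ j l).2.2]
    ring
  simp only [h]
  rw [← Finset.mul_sum, polarCubic_contract_left hz, mul_zero]

/-- A derivative replaces one of the three vectors. In each resulting term at least one of the two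
antisymmetric pairs is still contracted twice with v. -/
theorem sum_pderiv_cubicTerm_sq (hz : HasRiemannDerivSymmetries z) (t : ℝ) (v : E3)
    (l : Fin 3) :
    ∑ i, ∑ j, pderiv l (fun y => cubicTerm z y i j) (t • v) * v i * v j = 0 := by
  have h : ∀ i j, pderiv l (fun y => cubicTerm z y i j) (t • v) * v i * v j =
      t ^ 2 * v i * (polarCubic z (EuclideanSpace.single l 1) v v i j * v j) +
      t ^ 2 * v j * (polarCubic z v (EuclideanSpace.single l 1) v i j * v i) +
      t ^ 2 * v i * (polarCubic z v v (EuclideanSpace.single l 1) i j * v j) := by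
    intro i j
    rw [pderiv_cubicTerm]
    simp only [(polarCubic_smul t _ _ _ i j).1, (polarCubic_smul t _ _ _ i j).2.1,
      (polarCubic_smul t _ _ _ i j).2.2]
    ring
  simp only [h, Finset.sum_add_distrib]
  have h1 : ∀ b : E3, ∑ i, ∑ j, t ^ 2 * v i * (polarCubic z b v v i j * v j) = 0 := fun b =>
    Finset.sum_eq_zero fun i _ => by
      rw [← Finset.mul_sum, polarCubic_contract_right hz, mul_zero]
  have h3 : ∀ b : E3, ∑ i, ∑ j, t ^ 2 * v i * (polarCubic z v v b i j * v j) = 0 := fun b =>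
    Finset.sum_eq_zero fun i _ => by
      rw [← Finset.mul_sum, polarCubic_contract_right hz, mul_zero]
  have h2 : ∀ b : E3, ∑ i, ∑ j, t ^ 2 * v j * (polarCubic z v b v i j * v i) = 0 := fun b => by
    rw [Finset.sum_comm]
    exact Finset.sum_eq_zero fun i _ => by
      rw [← Finset.mul_sum, polarCubic_contract_left hz, mul_zero]
  rw [h1, h2, h3]; simp

/-- Rays are geodesics of the metric `1 + z x x x`. -/
theorem isGeodesicOn_ray (hz : HasRiemannDerivSymmetries z)
    {G : E3 → Matrix (Fin 3) (Fin 3) ℝ} {r : ℝ}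
    (hG : ∀ x ∈ Metric.ball (0 : E3) r, G x = 1 + cubicTerm z x) (v : E3) :
    IsGeodesicOn G (fun t : ℝ => t • v) {t | ‖t • v‖ < r} := by
  refine ⟨(contDiff_id.smul contDiff_const).contDiffOn, fun t ht k => ?_⟩
  have hd : ∀ i : Fin 3, (fun τ : ℝ => deriv (fun σ : ℝ => (σ • v) i) τ) = fun _ => v i := by
    intro i
    ext τ
    have : HasDerivAt (fun σ : ℝ => (σ • v) i) (1 * v i) τ := (hasDerivAt_id τ).mul_const (v i)
    rw [this.deriv, one_mul]
  have hd' : ∀ i : Fin 3, deriv (fun σ : ℝ => (σ • v) i) t = v i := fun i => congrFun (hd i) t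
  simp only [hd', hd, deriv_const, zero_add]
  have hev : G =ᶠ[𝓝 (t • v)] fun x => 1 + cubicTerm z x := by
    filter_upwards [Metric.isOpen_ball.mem_nhds (show t • v ∈ Metric.ball (0 : E3) r by
      simpa using ht)] with x hx using hG x hx
  have hp : ∀ l a b, pderiv l (fun y => G y a b) (t • v) =
      pderiv l (fun y => cubicTerm z y a b) (t • v) := by
    intro l a b
    rw [pderiv_congr (g := fun y => (1 : Matrix (Fin 3) (Fin 3) ℝ) a b + cubicTerm z y a b)
      (hev.mono fun y hy => by simp only [hy, Matrix.add_apply])]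
    simp only [pderiv, fderiv_const_add]
  -- The lowered Christoffel symbols already vanish when contracted twice with v, so the inverse
  -- metric plays no role.
  have key : ∀ l, ∑ i, ∑ j, (pderiv i (fun y => G y j l) (t • v) +
      pderiv j (fun y => G y i l) (t • v) - pderiv l (fun y => G y i j) (t • v)) * v i * v j
      = 0 := by
    intro l
    simp only [hp]
    have e1 := sum_pderiv_cubicTerm_self hz t v l
    have e2 := sum_pderiv_cubicTerm_sq hz t v l
    simp only [Fin.sum_univ_three] at e1 e2 ⊢
    linear_combination 2 * e1 - e2
  have : ∑ i, ∑ j, christoffel G k i j (t • v) * v i * v j =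
      (1 / 2) * ∑ l, (G (t • v))⁻¹ k l * ∑ i, ∑ j, (pderiv i (fun y => G y j l) (t • v) +
      pderiv j (fun y => G y i l) (t • v) - pderiv l (fun y => G y i j) (t • v)) * v i * v j := by
    simp only [christoffel, Fin.sum_univ_three]; ring
  rw [this]
  simp [key]

end Cubic

section Family
open CoordGeometry

/-! ### The family of metrics -/

/-- A cutoff function, `1` on the unit ball and supported in the ball of radius two. -/
def cutoff : ContDiffBump (0 : E3) := ⟨1, 2, one_pos, one_lt_two⟩

theorem cutoff_eq_one {y : E3} (hy : ‖y‖ ≤ 1) : cutoff y = 1 :=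
  cutoff.one_of_mem_closedBall (by simpa [cutoff] using hy)

theorem cutoff_eq_zero {y : E3} (hy : 2 ≤ ‖y‖) : cutoff y = 0 :=
  cutoff.zero_of_le_dist (by simpa [cutoff] using hy)

theorem ffun_pos (x : E3) : 0 < ffun x := by unfold ffun; positivity

theorem contDiff_ffun : ContDiff ℝ ∞ ffun := by
  unfold ffun
  have h : ContDiff ℝ ∞ (fun x : E3 => ‖x‖ ^ 2) := contDiff_norm_sq ℝ
  refine ContDiff.div (by fun_prop) (by fun_prop) fun x => by positivity

/-- The quotient `(1 - f²) / |x|⁴`, with a parameter. -/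
def defect (ε : ℝ) (y : E3) : ℝ :=
  ‖y‖ ^ 4 / 16 / (1 + ‖ε • y‖ ^ 2 / 4) ^ 2 * (1 + ffun (ε • y))

/-- Since 1 - f = n²/(1 + n)², a full factor ε⁴ splits off with a quotient smooth in (ε, y). After
division by ε³ the deviation from the limit metric remains smooth up to ε = 0. -/
theorem one_sub_ffun_sq (ε : ℝ) (y : E3) : 1 - ffun (ε • y) ^ 2 = ε ^ 4 * defect ε y := by
  have h : ‖ε • y‖ ^ 4 = ε ^ 4 * ‖y‖ ^ 4 := by
    rw [norm_smul, mul_pow, Real.norm_eq_abs, pow_abs, abs_of_nonneg (by positivity)]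
  have h1 : ε ^ 4 * defect ε y =
      ‖ε • y‖ ^ 4 / 16 / (1 + ‖ε • y‖ ^ 2 / 4) ^ 2 * (1 + ffun (ε • y)) := by
    rw [h, defect]; ring
  rw [h1, ffun]
  field_simp
  ring

theorem defect_nonneg (ε : ℝ) (y : E3) : 0 ≤ defect ε y := by
  have := ffun_pos (ε • y)
  unfold defect; positivity

theorem ffun_sq_le_one (x : E3) : ffun x ^ 2 ≤ 1 := by
  have h := one_sub_ffun_sq 1 x
  have := defect_nonneg 1 x
  rw [one_smul] at h
  linarith

theorem contDiff_defect : ContDiff ℝ ∞ (fun q : ℝ × E3 => defect q.1 q.2) := by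
  unfold defect
  have hs : ContDiff ℝ ∞ (fun q : ℝ × E3 => q.1 • q.2) := contDiff_fst.smul contDiff_snd
  have h : ContDiff ℝ ∞ (fun q : ℝ × E3 => ‖q.1 • q.2‖ ^ 2) := hs.norm_sq ℝ
  have h4 : ContDiff ℝ ∞ (fun q : ℝ × E3 => ‖q.2‖ ^ 4) := by
    have h5 : ContDiff ℝ ∞ (fun q : ℝ × E3 => (‖q.2‖ ^ 2) ^ 2) := (contDiff_snd.norm_sq ℝ).pow 2
    convert! h5 using 2 with q
    ring
  refine (ContDiff.div (h4.div_const 16) (by fun_prop) fun x => by positivity).mul ?_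
  exact contDiff_const.add (contDiff_ffun.comp hs)

variable (z : Fin 3 → Fin 3 → Fin 3 → Fin 3 → Fin 3 → ℝ)

/-- The deviation from the limit metric, blown up at the origin and divided by `ε³`. -/
def deviation (ε : ℝ) (y : E3) : Matrix (Fin 3) (Fin 3) ℝ :=
  cutoff y • ((ε * defect ε y) • (1 : Matrix (Fin 3) (Fin 3) ℝ) + cubicTerm z y)

/-- The metrics of the family, blown up at the origin. -/
def blowup (ε : ℝ) (y : E3) : Matrix (Fin 3) (Fin 3) ℝ :=
  ffun (ε • y) ^ 2 • (1 : Matrix (Fin 3) (Fin 3) ℝ) + ε ^ 3 • deviation z ε y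

/-- The metrics of the family in the stereographic chart. -/
def family (ε : ℝ) (x : E3) : Matrix (Fin 3) (Fin 3) ℝ := blowup z ε (ε⁻¹ • x)

variable {z}

theorem smoothEntriesOn_deviation : SmoothEntriesOn (fun q : ℝ × E3 => deviation z q.1 q.2) univ := by
  intro a b
  refine ContDiff.contDiffOn ?_
  simp only [deviation, Matrix.smul_apply, Matrix.add_apply, smul_eq_mul]
  refine (cutoff.contDiff.comp contDiff_snd).mul ?_
  exact ((contDiff_fst.mul contDiff_defect).mul contDiff_const).add
    ((contDiff_cubicTerm a b).comp contDiff_snd)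

theorem smoothEntriesOn_blowup : SmoothEntriesOn (fun q : ℝ × E3 => blowup z q.1 q.2) univ := by
  intro a b
  simp only [blowup, Matrix.smul_apply, Matrix.add_apply, smul_eq_mul]
  refine ContDiffOn.add ?_ ((contDiff_fst.pow 3).contDiffOn.mul (smoothEntriesOn_deviation a b))
  exact (((contDiff_ffun.comp (contDiff_fst.smul contDiff_snd)).pow 2).mul
    contDiff_const).contDiffOn

theorem smoothEntriesOn_family (ε : ℝ) : SmoothEntriesOn (family z ε) univ := by
  intro a b
  have h : ContDiff ℝ ∞ (fun x : E3 => (ε, ε⁻¹ • x)) :=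
    contDiff_const.prodMk (contDiff_const_smul ε⁻¹)
  have h2 : ContDiff ℝ ∞ (fun q : ℝ × E3 => blowup z q.1 q.2 a b) :=
    contDiffOn_univ.1 (smoothEntriesOn_blowup a b)
  exact (ContDiff.comp (f := fun x : E3 => (ε, ε⁻¹ • x))
    (g := fun q : ℝ × E3 => blowup z q.1 q.2 a b) h2 h).contDiffOn

theorem family_smul {ε : ℝ} (hε : ε ≠ 0) (y : E3) : family z ε (ε • y) = blowup z ε y := by
  rw [family, inv_smul_smul₀ hε]

theorem family_sub {ε : ℝ} (hε : ε ≠ 0) (x : E3) :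
    family z ε x = ffun x ^ 2 • (1 : Matrix (Fin 3) (Fin 3) ℝ) +
      ε ^ 3 • deviation z ε (ε⁻¹ • x) := by
  rw [family, blowup, smul_inv_smul₀ hε]

theorem norm_inv_smul' {ε : ℝ} (hε : 0 < ε) (x : E3) : ‖ε⁻¹ • x‖ = ‖x‖ / ε := by
  rw [norm_smul, norm_inv, Real.norm_of_nonneg hε.le]; ring

theorem family_eq_outside {ε : ℝ} (hε : 0 < ε) {x : E3} (hx : 2 * ε ≤ ‖x‖) :
    family z ε x = ffun x ^ 2 • (1 : Matrix (Fin 3) (Fin 3) ℝ) := by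
  rw [family_sub hε.ne', deviation, cutoff_eq_zero, zero_smul, smul_zero, add_zero]
  rw [norm_inv_smul' hε, le_div_iff₀ hε]; exact hx

/-- Undoing the blow-up, by homogeneity of the cubic term, shows the metric as an interpolation
between f²δ and δ plus the cubic term. -/
theorem family_eq {ε : ℝ} (hε : 0 < ε) (x : E3) :
    family z ε x = (ffun x ^ 2 + cutoff (ε⁻¹ • x) * (1 - ffun x ^ 2)) •
      (1 : Matrix (Fin 3) (Fin 3) ℝ) + cutoff (ε⁻¹ • x) • cubicTerm z x := by
  have h := one_sub_ffun_sq ε (ε⁻¹ • x)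
  rw [smul_inv_smul₀ hε.ne'] at h
  have h2 : ε ^ 3 • cubicTerm z (ε⁻¹ • x) = cubicTerm z x := by
    rw [← cubicTerm_smul, smul_inv_smul₀ hε.ne']
  rw [family_sub hε.ne', deviation, h, ← h2]
  module

theorem family_eq_inside {ε : ℝ} (hε : 0 < ε) {x : E3} (hx : ‖x‖ ≤ ε) :
    family z ε x = 1 + cubicTerm z x := by
  rw [family_eq hε, cutoff_eq_one]
  · module
  · rw [norm_inv_smul' hε, div_le_one hε]; exact hx

theorem family_isSymm (hz : HasRiemannDerivSymmetries z) {ε : ℝ} (hε : 0 < ε) (x : E3) :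
    (family z ε x).IsSymm := by
  rw [family_eq hε]
  exact (Matrix.isSymm_one.smul _).add ((cubicTerm_isSymm hz x).smul _)

theorem family_radial (hz : HasRiemannDerivSymmetries z) {ε : ℝ} (hε : 0 < ε) {x : E3}
    (hx : ‖x‖ ≤ ε) (α : Fin 3) : ∑ β, family z ε x α β * x β = x α := by
  have h := cubicTerm_radial hz x α
  rw [family_eq_inside hε hx]
  simp only [Matrix.add_apply, add_mul, Finset.sum_add_distrib, h]
  simp [Matrix.one_apply]

/-- Radially the cubic term drops out, and an interpolation between f² ≤ 1 and 1 is left. The bound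
holds at every radius, so coordinate balls lie in metric balls of the same radius, in particular for
the radius 2ε. -/
theorem family_radial_le (hz : HasRiemannDerivSymmetries z) {ε : ℝ} (hε : 0 < ε) (t : ℝ) (x : E3) :
    ∑ α, ∑ β, x α * x β * family z ε (t • x) α β ≤ ‖x‖ ^ 2 := by
  have h : ∀ α, ∑ β, cubicTerm z (t • x) α β * x β = 0 := fun α => by
    simp only [cubicTerm_smul, Matrix.smul_apply, smul_eq_mul, mul_assoc]
    rw [← Finset.mul_sum, cubicTerm_radial hz, mul_zero]
  set c := ffun (t • x) ^ 2 + cutoff (ε⁻¹ • t • x) * (1 - ffun (t • x) ^ 2) with hc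
  have h1 : ∀ α, ∑ β, x α * x β * family z ε (t • x) α β = c * x α ^ 2 := by
    intro α
    have e : ∀ β, x α * x β * family z ε (t • x) α β =
        c * (x α * x β * (1 : Matrix (Fin 3) (Fin 3) ℝ) α β) +
        cutoff (ε⁻¹ • t • x) * x α * (cubicTerm z (t • x) α β * x β) := by
      intro β
      rw [family_eq hε]
      simp only [Matrix.add_apply, Matrix.smul_apply, smul_eq_mul]
      ring
    simp only [e, Finset.sum_add_distrib, ← Finset.mul_sum, h]
    simp [Matrix.one_apply]
    ring_nf
    simp
  have hc1 : c ≤ 1 := by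
    have h2 := ffun_sq_le_one (t • x)
    have h3 := cutoff.le_one (x := ε⁻¹ • t • x)
    nlinarith
  rw [EuclideanSpace.norm_sq_eq]
  simp only [h1, ← Finset.mul_sum, Real.norm_eq_abs, sq_abs]
  exact mul_le_of_le_one_left (Finset.sum_nonneg fun _ _ => sq_nonneg _) hc1

/-! ### Scalar curvature of the limit metric -/

/-- The logarithmic derivative `∂_i f / f` of the conformal factor. -/
def drift (i : Fin 3) (x : E3) : ℝ :=
  -(‖x‖ ^ 2 / 4) / ((1 + ‖x‖ ^ 2 / 4) * (1 + ‖x‖ ^ 2 / 2)) * x i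

/-- The scalar curvature of `f² δ`, multiplied by `f²`. -/
def potential (x : E3) : ℝ :=
  ‖x‖ ^ 2 * (5 + 9 * (‖x‖ ^ 2 / 4)) / ((1 + ‖x‖ ^ 2 / 4) * (1 + ‖x‖ ^ 2 / 2)) ^ 2

theorem potential_nonneg (x : E3) : 0 ≤ potential x := by unfold potential; positivity

theorem pderiv_radial {g : ℝ → ℝ} {g' : ℝ} {x : E3} (hg : HasDerivAt g g' (‖x‖ ^ 2)) (i : Fin 3) :
    pderiv i (fun y => g (‖y‖ ^ 2)) x = g' * (2 * x i) := by
  have h := hg.comp_hasFDerivAt x (hasStrictFDerivAt_norm_sq x).hasFDerivAt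
  have h2 : HasFDerivAt (fun y : E3 => g (‖y‖ ^ 2)) _ x := h
  rw [pderiv, h2.fderiv]
  simp [EuclideanSpace.inner_single_right]

theorem contDiff_drift (i : Fin 3) : ContDiff ℝ ∞ (drift i) := by
  unfold drift
  have h : ContDiff ℝ ∞ (fun x : E3 => ‖x‖ ^ 2) := contDiff_norm_sq ℝ
  refine ContDiff.mul (ContDiff.div (by fun_prop) (by fun_prop) fun x => by positivity) ?_
  fun_prop

theorem contDiff_potential : ContDiff ℝ ∞ potential := by
  unfold potential
  have h : ContDiff ℝ ∞ (fun x : E3 => ‖x‖ ^ 2) := contDiff_norm_sq ℝ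
  exact ContDiff.div (by fun_prop) (by fun_prop) fun x => by positivity

theorem pderiv_ffun (i : Fin 3) (x : E3) : pderiv i ffun x = ffun x * drift i x := by
  have hg : HasDerivAt (fun t : ℝ => (1 + t / 2) / (1 + t / 4) ^ 2)
      ((1 / 2 * (1 + ‖x‖ ^ 2 / 4) ^ 2 - (1 + ‖x‖ ^ 2 / 2) * (2 * (1 + ‖x‖ ^ 2 / 4) * (1 / 4))) /
        ((1 + ‖x‖ ^ 2 / 4) ^ 2) ^ 2) (‖x‖ ^ 2) := by
    have h1 : HasDerivAt (fun t : ℝ => 1 + t / 2) (1 / 2) (‖x‖ ^ 2) :=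
      ((hasDerivAt_id _).div_const 2).const_add 1
    have h2 : HasDerivAt (fun t : ℝ => 1 + t / 4) (1 / 4) (‖x‖ ^ 2) :=
      ((hasDerivAt_id _).div_const 4).const_add 1
    have h3 : HasDerivAt (fun t : ℝ => (1 + t / 4) ^ 2)
      (2 * (1 + ‖x‖ ^ 2 / 4) * (1 / 4)) (‖x‖ ^ 2) := by simpa using h2.fun_pow 2
    exact h1.fun_div h3 (by positivity)
  have h := pderiv_radial hg i
  change pderiv i (fun y : E3 => (1 + ‖y‖ ^ 2 / 2) / (1 + ‖y‖ ^ 2 / 4) ^ 2) x = _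
  rw [h, drift, ffun]
  field_simp
  ring

/-- The left side is -8Δρ/ρ for ρ = √f, so the evident sign of `potential` says that ρ is
superharmonic. -/
theorem potential_eq (x : E3) :
    -4 * ∑ i, pderiv i (drift i) x - 2 * ∑ i, drift i x ^ 2 = potential x := by
  set b : ℝ → ℝ := fun t => -(t / 4) / ((1 + t / 4) * (1 + t / 2)) with hb
  have hg : HasDerivAt b
      ((-(1 / 4) * ((1 + ‖x‖ ^ 2 / 4) * (1 + ‖x‖ ^ 2 / 2)) - -(‖x‖ ^ 2 / 4) *
        (1 / 4 * (1 + ‖x‖ ^ 2 / 2) + (1 + ‖x‖ ^ 2 / 4) * (1 / 2))) /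
        ((1 + ‖x‖ ^ 2 / 4) * (1 + ‖x‖ ^ 2 / 2)) ^ 2) (‖x‖ ^ 2) := by
    have h1 : HasDerivAt (fun t : ℝ => 1 + t / 2) (1 / 2) (‖x‖ ^ 2) :=
      ((hasDerivAt_id _).div_const 2).const_add 1
    have h2 : HasDerivAt (fun t : ℝ => 1 + t / 4) (1 / 4) (‖x‖ ^ 2) :=
      ((hasDerivAt_id _).div_const 4).const_add 1
    have h3 : HasDerivAt (fun t : ℝ => -(t / 4)) (-(1 / 4)) (‖x‖ ^ 2) :=
      ((hasDerivAt_id _).div_const 4).fun_neg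
    exact h3.fun_div (h2.fun_mul h1) (by positivity)
  have hd : ∀ i, pderiv i (drift i) x = b (‖x‖ ^ 2) +
      ((-(1 / 4) * ((1 + ‖x‖ ^ 2 / 4) * (1 + ‖x‖ ^ 2 / 2)) - -(‖x‖ ^ 2 / 4) *
        (1 / 4 * (1 + ‖x‖ ^ 2 / 2) + (1 + ‖x‖ ^ 2 / 4) * (1 / 2))) /
        ((1 + ‖x‖ ^ 2 / 4) * (1 + ‖x‖ ^ 2 / 2)) ^ 2) * (2 * x i ^ 2) := by
    intro i
    have e1 : DifferentiableAt ℝ (fun y : E3 => b (‖y‖ ^ 2)) x := by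
      have e0 := hg.comp_hasFDerivAt x (hasStrictFDerivAt_norm_sq x).hasFDerivAt
      exact e0.differentiableAt
    have e2 : DifferentiableAt ℝ (fun y : E3 => y i) x := by fun_prop
    have e3 := pderiv_mul e1 e2 i
    have e4 : pderiv i (fun y : E3 => y i) x = 1 := by
      have : HasFDerivAt (fun y : E3 => y i) (EuclideanSpace.proj i : E3 →L[ℝ] ℝ) x :=
        (EuclideanSpace.proj i : E3 →L[ℝ] ℝ).hasFDerivAt
      rw [pderiv, this.fderiv]; simp
    rw [pderiv_radial hg, e4] at e3
    change pderiv i (fun y : E3 => b (‖y‖ ^ 2) * y i) x = _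
    rw [e3]; ring
  have hx : ‖x‖ ^ 2 = x 0 ^ 2 + x 1 ^ 2 + x 2 ^ 2 := by
    rw [EuclideanSpace.norm_sq_eq]; simp [Fin.sum_univ_three]
  simp only [hd, drift, Finset.sum_add_distrib, ← Finset.mul_sum, mul_pow]
  have e5 : ∑ i, x i ^ 2 = ‖x‖ ^ 2 := by rw [hx, Fin.sum_univ_three]
  rw [e5, hb, potential]
  simp only [Finset.sum_const, Finset.card_univ, Fintype.card_fin]
  have h1 : (1 + ‖x‖ ^ 2 / 4) ≠ 0 := by positivity
  have h2 : (1 + ‖x‖ ^ 2 / 2) ≠ 0 := by positivity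
  clear hd hg e5 hx hb b
  generalize ‖x‖ ^ 2 = n at *
  simp only [nsmul_eq_mul]
  field_simp
  push_cast
  ring

theorem scalarCurvature_limit (x : E3) :
    scalarCurvature (fun y => ffun y ^ 2 • (1 : Matrix (Fin 3) (Fin 3) ℝ)) x =
      (ffun x ^ 2)⁻¹ * potential x := by
  rw [← potential_eq]
  have hf : Differentiable ℝ ffun := contDiff_ffun.differentiable (by simp)
  refine scalarCurvature_conformal (F := fun y => ffun y ^ 2) (p := drift) (hf.fun_pow 2)
    (fun y => (pow_pos (ffun_pos y) 2).ne')
    (fun i => (contDiff_drift i).differentiable (by simp)) (fun i y => ?_) x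
  have h := pderiv_mul (hf y) (hf y) i
  rw [pderiv_ffun] at h
  simp only [pow_two]
  rw [h]; ring

end Family
section Near
open CoordGeometry

/-! ### The blown up metrics are close to the Euclidean one -/

variable {z : Fin 3 → Fin 3 → Fin 3 → Fin 3 → Fin 3 → ℝ}

/-- A tube argument: `F` is constant on the slice ε = 0, and the closed ball of radius two is
compact. -/
theorem eventually_near {F : ℝ × E3 → ℝ} {U : Set (ℝ × E3)} (hU : IsOpen U)
    (hF : ContinuousOn F U) (h0 : ∀ y, ((0 : ℝ), y) ∈ U) {c : ℝ} (hc : ∀ y, F (0, y) = c) {η : ℝ}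
    (hη : 0 < η) : ∀ᶠ ε in 𝓝 (0 : ℝ), ∀ y : E3, ‖y‖ ≤ 2 → |F (ε, y) - c| < η := by
  have h1 : ∀ y ∈ Metric.closedBall (0 : E3) 2, ∀ᶠ q : ℝ × E3 in 𝓝 ((0 : ℝ), y),
      |F (q.1, q.2) - c| < η := by
    intro y _
    have h2 : ContinuousAt F ((0 : ℝ), y) := hF.continuousAt (hU.mem_nhds (h0 y))
    have h3 := Metric.tendsto_nhds.1 h2 η hη
    filter_upwards [h3] with q hq
    rw [hc, Real.dist_eq] at hq
    exact hq
  have h4 := (isCompact_closedBall (0 : E3) 2).eventually_forall_of_forall_eventually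
    (x₀ := (0 : ℝ)) (P := fun ε y => |F (ε, y) - c| < η) h1
  filter_upwards [h4] with ε hε y hy
  exact hε y (by simpa using hy)

/-- An error of 1/6 in the entry i, j costs at most (vᵢ² + vⱼ²)/12, and the nine entries together
cost half of |v|². -/
theorem half_sq_le_of_near {A : Matrix (Fin 3) (Fin 3) ℝ}
    (hA : ∀ i j, |A i j - (1 : Matrix (Fin 3) (Fin 3) ℝ) i j| ≤ 1 / 6) (v : Fin 3 → ℝ) :
    (1 / 2) * ∑ i, v i ^ 2 ≤ ∑ i, ∑ j, A i j * v i * v j := by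
  have h : ∀ i j, (1 : Matrix (Fin 3) (Fin 3) ℝ) i j * v i * v j -
      (1 / 12) * (v i ^ 2 + v j ^ 2) ≤ A i j * v i * v j := by
    intro i j
    have h1 : |(A i j - (1 : Matrix (Fin 3) (Fin 3) ℝ) i j) * (v i * v j)| ≤
        1 / 6 * |v i * v j| := by
      rw [abs_mul]; exact mul_le_mul_of_nonneg_right (hA i j) (abs_nonneg _)
    have h2 : |v i * v j| ≤ (v i ^ 2 + v j ^ 2) / 2 := by
      rw [abs_le]; constructor <;> nlinarith [sq_nonneg (v i + v j), sq_nonneg (v i - v j)]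
    have h3 := (abs_le.1 h1).1
    nlinarith
  have h4 : ∑ i, ∑ j, ((1 : Matrix (Fin 3) (Fin 3) ℝ) i j * v i * v j -
      (1 / 12) * (v i ^ 2 + v j ^ 2)) = (1 / 2) * ∑ i, v i ^ 2 := by
    simp [Fin.sum_univ_three, Matrix.one_apply]; ring
  rw [← h4]
  exact Finset.sum_le_sum fun i _ => Finset.sum_le_sum fun j _ => h i j

theorem ffun_zero : ffun 0 = 1 := by simp [ffun]

theorem blowup_zero (y : E3) : blowup z 0 y = 1 := by
  simp [blowup, ffun_zero]

theorem posDef_of_half_sq_le {A : Matrix (Fin 3) (Fin 3) ℝ} (hs : A.IsSymm)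
    (hA : ∀ v : Fin 3 → ℝ, (1 / 2) * ∑ i, v i ^ 2 ≤ ∑ i, ∑ j, A i j * v i * v j) : A.PosDef := by
  refine Matrix.posDef_iff_dotProduct_mulVec.2 ⟨?_, fun {v} hv => ?_⟩
  · rw [Matrix.IsHermitian, Matrix.conjTranspose_eq_transpose_of_trivial]; exact hs
  · have h1 : star v ⬝ᵥ A.mulVec v = ∑ i, ∑ j, A i j * v i * v j := by
      simp only [dotProduct, Matrix.mulVec, Finset.mul_sum, star_trivial]
      exact Finset.sum_congr rfl fun a _ => Finset.sum_congr rfl fun b _ => by ring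
    rw [h1]
    refine lt_of_lt_of_le ?_ (hA v)
    obtain ⟨k, hk⟩ := Function.ne_iff.1 hv
    have : 0 < ∑ i, v i ^ 2 := Finset.sum_pos' (fun _ _ => sq_nonneg _)
      ⟨k, Finset.mem_univ _, (sq_pos_of_ne_zero hk :)⟩
    linarith

/-- The estimates on the metrics of the family near the origin. -/
structure FamilyBounds (z : Fin 3 → Fin 3 → Fin 3 → Fin 3 → Fin 3 → ℝ) (η ε : ℝ) : Prop where
  pos : 0 < ε
  posDef : ∀ x, (family z ε x).PosDef
  half_le : ∀ x : E3, ‖x‖ ≤ 2 * ε → 1 / 2 ≤ √(family z ε x).det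
  le_two : ∀ x : E3, ‖x‖ ≤ 2 * ε → √(family z ε x).det ≤ 2
  grad_le : ∀ x : E3, ‖x‖ ≤ 2 * ε → ∀ v : Fin 3 → ℝ, (1 / 2) * ∑ i, v i ^ 2 ≤
    √(family z ε x).det * ∑ i, ∑ j, (family z ε x)⁻¹ i j * v i * v j
  scal_le : ∀ x : E3, ‖x‖ ≤ 2 * ε → |scalarCurvature (family z ε) x| ≤ η / ε ^ 2

/-- The blown up metrics extend smoothly to ε = 0, where they are Euclidean, so for small ε they are
nearly flat on the ball of radius two. Scaling back leaves the determinant and the inverse at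
corresponding points unchanged and multiplies the scalar curvature by ε⁻², hence the bound η/ε². -/
theorem eventually_familyBounds (hz : HasRiemannDerivSymmetries z) {η : ℝ} (hη : 0 < η) :
    ∀ᶠ ε in 𝓝[>] (0 : ℝ), FamilyBounds z η ε := by
  set B : ℝ × E3 → Matrix (Fin 3) (Fin 3) ℝ := fun q => blowup z q.1 q.2 with hB
  have hBs : SmoothEntriesOn B univ := smoothEntriesOn_blowup
  have hdetc : Continuous fun q => (B q).det :=
    continuousOn_univ.1 (contDiffOn_det hBs).continuousOn
  -- Inverse and curvature are smooth only where the determinant does not vanish; this open set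
  -- contains the slice ε = 0.
  set U : Set (ℝ × E3) := {q | (B q).det ≠ 0} with hUdef
  have hU : IsOpen U := isOpen_ne_fun hdetc continuous_const
  have hBU : SmoothEntriesOn B U := fun a b => (hBs a b).mono (subset_univ _)
  have hB0 : ∀ y, B (0, y) = 1 := fun y => blowup_zero y
  have h0 : ∀ y, ((0 : ℝ), y) ∈ U := fun y => by simp [hUdef, hB0]
  have n1 : ∀ i j, ∀ᶠ ε in 𝓝 (0 : ℝ), ∀ y : E3, ‖y‖ ≤ 2 →
      |B (ε, y) i j - (1 : Matrix (Fin 3) (Fin 3) ℝ) i j| < 1 / 6 := fun i j =>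
    eventually_near (F := fun q => B q i j) hU (hBU i j).continuousOn h0
      (fun y => by simp only [hB0]) (by norm_num)
  have n2 : ∀ᶠ ε in 𝓝 (0 : ℝ), ∀ y : E3, ‖y‖ ≤ 2 → |√(B (ε, y)).det - 1| < 1 / 2 :=
    eventually_near (F := fun q => √(B q).det) isOpen_univ hdetc.sqrt.continuousOn
      (fun _ => trivial) (fun y => by simp only [hB0]; simp) (by norm_num)
  have n3 : ∀ i j, ∀ᶠ ε in 𝓝 (0 : ℝ), ∀ y : E3, ‖y‖ ≤ 2 →
      |√(B (ε, y)).det * (B (ε, y))⁻¹ i j - (1 : Matrix (Fin 3) (Fin 3) ℝ) i j| < 1 / 6 :=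
    fun i j => eventually_near (F := fun q => √(B q).det * (B q)⁻¹ i j) hU
      (hdetc.sqrt.continuousOn.mul (hBU.inv (fun q hq => hq) i j).continuousOn) h0
      (fun y => by simp only [hB0]; simp) (by norm_num)
  have n4 : ∀ᶠ ε in 𝓝 (0 : ℝ), ∀ y : E3, ‖y‖ ≤ 2 →
      |scalarCurvature (fun y => B (ε, y)) y - 0| < η := by
    refine eventually_near (F := fun q => scalarCurvature (fun y => B (q.1, y)) q.2) hU
      (contDiffOn_scalarCurvature_param hU hBU fun q hq => hq).continuousOn h0 (fun y => ?_) hη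
    simp only [hB0]
    have hc : ∀ k i j, christoffel (fun _ => (1 : Matrix (Fin 3) (Fin 3) ℝ)) k i j = fun _ => 0 :=
      fun k i j => by ext y; simp [christoffel, pderiv]
    simp [scalarCurvature, ricci, hc, pderiv]
  have n1' := eventually_all.2 fun i => eventually_all.2 fun j => n1 i j
  have n3' := eventually_all.2 fun i => eventually_all.2 fun j => n3 i j
  filter_upwards [n1'.filter_mono nhdsWithin_le_nhds, n2.filter_mono nhdsWithin_le_nhds,
    n3'.filter_mono nhdsWithin_le_nhds, n4.filter_mono nhdsWithin_le_nhds,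
    self_mem_nhdsWithin] with ε m1 m2 m3 m4 hε
  have hε : 0 < ε := hε
  have hn : ∀ x : E3, ‖x‖ ≤ 2 * ε → ‖ε⁻¹ • x‖ ≤ 2 := fun x hx => by
    rw [norm_inv_smul' hε, div_le_iff₀ hε]; exact hx
  have hfam : ∀ x, family z ε x = B (ε, ε⁻¹ • x) := fun x => rfl
  have hpd : ∀ x, (family z ε x).PosDef := by
    intro x
    by_cases hx : ‖x‖ ≤ 2 * ε
    · refine posDef_of_half_sq_le (family_isSymm hz hε x) (half_sq_le_of_near fun i j => ?_)
      rw [hfam]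
      exact (m1 i j _ (hn x hx)).le
    · rw [family_eq_outside hε (not_le.1 hx).le]
      exact Matrix.PosDef.one.smul (pow_pos (ffun_pos x) 2)
  refine ⟨hε, hpd, fun x hx => ?_, fun x hx => ?_, fun x hx v => ?_, fun x hx => ?_⟩
  · have := (abs_lt.1 (m2 _ (hn x hx))).1
    rw [hfam]; linarith
  · have := (abs_lt.1 (m2 _ (hn x hx))).2
    rw [hfam]; linarith
  · have := half_sq_le_of_near (A := √(family z ε x).det • (family z ε x)⁻¹)
      (fun i j => by rw [hfam]; exact (m3 i j _ (hn x hx)).le) v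
    refine this.trans (le_of_eq ?_)
    simp only [Matrix.smul_apply, smul_eq_mul, Finset.mul_sum, mul_assoc]
  · have h5 := scalarCurvature_comp_smul hε.ne' (smoothEntriesOn_family (z := z) ε)
      (family_isSymm hz hε) (fun y => (hpd y).det_pos.ne') (ε⁻¹ • x)
    simp only [family_smul hε.ne', smul_inv_smul₀ hε.ne'] at h5
    have h6 := m4 _ (hn x hx)
    rw [sub_zero] at h6
    simp only [hB] at h6
    rw [h5, abs_mul, abs_of_pos (pow_pos hε 2)] at h6
    rw [le_div_iff₀ (pow_pos hε 2)]
    linarith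

end Near

/-! ### The family as smooth metrics on the manifold -/

section FamilyMetric
open CoordGeometry

variable {S : Type*} [TopologicalSpace S] [ChartedSpace (EuclideanSpace ℝ (Fin 3)) S]
  [IsManifold (𝓡 3) ∞ S] [T2Space S]
  (Ψ : S ≃ₘ⟮𝓡 3, 𝓡 3⟯ (Metric.sphere (0 : EuclideanSpace ℝ (Fin 4)) 1))
  (v : Metric.sphere (0 : E4) 1)
  {z : Fin 3 → Fin 3 → Fin 3 → Fin 3 → Fin 3 → ℝ}

theorem fieldVal_conformal_comm (w : S → ℝ) (p : S) (a b : E3) :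
    fieldVal (conformalRescale w (roundMetric Ψ)) p a b =
      fieldVal (conformalRescale w (roundMetric Ψ)) p b a :=
  congrArg (w p ^ 2 * ·) (real_inner_comm (F := E4) _ _)

/-- The limit of the family of metrics. -/
def limitField : BilinField S := conformalRescale (heightFactor Ψ v) (roundMetric Ψ)

/-- The metrics of the family. -/
def familyMetric (hz : HasRiemannDerivSymmetries z) {η ε : ℝ} (hb : FamilyBounds z η ε) :
    SmoothMetric S :=
  patchMetric (stereoChart_mem Ψ v) (A := family z ε)
    (fun a b => (smoothEntriesOn_family ε a b).mono (subset_univ _))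
    (fun x _ => family_isSymm hz hb.pos x) (fun x _ => hb.posDef x)
    (T := limitField Ψ v) (fun p a b => fieldVal_conformal_comm Ψ _ p a b)
    (conformal_round_pos Ψ (heightFactor_pos Ψ v))
    (contMDiff_conformal_round Ψ (contMDiff_heightFactor Ψ v))
    (K := Metric.closedBall 0 (2 * ε)) (isCompact_closedBall _ _)
    (by rw [stereoChart_target]; exact subset_univ _)
    (fun x _ hx => by
      rw [limitField, chartCoeff_limit, family_eq_outside hb.pos]
      rw [Metric.mem_closedBall, dist_zero_right, not_le] at hx
      exact hx.le)

variable (hz : HasRiemannDerivSymmetries z) {η ε : ℝ} (hb : FamilyBounds z η ε)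

theorem familyMetric_inner : (familyMetric Ψ v hz hb).inner =
    patchField (stereoChart Ψ v) (family z ε) (limitField Ψ v) := rfl

theorem chartCoeff_familyMetric (x : E3) :
    chartCoeff (familyMetric Ψ v hz hb).inner (stereoChart Ψ v) x = family z ε x := by
  rw [familyMetric_inner, chartCoeff_patchField (stereoChart_mem Ψ v)]
  rw [stereoChart_target]; trivial

theorem familyMetric_eq_limit {p : S}
    (hp : p ∈ (stereoChart Ψ v).source → 2 * ε ≤ ‖stereoChart Ψ v p‖) :
    (familyMetric Ψ v hz hb).inner p = limitField Ψ v p := by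
  rw [familyMetric_inner, patchField_eq (stereoChart_mem Ψ v)]
  intro h
  rw [limitField, chartCoeff_limit, family_eq_outside hb.pos (hp h)]

end FamilyMetric
section Distance
open CoordGeometry

/-! ### Riemannian distance -/

variable {M : Type*} [TopologicalSpace M] [ChartedSpace (EuclideanSpace ℝ (Fin 3)) M]
  [IsManifold (𝓡 3) ∞ M] {e : OpenPartialHomeomorph M E3} {h : SmoothMetric M}

/-- The differential of a function, as a linear form on the model space. -/
def diffVal (F : M → ℝ) (p : M) : E3 →L[ℝ] ℝ := mfderiv (𝓡 3) 𝓘(ℝ, ℝ) F p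

/-- A function whose differential has norm at most 1 is 1-Lipschitz, by integration along paths.
Such functions provide the lower bounds for the distance. -/
theorem enorm_sub_le_metricEDist {F : M → ℝ} (hF : ContMDiff (𝓡 3) 𝓘(ℝ, ℝ) 1 F)
    (hd : ∀ p (a : E3), diffVal F p a ^ 2 ≤ fieldVal h.inner p a a)
    (p q : M) : ‖F p - F q‖ₑ ≤ metricEDist h p q := by
  let _ : RiemannianBundle (fun p : M => TangentSpace (𝓡 3) p) := ⟨h.toRiemannianMetric⟩
  refine le_of_forall_gt fun r hr => ?_
  obtain ⟨γ, h0, h1, hγ, hlt⟩ := exists_lt_of_riemannianEDist_lt (show riemannianEDist (𝓡 3) p q < r from hr)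
  refine lt_of_le_of_lt ?_ hlt
  have D : ContDiffOn ℝ 1 (F ∘ γ) (Icc 0 1) := by
    rw [← contMDiffOn_iff_contDiffOn]
    exact hF.comp_contMDiffOn hγ
  have h2 := enorm_sub_le_lintegral_derivWithin_Icc_of_contDiffOn_Icc D zero_le_one
  rw [enorm_sub_rev, ← h0, ← h1]
  refine h2.trans ?_
  rw [pathELength_eq_lintegral_mfderivWithin_Icc]
  refine setLIntegral_mono' measurableSet_Icc fun t ht => ?_
  have hu : UniqueMDiffWithinAt 𝓘(ℝ, ℝ) (Icc (0 : ℝ) 1) t :=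
    (uniqueDiffOn_Icc zero_lt_one t ht).uniqueMDiffWithinAt
  have hc := mfderiv_comp_mfderivWithin t ((hF (γ t)).mdifferentiableAt (by simp))
    ((hγ t ht).mdifferentiableWithinAt (by simp)) hu
  set w := mfderivWithin 𝓘(ℝ, ℝ) (𝓡 3) γ (Icc 0 1) t 1
  have hv : derivWithin (F ∘ γ) (Icc 0 1) t = diffVal F (γ t) w := by
    rw [← fderivWithin_derivWithin, ← mfderivWithin_eq_fderivWithin]
    exact congrArg (fun L : ℝ →L[ℝ] ℝ => L 1) hc
  rw [hv]
  have hw : diffVal F (γ t) w ^ 2 ≤ ‖w‖ ^ 2 := by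
    rw [← real_inner_self_eq_norm_sq]
    exact hd (γ t) w
  have hw2 : |diffVal F (γ t) w| ≤ ‖w‖ :=
    abs_le_of_sq_le_sq hw (norm_nonneg _)
  rw [← ofReal_norm, ← ofReal_norm]
  exact ENNReal.ofReal_le_ofReal hw2

/-- By the hypothesis the segment from 0 to x has speed at most |x| at all times, hence length at
most |x|. -/
theorem metricEDist_chart_le (he : e ∈ IsManifold.maximalAtlas (𝓡 3) ∞ M) (ht : e.target = univ)
    (hG : ∀ (t : ℝ) (x : E3), ∑ i, ∑ j, x i * x j * chartCoeff h.inner e (t • x) i j ≤ ‖x‖ ^ 2)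
    (x : E3) : metricEDist h (e.symm 0) (e.symm x) ≤ ENNReal.ofReal ‖x‖ := by
  let _ : RiemannianBundle (fun p : M => TangentSpace (𝓡 3) p) := ⟨h.toRiemannianMetric⟩
  have hs : ∀ y : E3, y ∈ e.target := fun y => by rw [ht]; trivial
  set γ : ℝ → M := fun t => e.symm (t • x) with hγd
  have hl : ContMDiff 𝓘(ℝ, ℝ) (𝓡 3) 1 (fun t : ℝ => t • x) :=
    (contDiff_id.smul contDiff_const).contMDiff
  have hγ : ContMDiff 𝓘(ℝ, ℝ) (𝓡 3) 1 γ := by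
    intro t
    exact ContMDiffAt.comp t (((contMDiffOn_symm_of_mem_maximalAtlas he).contMDiffAt
      (e.open_target.mem_nhds (hs _))).of_le (by simp)) (hl t)
  refine (riemannianEDist_le_pathELength (γ := γ) (a := 0) (b := 1) hγ.contMDiffOn
    (by simp [hγd]) (by simp [hγd]) zero_le_one).trans ?_
  rw [pathELength_eq_lintegral_mfderiv_Icc]
  have hb : ∀ t ∈ Icc (0 : ℝ) 1, ‖mfderiv 𝓘(ℝ, ℝ) (𝓡 3) γ t 1‖ₑ ≤ ENNReal.ofReal ‖x‖ := by
    intro t _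
    have hc := mfderiv_comp t (mdifferentiableAt_chart_symm he (hs (t • x)))
      ((hl t).mdifferentiableAt (by simp))
    have h1 : HasDerivAt (fun t : ℝ => t • x) ((1 : ℝ) • x) t := (hasDerivAt_id t).smul_const x
    have h2 : mfderiv 𝓘(ℝ, ℝ) (𝓡 3) γ t 1 = chartFrame e (t • x) x := by
      change (mfderiv 𝓘(ℝ, ℝ) (𝓡 3) (e.symm ∘ fun t : ℝ => t • x) t) 1 = _
      rw [hc]
      change chartFrame e (t • x) (mfderiv 𝓘(ℝ, ℝ) 𝓘(ℝ, E3) (fun t : ℝ => t • x) t 1) = _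
      rw [mfderiv_eq_fderiv]
      have h4 : (fderiv ℝ (fun t : ℝ => t • x) t) (1 : ℝ) = x := by
        rw [fderiv_apply_one_eq_deriv, h1.deriv, one_smul]
      exact congrArg (chartFrame e (t • x)) h4
    rw [← ofReal_norm]
    refine ENNReal.ofReal_le_ofReal (abs_le_of_sq_le_sq' ?_ (norm_nonneg _)).2
    rw [← real_inner_self_eq_norm_sq]
    have h3 : fieldVal h.inner (e.symm (t • x)) (chartFrame e (t • x) x) (chartFrame e (t • x) x)
      ≤ ‖x‖ ^ 2 := by rw [fieldVal_chartFrame]; exact hG t x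
    rw [← h2] at h3
    exact h3
  refine (setLIntegral_mono' measurableSet_Icc hb).trans ?_
  simp

/-- A profile function that grows at unit speed on most of `[0, ε]` and is constant elsewhere. -/
theorem exists_radial_profile {ε c : ℝ} (hc : 0 < c) (hcε : c < ε) : ∃ m k : ℝ → ℝ,
    (∀ s, HasDerivAt m (k s) s) ∧ Continuous k ∧ (∀ s, 0 ≤ k s) ∧ (∀ s, k s ≤ 1) ∧
    (∀ᶠ s in 𝓝 0, m s = 0) ∧ (∀ s, ε ≤ s → m s = m ε) ∧ (∀ s, ε ≤ s → k s = 0) ∧ c ≤ m ε := by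
  have h1 : (0 : ℝ) < c / 2 := by positivity
  have h2 : c / 2 < (c + ε) / 4 := by linarith
  -- The bump is 1 on an interval of length c and vanishes outside one of length (c + ε)/2 < ε, both
  -- centred at ε/2. Its primitive vanishes near 0, is constant beyond ε and gains at least c.
  let k : ContDiffBump (ε / 2) := ⟨c / 2, (c + ε) / 4, h1, h2⟩
  have hk : Continuous k := k.continuous
  have hk0 : ∀ s, (c + ε) / 4 ≤ |s - ε / 2| → k s = 0 := fun s hs =>
    k.zero_of_le_dist (by rw [Real.dist_eq]; exact hs)
  have hk1 : ∀ s ∈ Icc (ε / 2 - c / 2) (ε / 2 + c / 2), k s = 1 := fun s hs =>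
    k.one_of_mem_closedBall (by
      rw [Metric.mem_closedBall, Real.dist_eq, abs_le]
      change -(c / 2) ≤ s - ε / 2 ∧ s - ε / 2 ≤ c / 2
      exact ⟨by linarith [hs.1], by linarith [hs.2]⟩)
  have hke : ∀ s, ε ≤ s → k s = 0 := fun s hs => hk0 s (by
    rw [abs_of_nonneg (by linarith)]; linarith)
  have hi : ∀ a b, IntervalIntegrable k volume a b := fun a b => hk.intervalIntegrable a b
  refine ⟨fun s => ∫ τ in (0 : ℝ)..s, k τ, k, fun s => hk.integral_hasStrictDerivAt 0 s |>.hasDerivAt,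
    hk, fun s => k.nonneg, fun s => k.le_one, ?_, ?_, hke, ?_⟩
  · filter_upwards [Metric.ball_mem_nhds (0 : ℝ) (show 0 < (ε - c) / 4 by linarith)] with s hs
    rw [Metric.mem_ball, Real.dist_eq, sub_zero, abs_lt] at hs
    rw [intervalIntegral.integral_congr (g := fun _ => (0 : ℝ)), intervalIntegral.integral_zero]
    intro τ hτ
    refine hk0 τ ?_
    rw [mem_uIcc] at hτ
    rw [abs_of_neg (by rcases hτ with h | h <;> linarith [h.1, h.2, hs.1, hs.2])]
    rcases hτ with h | h <;> linarith [h.1, h.2, hs.1, hs.2]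
  · intro s hs
    change (∫ τ in (0 : ℝ)..s, k τ) = ∫ τ in (0 : ℝ)..ε, k τ
    rw [← intervalIntegral.integral_add_adjacent_intervals (hi 0 ε) (hi ε s),
      intervalIntegral.integral_congr (a := ε) (g := fun _ => (0 : ℝ)),
      intervalIntegral.integral_zero, add_zero]
    intro τ hτ
    rw [uIcc_of_le hs] at hτ
    exact hke τ hτ.1
  · have h3 : c = ∫ τ in (ε / 2 - c / 2)..(ε / 2 + c / 2), k τ := by
      rw [intervalIntegral.integral_congr (g := fun _ => (1 : ℝ))]
      · simp
      · intro τ hτ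
        rw [uIcc_of_le (by linarith)] at hτ
        exact hk1 τ hτ
    conv_lhs => rw [h3]
    exact intervalIntegral.integral_mono_interval (by linarith) (by linarith) (by linarith)
      (Eventually.of_forall fun s => k.nonneg) (hi _ _)

/-- The Cauchy–Schwarz inequality for G: as G x = x, the G-products of x with c and with itself are
the Euclidean ones. -/
theorem sq_sum_le_of_radial {G : Matrix (Fin 3) (Fin 3) ℝ} (hG : G.PosDef) {x : E3}
    (hx : ∀ i, ∑ j, G i j * x j = x i) (c : E3) :
    (inner ℝ x c) ^ 2 ≤ ‖x‖ ^ 2 * ∑ i, ∑ j, c i * c j * G i j := by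
  have hnn : ∀ y : E3, 0 ≤ ∑ i, ∑ j, y i * y j * G i j := by
    intro y
    by_cases hy : y.ofLp = 0
    · simp [hy]
    have h2 := (Matrix.posDef_iff_dotProduct_mulVec.1 hG).2 hy
    have h3 : star y.ofLp ⬝ᵥ G.mulVec y.ofLp = ∑ i, ∑ j, y i * y j * G i j := by
      simp only [dotProduct, Matrix.mulVec, Finset.mul_sum, star_trivial]
      exact Finset.sum_congr rfl fun a _ => Finset.sum_congr rfl fun b _ => by ring
    exact h3 ▸ h2.le
  have hsy : ∀ i j, G i j = G j i := fun i j => by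
    have := hG.isHermitian.apply i j
    simpa using this.symm
  have hxc : inner ℝ x c = ∑ i, x i * c i := by
    simp [PiLp.inner_apply, mul_comm]
  have hxx : ‖x‖ ^ 2 = ∑ i, x i ^ 2 := by simp [EuclideanSpace.norm_sq_eq]
  have key : ∀ t : ℝ, 0 ≤ ‖x‖ ^ 2 * (t * t) + 2 * inner ℝ x c * t +
      ∑ i, ∑ j, c i * c j * G i j := by
    intro t
    have h1 := hnn (c + t • x)
    have e : ∑ i, ∑ j, (c + t • x) i * (c + t • x) j * G i j =
        ∑ i, ∑ j, c i * c j * G i j + 2 * t * ∑ i, c i * ∑ j, G i j * x j +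
        t ^ 2 * ∑ i, x i * ∑ j, G i j * x j := by
      simp only [Fin.sum_univ_three, PiLp.add_apply, PiLp.smul_apply, smul_eq_mul]
      rw [hsy 1 0, hsy 2 0, hsy 2 1]
      ring
    rw [e] at h1
    simp only [hx] at h1
    rw [hxc, hxx]
    simp only [Fin.sum_univ_three] at h1 ⊢
    nlinarith
  have := discrim_le_zero key
  rw [discrim] at this
  nlinarith

theorem SmoothMetric.fieldVal_nonneg (h : SmoothMetric M) (p : M) (a : E3) :
    0 ≤ fieldVal h.inner p a a := by
  by_cases ha : a = 0
  · have h0 : h.inner p (0 : TangentSpace (𝓡 3) p) = 0 := map_zero _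
    have h1 : fieldVal h.inner p 0 0 = 0 :=
      congrArg (fun L : TangentSpace (𝓡 3) p →L[ℝ] ℝ => L 0) h0
    rw [ha, h1]
  · exact (h.pos p a ha).le

/-- Outside of the coordinate ball of radius `ε` the distance from the center is at least `ε`, if
the Gauss lemma holds on this ball. -/
theorem le_metricEDist_of_radial [T2Space M] (he : e ∈ IsManifold.maximalAtlas (𝓡 3) ∞ M)
    (ht : e.target = univ) {ε : ℝ}
    (hG : ∀ x : E3, ‖x‖ ≤ ε → ∀ i, ∑ j, chartCoeff h.inner e x i j * x j = x i) {q : M}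
    (hq : q ∈ e.source → ε ≤ ‖e q‖) : ENNReal.ofReal ε ≤ metricEDist h (e.symm 0) q := by
  classical
  -- The function |x| is not smooth at the origin and has to become constant beyond ε. Its
  -- smoothings lose a little growth, so c < ε comes first and the supremum over c afterwards.
  suffices H : ∀ c, 0 < c → c < ε → ENNReal.ofReal c ≤ metricEDist h (e.symm 0) q by
    refine ENNReal.le_of_forall_nnreal_lt fun r hr => ?_
    rcases eq_or_ne r 0 with rfl | hr0
    · simp
    rw [← ENNReal.ofReal_coe_nnreal] at hr ⊢
    exact H r (NNReal.coe_pos.2 (pos_iff_ne_zero.2 hr0))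
      ((ENNReal.ofReal_lt_ofReal_iff_of_nonneg r.2).1 hr)
  intro c hc hcε
  obtain ⟨m, k, hm, hkc, hk0, hk1, hm0, hmε, hkε, hcm⟩ := exists_radial_profile hc hcε
  have hε : 0 < ε := hc.trans hcε
  have hs : ∀ y : E3, y ∈ e.target := fun y => by rw [ht]; trivial
  have hmz : m 0 = 0 := hm0.self_of_nhds
  set l : E3 → ℝ := fun x => m ‖x‖ with hl
  have hmC : ContDiff ℝ 1 m := contDiff_one_iff_deriv.2 ⟨fun s => (hm s).differentiableAt, by
    rw [show deriv m = k from funext fun s => (hm s).deriv]; exact hkc⟩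
  have hl0 : l =ᶠ[𝓝 0] fun _ => 0 := by
    have h1 : Tendsto (fun x : E3 => ‖x‖) (𝓝 0) (𝓝 0) := by
      simpa using (continuous_norm (E := E3)).tendsto 0
    exact h1.eventually hm0
  have hlC : ContDiff ℝ 1 l := contDiff_iff_contDiffAt.2 fun x => by
    by_cases hx : x = 0
    · subst hx
      exact contDiffAt_const.congr_of_eventuallyEq hl0
    · exact hmC.contDiffAt.comp x (contDiffAt_norm ℝ hx)
  have hld : ∀ x c : E3, fderiv ℝ l x c ^ 2 ≤
      ∑ i, ∑ j, c i * c j * chartCoeff h.inner e x i j := by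
    intro x c
    have hpd := h.posDef_chartCoeff he (hs x)
    have hnn : 0 ≤ ∑ i, ∑ j, c i * c j * chartCoeff h.inner e x i j := by
      rw [← fieldVal_chartFrame]
      exact h.fieldVal_nonneg _ _
    by_cases hx : x = 0
    · subst hx
      rw [hl0.fderiv_eq]; simpa using hnn
    have hxn : 0 < ‖x‖ := norm_pos_iff.2 hx
    have hn : HasFDerivAt (fun y : E3 => ‖y‖) (‖x‖⁻¹ • innerSL ℝ x) x := by
      have h1 := (hasStrictFDerivAt_norm_sq x).hasFDerivAt.sqrt (by positivity)
      simp only [Real.sqrt_sq (norm_nonneg _)] at h1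
      convert! h1 using 1
      ext a
      simp
      field_simp
    have hd : fderiv ℝ l x c = k ‖x‖ * (‖x‖⁻¹ * inner ℝ x c) := by
      have h1 := (hm ‖x‖).comp_hasFDerivAt x hn
      have h2 : HasFDerivAt l _ x := h1
      rw [h2.fderiv]
      simp
    by_cases hxε : ε ≤ ‖x‖
    · rw [hd, hkε _ hxε]; simpa using hnn
    have h3 := sq_sum_le_of_radial hpd (hG x (not_le.1 hxε).le) c
    rw [hd, mul_pow, mul_pow, inv_pow]
    have h4 : k ‖x‖ ^ 2 ≤ 1 := pow_le_one₀ (hk0 _) (hk1 _)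
    have h5 : (‖x‖ ^ 2)⁻¹ * inner ℝ x c ^ 2 ≤ ∑ i, ∑ j, c i * c j * chartCoeff h.inner e x i j := by
      rw [inv_mul_le_iff₀ (by positivity)]; exact h3
    exact (mul_le_of_le_one_left (by positivity) h4).trans h5
  -- The value `m ε` off the chart continues the function smoothly, because `m` is already constant
  -- outside the compact ball of radius ε.
  set F : M → ℝ := fun p => if p ∈ e.source then l (e p) else m ε with hF
  have hFs : ∀ p ∈ e.source, F =ᶠ[𝓝 p] fun p => l (e p) := fun p hp => by
    filter_upwards [e.open_source.mem_nhds hp] with p' hp' using if_pos hp'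
  have hFo : ∀ p ∉ e.source, F =ᶠ[𝓝 p] fun _ => m ε := fun p hp => by
    have hcl : IsClosed (e.symm '' Metric.closedBall 0 ε) :=
      ((isCompact_closedBall (0 : E3) ε).image_of_continuousOn
        (e.continuousOn_symm.mono fun y _ => hs y)).isClosed
    have hpK : p ∈ (e.symm '' Metric.closedBall 0 ε)ᶜ := by
      rintro ⟨x, hx, rfl⟩
      exact hp (e.map_target (hs x))
    filter_upwards [hcl.isOpen_compl.mem_nhds hpK] with p' hp'
    by_cases h1 : p' ∈ e.source
    · have h2 : ε ≤ ‖e p'‖ := by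
        by_contra h3
        exact hp' ⟨e p', by simpa using (not_le.1 h3).le, e.left_inv h1⟩
      simp only [hF, if_pos h1, hl, hmε _ h2]
    · exact if_neg h1
  have hFC : ContMDiff (𝓡 3) 𝓘(ℝ, ℝ) 1 F := by
    intro p
    by_cases hp : p ∈ e.source
    · refine ContMDiffAt.congr_of_eventuallyEq ?_ (hFs p hp)
      exact ContMDiffAt.comp (g := l) p hlC.contMDiff.contMDiffAt
        ((contMDiffAt_of_mem_maximalAtlas he hp).of_le (by simp))
    · exact contMDiffAt_const.congr_of_eventuallyEq (hFo p hp)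
  have hFd : ∀ p (a : E3), diffVal F p a ^ 2 ≤ fieldVal h.inner p a a := by
    intro p a
    by_cases hp : p ∈ e.source
    · have h1 : diffVal F p a = fderiv ℝ l (e p) (chartCoframe e p a) := by
        have h2 := mfderiv_comp p (g := l)
          (hlC.contMDiff.mdifferentiable (by simp) (e p)) (mdifferentiableAt_chart he hp)
        rw [← mfderiv_eq_fderiv, diffVal, (hFs p hp).mfderiv_eq]
        exact congrArg (fun L : E3 →L[ℝ] ℝ => L a) h2
      rw [h1, fieldVal_eq_chartCoeff he _ hp]
      exact hld _ _
    · have h1 : diffVal F p a = 0 := by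
        rw [diffVal, (hFo p hp).mfderiv_eq, mfderiv_const]; rfl
      rw [h1, zero_pow two_ne_zero]
      exact h.fieldVal_nonneg p a
  have h6 := enorm_sub_le_metricEDist hFC hFd (e.symm 0) q
  have h7 : F (e.symm 0) = 0 := by
    simp only [hF, if_pos (e.map_target (hs 0)), e.right_inv (hs 0), hl, norm_zero, hmz]
  have h8 : F q = m ε := by
    by_cases h1 : q ∈ e.source
    · simp only [hF, if_pos h1, hl, hmε _ (hq h1)]
    · exact if_neg h1
  rw [h7, h8, zero_sub, enorm_neg] at h6
  refine le_trans ?_ h6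
  rw [← ofReal_norm, Real.norm_of_nonneg (hc.le.trans hcm)]
  exact ENNReal.ofReal_le_ofReal hcm

end Distance

/-! ### Metric balls and normal coordinates of the family -/

section Balls
open CoordGeometry

variable {S : Type*} [TopologicalSpace S] [ChartedSpace (EuclideanSpace ℝ (Fin 3)) S]
  [IsManifold (𝓡 3) ∞ S] [T2Space S]
  (Ψ : S ≃ₘ⟮𝓡 3, 𝓡 3⟯ (Metric.sphere (0 : EuclideanSpace ℝ (Fin 4)) 1))
  (v : Metric.sphere (0 : E4) 1)
  {z : Fin 3 → Fin 3 → Fin 3 → Fin 3 → Fin 3 → ℝ}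
  (hz : HasRiemannDerivSymmetries z) {η ε : ℝ} (hb : FamilyBounds z η ε)

theorem stereoChart_symm_zero : (stereoChart Ψ v).symm 0 = Ψ.symm (-v) := by
  rw [← stereoChart_neg Ψ v, (stereoChart Ψ v).left_inv]
  rw [stereoChart_source]
  intro h
  have h1 : -v = v := Ψ.symm.injective h
  exact ne_neg_of_mem_unit_sphere ℝ v h1.symm

theorem mem_metricBall_of_norm_lt {r : ℝ} {p : S} (hp : p ∈ (stereoChart Ψ v).source)
    (hr : ‖stereoChart Ψ v p‖ < r) :
    p ∈ metricBall (familyMetric Ψ v hz hb) (Ψ.symm (-v)) r := by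
  have h1 := metricEDist_chart_le (h := familyMetric Ψ v hz hb) (stereoChart_mem Ψ v)
    (stereoChart_target Ψ v) (fun t x => by
      simp only [chartCoeff_familyMetric]; exact family_radial_le hz hb.pos t x)
    (stereoChart Ψ v p)
  rw [stereoChart_symm_zero, (stereoChart Ψ v).left_inv hp] at h1
  exact h1.trans_lt (ENNReal.ofReal_lt_ofReal_iff_of_nonneg (norm_nonneg _) |>.2 hr)

/-- Lengths of rays bound the distance from above and the Gauss lemma bounds it from below. The
latter holds up to radius ε only, so no such equality is claimed for 2ε. -/
theorem mem_metricBall_iff {p : S} :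
    p ∈ metricBall (familyMetric Ψ v hz hb) (Ψ.symm (-v)) ε ↔
      p ∈ (stereoChart Ψ v).source ∧ ‖stereoChart Ψ v p‖ < ε := by
  refine ⟨fun hp => ?_, fun hp => mem_metricBall_of_norm_lt Ψ v hz hb hp.1 hp.2⟩
  by_contra hcon
  have h1 := le_metricEDist_of_radial (h := familyMetric Ψ v hz hb) (stereoChart_mem Ψ v)
    (stereoChart_target Ψ v) (ε := ε) (fun x hx i => by
      rw [chartCoeff_familyMetric]; exact family_radial hz hb.pos hx i) (q := p)
    (fun hs => not_lt.1 fun h => hcon ⟨hs, h⟩)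
  rw [stereoChart_symm_zero] at h1
  exact not_lt.2 h1 hp

theorem familyMetric_isNormalChartOn :
    IsNormalChartOn (familyMetric Ψ v hz hb) (Ψ.symm (-v)) ε (stereoChart Ψ v) where
  smooth := stereoChart_mem Ψ v
  ball_subset := fun p hp => ((mem_metricBall_iff Ψ v hz hb).1 hp).1
  image_ball := by
    ext x
    rw [mem_ball_zero_iff]
    constructor
    · rintro ⟨p, hp, rfl⟩
      exact ((mem_metricBall_iff Ψ v hz hb).1 hp).2
    · intro hx
      have ht : x ∈ (stereoChart Ψ v).target := by rw [stereoChart_target]; trivial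
      exact ⟨_, (mem_metricBall_iff Ψ v hz hb).2 ⟨(stereoChart Ψ v).map_target ht, by
        rwa [(stereoChart Ψ v).right_inv ht]⟩, (stereoChart Ψ v).right_inv ht⟩
  center := stereoChart_neg Ψ v
  orthonormal := by
    rw [chartCoeff_familyMetric, family_eq_inside hb.pos (by simpa using hb.pos.le)]
    simpa using cubicTerm_smul (z := z) 0 0
  rays := isGeodesicOn_ray hz fun x hx => by
    rw [chartCoeff_familyMetric, family_eq_inside hb.pos (mem_ball_zero_iff.1 hx).le]

theorem chartCoeff_familyMetric_ball {x : E3} (hx : x ∈ Metric.ball (0 : E3) ε) (α β : Fin 3) :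
    chartCoeff (familyMetric Ψ v hz hb).inner (stereoChart Ψ v) x α β = cubicMetric z x α β := by
  rw [chartCoeff_familyMetric, family_eq_inside hb.pos (mem_ball_zero_iff.1 hx).le,
    one_add_cubicTerm]

/-- It suffices that the metric ball of radius 2ε contains the coordinate ball of that radius, off
which the cutoff vanishes. -/
theorem familyMetric_eq_limit_outside {p : S}
    (hp : p ∉ metricBall (familyMetric Ψ v hz hb) (Ψ.symm (-v)) (2 * ε)) :
    (familyMetric Ψ v hz hb).inner p = limitField Ψ v p :=
  familyMetric_eq_limit Ψ v hz hb fun hs =>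
    not_lt.1 fun h => hp (mem_metricBall_of_norm_lt Ψ v hz hb hs h)

end Balls
section Bounds

/-! ### Estimates of iterated derivatives -/

variable {E F : Type*} [NormedAddCommGroup E] [NormedSpace ℝ E] [NormedAddCommGroup F]
  [NormedSpace ℝ F]

theorem exists_bound_iteratedFDerivWithin {f : E → F} {A K : Set E} (hA : IsOpen A)
    (hf : ContDiffOn ℝ ∞ f A) (hK : IsCompact K) (hKA : K ⊆ A) (n : ℕ) :
    ∃ C, 1 ≤ C ∧ ∀ k ≤ n, ∀ x ∈ K, ‖iteratedFDerivWithin ℝ k f A x‖ ≤ C := by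
  have h : ∀ k : ℕ, ∃ C, ∀ x ∈ K, ‖iteratedFDerivWithin ℝ k f A x‖ ≤ C := fun k =>
    hK.exists_bound_of_continuousOn
      ((hf.continuousOn_iteratedFDerivWithin (m := k) (by exact_mod_cast le_top)
        hA.uniqueDiffOn).mono hKA)
  choose C hC using h
  refine ⟨1 + ∑ k ∈ Finset.range (n + 1), |C k|, ?_, fun k hk x hx => ?_⟩
  · linarith [Finset.sum_nonneg fun k (_ : k ∈ Finset.range (n + 1)) => abs_nonneg (C k)]
  · have h1 := Finset.single_le_sum (f := fun k => |C k|) (fun k _ => abs_nonneg _)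
      (Finset.mem_range.2 (Nat.lt_succ_of_le hk))
    linarith [hC k x hx, le_abs_self (C k)]

/-- A `C²` small function stays `C²` small after composition with a fixed smooth map and
multiplication by a fixed smooth function, on compact sets. -/
theorem exists_bound_mul_comp {c : E → ℝ} {φ : E → F} {A K : Set E} (hA : IsOpen A)
    (hc : ContDiffOn ℝ ∞ c A) (hφ : ContDiffOn ℝ ∞ φ A) (hK : IsCompact K) (hKA : K ⊆ A) :
    ∃ C, 0 ≤ C ∧ ∀ (g : F → ℝ) (η : ℝ), ContDiff ℝ ∞ g →
      (∀ k ≤ 2, ∀ x, ‖iteratedFDeriv ℝ k g x‖ ≤ η) → ∀ k ≤ 2, ∀ x ∈ K,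
        ‖iteratedFDerivWithin ℝ k (fun y => c y * g (φ y)) A x‖ ≤ C * η := by
  obtain ⟨B, hB1, hB⟩ := exists_bound_iteratedFDerivWithin hA hc hK hKA 2
  obtain ⟨D, hD1, hD⟩ := exists_bound_iteratedFDerivWithin hA hφ hK hKA 2
  have hn : ∀ k : ℕ, (k : ℕ∞ω) ≤ (∞ : ℕ∞ω) := fun k => by exact_mod_cast le_top
  -- For orders k ≤ 2 the Leibniz rule contributes 2ᵏ ≤ 4 and the composition estimate k! Dᵏ ≤ 2D²;
  -- the bounds are normalized to be at least 1 so that powers can be compared.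
  refine ⟨4 * B * (2 * D ^ 2), by positivity, fun g η hg hgη k hk x hx => ?_⟩
  have hη : 0 ≤ η := (norm_nonneg _).trans (hgη 0 (by norm_num) 0)
  have h1 : ∀ j ≤ 2, ‖iteratedFDerivWithin ℝ j (fun y => g (φ y)) A x‖ ≤ 2 * η * D ^ 2 := by
    intro j hj
    have h2 := norm_iteratedFDerivWithin_comp_le hg.contDiffOn hφ (hn j) uniqueDiffOn_univ
      hA.uniqueDiffOn (mapsTo_univ _ _) (hKA hx) (C := η) (D := D)
      (fun i hi => by rw [iteratedFDerivWithin_univ]; exact hgη i (hi.trans hj) _)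
      (fun i hi hij => (hD i (hij.trans hj) x hx).trans (le_self_pow₀ hD1 (by omega)))
    refine h2.trans ?_
    have h3 : ((Nat.factorial j : ℕ) : ℝ) ≤ 2 := by
      exact_mod_cast Nat.factorial_le hj
    have h4 : D ^ j ≤ D ^ 2 := pow_le_pow_right₀ hD1 hj
    gcongr
  have h5 := norm_iteratedFDerivWithin_mul_le hc (hg.comp_contDiffOn hφ) hA.uniqueDiffOn
    (hKA hx) (hn k)
  refine h5.trans ?_
  calc ∑ i ∈ Finset.range (k + 1), (k.choose i : ℝ) * ‖iteratedFDerivWithin ℝ i c A x‖ *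
        ‖iteratedFDerivWithin ℝ (k - i) (g ∘ φ) A x‖
      ≤ ∑ i ∈ Finset.range (k + 1), (k.choose i : ℝ) * (B * (2 * η * D ^ 2)) := by
        refine Finset.sum_le_sum fun i hi => ?_
        rw [mul_assoc]
        have hi' : i ≤ k := Nat.lt_succ_iff.1 (Finset.mem_range.1 hi)
        refine mul_le_mul_of_nonneg_left (mul_le_mul (hB i (hi'.trans hk) x hx)
          (h1 (k - i) (by omega)) (norm_nonneg _) (by positivity)) (by positivity)
    _ = 2 ^ k * (B * (2 * η * D ^ 2)) := by
        rw [← Finset.sum_mul]; congr 1; exact_mod_cast Nat.sum_range_choose k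
    _ ≤ 2 ^ 2 * (B * (2 * η * D ^ 2)) := by
        gcongr
        norm_num
    _ = 4 * B * (2 * D ^ 2) * η := by ring

/-- Rescaling of a family of functions with compact support. -/
theorem exists_bound_rescaled {q : ℝ × E3 → ℝ} (hq : ContDiff ℝ ∞ q)
    (h0 : ∀ (ε : ℝ) (y : E3), 2 ≤ ‖y‖ → q (ε, y) = 0) :
    ∃ C, 0 ≤ C ∧ ∀ ε, 0 < ε → ε ≤ 1 → ∀ k ≤ 2, ∀ x : E3,
      ‖iteratedFDeriv ℝ k (fun x : E3 => ε ^ 3 * q (ε, ε⁻¹ • x)) x‖ ≤ C * ε := by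
  obtain ⟨C, hC1, hC⟩ := exists_bound_iteratedFDerivWithin isOpen_univ hq.contDiffOn
    ((isCompact_Icc (a := (0 : ℝ)) (b := 1)).prod (isCompact_closedBall (0 : E3) 2))
    (subset_univ _) 2
  simp only [iteratedFDerivWithin_univ] at hC
  have hCall : ∀ k ≤ 2, ∀ ε ∈ Icc (0 : ℝ) 1, ∀ y : E3, ‖iteratedFDeriv ℝ k q (ε, y)‖ ≤ C := by
    intro k hk ε hε y
    by_cases hy : ‖y‖ ≤ 2
    · exact hC k hk (ε, y) ⟨hε, by simpa using hy⟩
    · have h1 : q =ᶠ[𝓝 (ε, y)] fun _ => 0 := by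
        have : {p : ℝ × E3 | 2 < ‖p.2‖} ∈ 𝓝 (ε, y) :=
          (isOpen_lt continuous_const (by fun_prop)).mem_nhds (not_le.1 hy)
        filter_upwards [this] with p hp using h0 p.1 p.2 (le_of_lt hp)
      have h2 := (h1.iteratedFDeriv ℝ k).self_of_nhds
      rw [h2, iteratedFDeriv_fun_zero]
      simp only [Pi.zero_apply, norm_zero]; linarith
  refine ⟨C, by linarith, fun ε hε hε1 k hk x => ?_⟩
  set L : E3 →L[ℝ] ℝ × E3 := (ContinuousLinearMap.inr ℝ ℝ E3).comp
    (ε⁻¹ • ContinuousLinearMap.id ℝ E3) with hL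
  have hLn : ‖L‖ ≤ ε⁻¹ := by
    refine ContinuousLinearMap.opNorm_le_bound _ (by positivity) fun y => ?_
    have : 0 ≤ ε⁻¹ * ‖y‖ := by positivity
    simpa [hL, Prod.norm_def, norm_smul, abs_of_pos hε] using this
  have hsh : ContDiff ℝ ∞ (fun p => q ((ε, 0) + p)) := hq.comp (contDiff_const.add contDiff_id)
  have hf : (fun x : E3 => ε ^ 3 * q (ε, ε⁻¹ • x)) =
      ε ^ 3 • ((fun p => q ((ε, 0) + p)) ∘ L) := by
    ext y
    simp [hL]
  have hkt : (k : ℕ∞ω) ≤ (∞ : ℕ∞ω) := by exact_mod_cast le_top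
  rw [hf, iteratedFDeriv_const_smul_apply ((hsh.comp L.contDiff).of_le hkt).contDiffAt,
    L.iteratedFDeriv_comp_right hsh x hkt, norm_smul]
  refine (mul_le_mul_of_nonneg_left (ContinuousMultilinearMap.norm_compContinuousLinearMap_le _ _)
    (norm_nonneg _)).trans ?_
  rw [iteratedFDeriv_comp_add_left]
  have h3 : ((ε, (0 : E3)) + L x) = (ε, ε⁻¹ • x) := by simp [hL]
  rw [h3, Finset.prod_const, Finset.card_univ, Fintype.card_fin, Real.norm_of_nonneg (by positivity)]
  have h4 := hCall k hk ε ⟨hε.le, hε1⟩ (ε⁻¹ • x)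
  -- At most two derivatives fall on x/ε, so of the factor ε³ at least one power of ε survives.
  have h5 : ‖L‖ ^ k ≤ ε⁻¹ ^ 2 := by
    refine (pow_le_pow_left₀ (norm_nonneg _) hLn k).trans ?_
    exact pow_le_pow_right₀ ((one_le_inv₀ hε).2 hε1) hk
  calc ε ^ 3 * (‖iteratedFDeriv ℝ k q (ε, ε⁻¹ • x)‖ * ‖L‖ ^ k) ≤ ε ^ 3 * (C * ε⁻¹ ^ 2) := by
        gcongr
    _ = C * ε := by field_simp

end Bounds

section Convergence
open CoordGeometry

/-! ### Convergence to the limit metric -/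

variable {M : Type*} [TopologicalSpace M] [ChartedSpace (EuclideanSpace ℝ (Fin 3)) M]
  [IsManifold (𝓡 3) ∞ M] [T2Space M] {e : OpenPartialHomeomorph M E3}

/-- Convergence in `C²` of metrics that differ from a fixed field by a family of matrices that
tends to zero in `C²`, in one chart. -/
theorem tendstoC2_of_chart (he : e ∈ IsManifold.maximalAtlas (𝓡 3) ∞ M) (ht : e.target = univ)
    {T : ℝ → BilinField M} {T₀ : BilinField M} {D : ℝ → E3 → Matrix (Fin 3) (Fin 3) ℝ}
    (hT₀ : ∀ e' ∈ IsManifold.maximalAtlas (𝓡 3) ∞ M, SmoothEntriesOn (chartCoeff T₀ e') e'.target)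
    (hD : ∀ᶠ ε in 𝓝[>] (0 : ℝ), ∀ x, chartCoeff (T ε) e x = chartCoeff T₀ e x + D ε x)
    (hDs : ∀ ε a b, ContDiff ℝ ∞ (fun x => D ε x a b))
    (hDT : ∀ᶠ ε in 𝓝[>] (0 : ℝ), ∀ p, (p ∈ e.source → 2 ≤ ‖e p‖) → T ε p = T₀ p)
    (hDb : ∃ C, 0 ≤ C ∧ ∀ ε, 0 < ε → ε ≤ 1 → ∀ a b, ∀ k ≤ 2, ∀ x,
      ‖iteratedFDeriv ℝ k (fun x => D ε x a b) x‖ ≤ C * ε) :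
    TendstoC2 T (𝓝[>] 0) T₀ := by
  intro e' he' K hK hKe i j k hk
  obtain ⟨C, hC0, hC⟩ := hDb
  set A := e'.target ∩ e'.symm ⁻¹' e.source with hAdef
  have hA : IsOpen A := isOpen_transition_source
  set φ : E3 → E3 := fun y => e (e'.symm y) with hφdef
  have hφ : ContDiffOn ℝ ∞ φ A := contDiffOn_transition he he'
  have hs : ∀ y : E3, y ∈ e.target := fun y => by rw [ht]; trivial
  have hCl : IsClosed (e.symm '' Metric.closedBall 0 2) :=
    ((isCompact_closedBall (0 : E3) 2).image_of_continuousOn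
      (e.continuousOn_symm.mono fun y _ => hs y)).isClosed
  -- The part of `K` where the metrics may differ from the limit. It is compact and lies inside the
  -- domain of the transition map, whose derivatives are therefore bounded on it.
  set K₁ := K ∩ e'.symm ⁻¹' (e.symm '' Metric.closedBall 0 2) with hK₁def
  have hK₁ : IsCompact K₁ := by
    obtain ⟨u, hu, huK⟩ := continuousOn_iff_isClosed.1 (e'.continuousOn_symm.mono hKe) _ hCl
    have h1 : K₁ = K ∩ u := by rw [hK₁def, inter_comm, huK, inter_comm]
    rw [h1]
    exact hK.inter_right hu
  have hK₁A : K₁ ⊆ A := by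
    rintro y ⟨hyK, x, -, hx⟩
    exact ⟨hKe hyK, by rw [mem_preimage, ← hx]; exact e.map_target (hs x)⟩
  have hJ : ∀ a b, ContDiffOn ℝ ∞ (fun y => jac φ y a b) A := fun a b =>
    contDiffOn_pderiv hA ((EuclideanSpace.proj a : E3 →L[ℝ] ℝ).contDiff.comp_contDiffOn hφ) b
  have hc : ∀ a b, ContDiffOn ℝ ∞ (fun y => jac φ y a i * jac φ y b j) A := fun a b =>
    (hJ a i).mul (hJ b j)
  have hB := fun a b => exists_bound_mul_comp hA (hc a b) hφ hK₁ hK₁A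
  choose B hB0 hB using hB
  set Btot := ∑ a, ∑ b, B a b with hBtot
  have hBtot0 : 0 ≤ Btot := Finset.sum_nonneg fun a _ => Finset.sum_nonneg fun b _ => hB0 a b
  have hkt : (k : ℕ∞ω) ≤ (∞ : ℕ∞ω) := by exact_mod_cast le_top
  have main : ∀ᶠ ε in 𝓝[>] (0 : ℝ), ∀ y ∈ K,
      ‖iteratedFDeriv ℝ k (fun y => chartCoeff (T ε) e' y i j) y -
        iteratedFDeriv ℝ k (fun y => chartCoeff T₀ e' y i j) y‖ ≤ Btot * (C * ε) := by
    filter_upwards [hD, hDT, Ioc_mem_nhdsGT one_pos] with ε hDε hTε hε y hy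
    have hCε : 0 ≤ C * ε := mul_nonneg hC0 hε.1.le
    by_cases hyK : y ∈ K₁
    · have hyA := hK₁A hyK
      set d : E3 → ℝ := fun y => ∑ p : Fin 3 × Fin 3,
        jac φ y p.1 i * jac φ y p.2 j * D ε (φ y) p.1 p.2 with hd
      have hdiff : (fun y => chartCoeff (T ε) e' y i j) =ᶠ[𝓝 y]
          (fun y => chartCoeff T₀ e' y i j) + d := by
        filter_upwards [hA.mem_nhds hyA] with x hx
        rw [Pi.add_apply, chartCoeff_change he he' _ hx.1 hx.2,
          chartCoeff_change he he' T₀ hx.1 hx.2, hDε]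
        simp only [hd, Matrix.mul_add, Matrix.add_mul, Matrix.add_apply]
        congr 1
        simp only [Matrix.mul_apply, Matrix.transpose_apply, Fintype.sum_prod_type,
          Finset.sum_mul]
        rw [Finset.sum_comm]
        refine Finset.sum_congr rfl fun a _ => Finset.sum_congr rfl fun b _ => ?_
        ring
      have hds : ∀ p : Fin 3 × Fin 3, ContDiffOn ℝ ∞
          (fun y => jac φ y p.1 i * jac φ y p.2 j * D ε (φ y) p.1 p.2) A := fun p =>
        (hc p.1 p.2).mul ((hDs ε p.1 p.2).comp_contDiffOn hφ)
      have hdA : ContDiffAt ℝ k d y :=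
        (((ContDiffOn.sum fun p _ => hds p).contDiffAt (hA.mem_nhds hyA)).of_le hkt)
      have h0A : ContDiffAt ℝ k (fun y => chartCoeff T₀ e' y i j) y :=
        ((hT₀ e' he' i j).contDiffAt (e'.open_target.mem_nhds (hKe hy))).of_le hkt
      rw [(hdiff.iteratedFDeriv ℝ k).self_of_nhds, iteratedFDeriv_add_apply h0A hdA,
        add_sub_cancel_left, ← iteratedFDerivWithin_of_isOpen k hA hyA, hd,
        iteratedFDerivWithin_fun_sum_apply hA.uniqueDiffOn hyA
          (fun p _ => ((hds p) y hyA).of_le hkt)]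
      refine (norm_sum_le _ _).trans ?_
      rw [hBtot, ← Fintype.sum_prod_type', Finset.sum_mul]
      refine Finset.sum_le_sum fun p _ => ?_
      exact hB p.1 p.2 (fun x => D ε x p.1 p.2) (C * ε) (hDs ε p.1 p.2)
        (hC ε hε.1 hε.2 p.1 p.2) k hk y hyK
    -- Off `K₁` the metrics agree with the limit on a neighbourhood, so all derivatives coincide.
    · have hO : IsOpen (e'.target ∩ e'.symm ⁻¹' (e.symm '' Metric.closedBall 0 2)ᶜ) :=
        e'.symm.isOpen_inter_preimage hCl.isOpen_compl
      have hyO : y ∈ e'.target ∩ e'.symm ⁻¹' (e.symm '' Metric.closedBall 0 2)ᶜ :=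
        ⟨hKe hy, fun h => hyK ⟨hy, h⟩⟩
      have heq : (fun y => chartCoeff (T ε) e' y i j) =ᶠ[𝓝 y]
          (fun y => chartCoeff T₀ e' y i j) := by
        filter_upwards [hO.mem_nhds hyO] with x hx
        have h1 := hTε (e'.symm x) fun hxs => by
          by_contra hlt
          exact hx.2 ⟨_, by simpa using (not_le.1 hlt).le, e.left_inv hxs⟩
        simp only [chartCoeff_eq, fieldVal, h1]
      rw [(heq.iteratedFDeriv ℝ k).self_of_nhds, sub_self, norm_zero]
      positivity
  rw [Metric.tendstoUniformlyOn_iff]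
  intro η hη
  have hsmall : ∀ᶠ ε in 𝓝[>] (0 : ℝ), Btot * (C * ε) < η := by
    have : Tendsto (fun ε : ℝ => Btot * (C * ε)) (𝓝[>] 0) (𝓝 0) := by
      have h : Continuous fun ε : ℝ => Btot * (C * ε) := by fun_prop
      simpa using (h.tendsto 0).mono_left (nhdsWithin_le_nhds (s := Ioi 0))
    exact this.eventually_lt_const hη
  filter_upwards [main, hsmall] with ε h1 h2 y hy
  rw [dist_comm, dist_eq_norm]
  exact (h1 y hy).trans_lt h2

end Convergence

/-! ### Convergence of the family in C² -/

section FamilyConvergence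
open CoordGeometry

variable {S : Type*} [TopologicalSpace S] [ChartedSpace (EuclideanSpace ℝ (Fin 3)) S]
  [IsManifold (𝓡 3) ∞ S] [T2Space S]
  (Ψ : S ≃ₘ⟮𝓡 3, 𝓡 3⟯ (Metric.sphere (0 : EuclideanSpace ℝ (Fin 4)) 1))
  (v : Metric.sphere (0 : E4) 1)
  {z : Fin 3 → Fin 3 → Fin 3 → Fin 3 → Fin 3 → ℝ}

/-- The limit of the family, as a smooth metric. -/
def limitMetric : SmoothMetric S where
  inner := limitField Ψ v
  symm := fun p a b => fieldVal_conformal_comm Ψ _ p a b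
  pos := fun p a ha => conformal_round_pos Ψ (heightFactor_pos Ψ v) p a ha
  isVonNBounded := fun p => isVonNBounded_of_pos (b := limitField Ψ v p)
    (conformal_round_pos Ψ (heightFactor_pos Ψ v) p)
  contMDiff := contMDiff_conformal_round Ψ (contMDiff_heightFactor Ψ v)

theorem tendstoC2_family {η : ℝ} (hz : HasRiemannDerivSymmetries z) {h : ℝ → SmoothMetric S}
    (hh : ∀ᶠ ε in 𝓝[>] (0 : ℝ), ∃ hb : FamilyBounds z η ε, h ε = familyMetric Ψ v hz hb) :
    TendstoC2 (fun ε => (h ε).inner) (𝓝[>] 0) (limitField Ψ v) := by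
  refine tendstoC2_of_chart (stereoChart_mem Ψ v) (stereoChart_target Ψ v)
    (D := fun ε x => ε ^ 3 • deviation z ε (ε⁻¹ • x))
    (fun e' he' => (limitMetric Ψ v).smoothEntriesOn he') ?_ ?_ ?_ ?_
  · filter_upwards [hh] with ε ⟨hb, hε⟩ x
    rw [hε, chartCoeff_familyMetric, limitField, chartCoeff_limit, family_sub hb.pos.ne']
  · intro ε a b
    simp only [Matrix.smul_apply, smul_eq_mul]
    have h1 : ContDiff ℝ ∞ (fun x : E3 => (ε, ε⁻¹ • x)) :=
      contDiff_const.prodMk (contDiff_const_smul ε⁻¹)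
    have h2 : ContDiff ℝ ∞ (fun q : ℝ × E3 => deviation z q.1 q.2 a b) :=
      contDiffOn_univ.1 (smoothEntriesOn_deviation a b)
    exact contDiff_const.mul (ContDiff.comp (f := fun x : E3 => (ε, ε⁻¹ • x))
      (g := fun q : ℝ × E3 => deviation z q.1 q.2 a b) h2 h1)
  · filter_upwards [hh, Ioc_mem_nhdsGT one_pos] with ε ⟨hb, hε⟩ hε1 p hp
    rw [hε]
    exact familyMetric_eq_limit Ψ v hz hb fun hs => by linarith [hp hs, hε1.2]
  · have h1 := fun a b => exists_bound_rescaled (q := fun q => deviation z q.1 q.2 a b)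
      (contDiffOn_univ.1 (smoothEntriesOn_deviation a b)) (fun ε y hy => by
        simp [deviation, cutoff_eq_zero hy])
    choose C hC0 hC using h1
    refine ⟨∑ a, ∑ b, C a b, Finset.sum_nonneg fun a _ => Finset.sum_nonneg fun b _ => hC0 a b,
      fun ε hε hε1 a b k hk x => ?_⟩
    have h2 : C a b ≤ ∑ a, ∑ b, C a b :=
      (Finset.single_le_sum (f := fun b => C a b) (fun b _ => hC0 a b) (Finset.mem_univ b)).trans
        (Finset.single_le_sum (f := fun a => ∑ b, C a b)
          (fun a _ => Finset.sum_nonneg fun b _ => hC0 a b) (Finset.mem_univ a))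
    exact (hC a b ε hε hε1 k hk x).trans (mul_le_mul_of_nonneg_right h2 hε.le)

end FamilyConvergence
section Sobolev
open CoordGeometry

/-! ### A weighted Sobolev inequality -/

/-- The squared Euclidean norm of the gradient. -/
def gradSq (w : E3 → ℝ) (x : E3) : ℝ := ∑ i, pderiv i w x ^ 2

/-- The Euclidean Laplacian. -/
def euclLaplacian (w : E3 → ℝ) (x : E3) : ℝ := ∑ i, pderiv i (pderiv i w) x

theorem gradSq_nonneg (w : E3 → ℝ) (x : E3) : 0 ≤ gradSq w x :=
  Finset.sum_nonneg fun _ _ => sq_nonneg _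

theorem contDiff_pderiv {w : E3 → ℝ} {n m : ℕ∞ω} (hw : ContDiff ℝ n w) (hmn : m + 1 ≤ n)
    (i : Fin 3) : ContDiff ℝ m (pderiv i w) :=
  (hw.fderiv_right hmn).clm_apply contDiff_const

theorem norm_fderiv_sq_le (w : E3 → ℝ) (x : E3) : ‖fderiv ℝ w x‖ ^ 2 ≤ gradSq w x := by
  rw [← Real.le_sqrt (norm_nonneg _) (gradSq_nonneg w x)]
  refine ContinuousLinearMap.opNorm_le_bound _ (Real.sqrt_nonneg _) fun a => ?_
  rw [Real.norm_eq_abs]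
  refine abs_le_of_sq_le_sq ?_ (by positivity)
  rw [mul_pow, Real.sq_sqrt (gradSq_nonneg w x), fderiv_apply_eq_sum_pderiv]
  have h := Finset.sum_mul_sq_le_sq_mul_sq Finset.univ (fun i => pderiv i w x) (fun i => a i)
  rw [EuclideanSpace.norm_sq_eq]
  simp only [gradSq, Real.norm_eq_abs, sq_abs]
  refine le_trans (le_of_eq ?_) h
  congr 1
  exact Finset.sum_congr rfl fun _ _ => by ring

theorem integrable_of_tsupport {τ F : E3 → ℝ} (hcs : HasCompactSupport τ) (hF : Continuous F)
    (h : ∀ x ∉ tsupport τ, F x = 0) : Integrable F :=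
  hF.integrable_of_hasCompactSupport (HasCompactSupport.intro hcs h)

theorem pderiv_eq_zero_of_notMem_tsupport {τ : E3 → ℝ} {x : E3} (hx : x ∉ tsupport τ)
    (i : Fin 3) : pderiv i τ x = 0 := by
  rw [pderiv, image_eq_zero_of_notMem_tsupport (fun h => hx (tsupport_fderiv_subset ℝ h)),
    zero_apply]

theorem continuous_gradSq {w : E3 → ℝ} (hw : ContDiff ℝ 1 w) : Continuous (gradSq w) :=
  continuous_finsetSum _ fun i _ => ((contDiff_pderiv hw (m := 0) (by simp) i).continuous).pow 2

theorem integral_norm_fderiv_sq_le {w : E3 → ℝ} (hw : ContDiff ℝ 1 w) (hcs : HasCompactSupport w) :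
    ∫ x, ‖fderiv ℝ w x‖ ^ 2 ≤ ∫ x, gradSq w x := by
  have hdc : Continuous (fderiv ℝ w) := hw.continuous_fderiv (by simp)
  refine integral_mono ?_ ?_ fun x => norm_fderiv_sq_le w x
  · refine integrable_of_tsupport hcs (hdc.norm.pow 2) fun x hx => ?_
    rw [image_eq_zero_of_notMem_tsupport (fun h => hx (tsupport_fderiv_subset ℝ h)), norm_zero]
    norm_num
  · refine integrable_of_tsupport hcs (continuous_gradSq hw) fun x hx => ?_
    simp [gradSq, pderiv_eq_zero_of_notMem_tsupport hx]

/-- The Gagliardo–Nirenberg–Sobolev inequality, for the exponent six in dimension three. -/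
theorem exists_sobolev : ∃ C, 0 < C ∧ ∀ w : E3 → ℝ, ContDiff ℝ 1 w → HasCompactSupport w →
    (∫ x, w x ^ 6) ^ (1 / 3 : ℝ) ≤ C * ∫ x, gradSq w x := by
  set K := eLpNormLESNormFDerivOfEqInnerConst (volume : Measure E3) 2 with hK
  -- The summand 1 only makes the constant strictly positive.
  refine ⟨(K : ℝ) ^ 2 + 1, by positivity, fun w hw hcs => ?_⟩
  have h := eLpNorm_le_eLpNorm_fderiv_of_eq_inner (volume : Measure E3) hw hcs (p := 2) (p' := 6)
    (by norm_num) (by simp) (by simp; norm_num)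
  have hdc : Continuous (fderiv ℝ w) := hw.continuous_fderiv (by simp)
  have hdcs : HasCompactSupport (fderiv ℝ w) := hcs.fderiv (𝕜 := ℝ)
  have m6 : MemLp w (6 : NNReal) volume := hw.continuous.memLp_of_hasCompactSupport hcs
  have m2 : MemLp (fderiv ℝ w) (2 : NNReal) volume := hdc.memLp_of_hasCompactSupport hdcs
  rw [m6.eLpNorm_eq_integral_rpow_norm (by simp) (by simp),
    m2.eLpNorm_eq_integral_rpow_norm (by simp) (by simp)] at h
  simp only [ENNReal.coe_toReal] at h
  have e6 : ∀ x, ‖w x‖ ^ (((6 : NNReal) : ℝ)) = w x ^ 6 := fun x => by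
    rw [show ((6 : NNReal) : ℝ) = ((6 : ℕ) : ℝ) by norm_num, Real.rpow_natCast, Real.norm_eq_abs]
    exact (by decide : Even 6).pow_abs _
  have e2 : ∀ x, ‖fderiv ℝ w x‖ ^ (((2 : NNReal) : ℝ)) = ‖fderiv ℝ w x‖ ^ 2 := fun x => by
    rw [show ((2 : NNReal) : ℝ) = ((2 : ℕ) : ℝ) by norm_num, Real.rpow_natCast]
  simp only [e6, e2] at h
  set I6 := ∫ x, w x ^ 6 with hI6
  set I2 := ∫ x, ‖fderiv ℝ w x‖ ^ 2 with hI2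
  have hI6n : 0 ≤ I6 := integral_nonneg fun x => (by decide : Even 6).pow_nonneg _
  have hI2n : 0 ≤ I2 := integral_nonneg fun x => sq_nonneg _
  have hKe : (eLpNormLESNormFDerivOfEqInnerConst (volume : Measure E3) ((2 : NNReal) : ℝ) : ℝ≥0∞) =
      ENNReal.ofReal (K : ℝ) := by rw [ENNReal.ofReal_coe_nnreal, hK]; rfl
  rw [hKe, ← ENNReal.ofReal_mul (NNReal.coe_nonneg K), ENNReal.ofReal_le_ofReal_iff (by positivity)] at h
  have h1 : (I6 ^ (((6 : NNReal) : ℝ))⁻¹) ^ 2 ≤ (K * I2 ^ (((2 : NNReal) : ℝ))⁻¹) ^ 2 :=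
    pow_le_pow_left₀ (by positivity) h 2
  have h2 : (I6 ^ (((6 : NNReal) : ℝ))⁻¹) ^ 2 = I6 ^ (1 / 3 : ℝ) := by
    rw [← Real.rpow_natCast, ← Real.rpow_mul hI6n]; norm_num
  have h3 : (I2 ^ (((2 : NNReal) : ℝ))⁻¹) ^ 2 = I2 := by
    rw [← Real.rpow_natCast, ← Real.rpow_mul hI2n]; norm_num
  rw [mul_pow, h2, h3] at h1
  have h4 : I2 ≤ ∫ x, gradSq w x := integral_norm_fderiv_sq_le hw hcs
  have h5 : 0 ≤ ∫ x, gradSq w x := integral_nonneg fun x => gradSq_nonneg w x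
  calc I6 ^ (1 / 3 : ℝ) ≤ (K : ℝ) ^ 2 * I2 := h1
    _ ≤ (K : ℝ) ^ 2 * ∫ x, gradSq w x := by gcongr
    _ ≤ ((K : ℝ) ^ 2 + 1) * ∫ x, gradSq w x := by nlinarith

/-- The ground state substitution. -/
theorem integral_gradSq_mul {τ v : E3 → ℝ} (hτ : ContDiff ℝ 2 τ) (hcs : HasCompactSupport τ)
    (hv : ContDiff ℝ 2 v) : ∫ x, gradSq (fun y => τ y * v y) x =
      ∫ x, (τ x ^ 2 * gradSq v x + v x ^ 2 * (-(τ x * euclLaplacian τ x))) := by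
  have hτd : Differentiable ℝ τ := hτ.differentiable (by simp)
  have hvd : Differentiable ℝ v := hv.differentiable (by simp)
  have hτ1 : ∀ i, ContDiff ℝ 1 (pderiv i τ) := fun i => contDiff_pderiv hτ (by norm_num) i
  have hv1 : ∀ i, ContDiff ℝ 1 (pderiv i v) := fun i => contDiff_pderiv hv (by norm_num) i
  have hτ2 : ∀ i, Continuous (pderiv i (pderiv i τ)) := fun i =>
    (contDiff_pderiv (hτ1 i) (m := 0) (by simp) i).continuous
  have z0 : ∀ {x}, x ∉ tsupport τ → τ x = 0 := fun hx => image_eq_zero_of_notMem_tsupport hx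
  have z1 : ∀ {x}, x ∉ tsupport τ → ∀ i, pderiv i τ x = 0 := fun hx i =>
    pderiv_eq_zero_of_notMem_tsupport hx i
  have c0 := hτ.continuous
  have cv := hv.continuous
  have c1 : ∀ i, Continuous (pderiv i τ) := fun i => (hτ1 i).continuous
  have cv1 : ∀ i, Continuous (pderiv i v) := fun i => (hv1 i).continuous
  have i2 : ∀ i, Integrable (fun x =>
      (2 * v x * τ x * pderiv i v x + v x ^ 2 * pderiv i τ x) * pderiv i τ x) := fun i =>
    integrable_of_tsupport hcs (by fun_prop) fun x hx => by rw [z1 hx]; ring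
  have i3 : ∀ i, Integrable (fun x => (v x ^ 2 * τ x) * pderiv i (pderiv i τ) x) := fun i =>
    integrable_of_tsupport hcs (by fun_prop) fun x hx => by rw [z0 hx]; ring
  -- The difference |∇(τv)|² - τ²|∇v|² equals ∇(v²τ)·∇τ, so one integration by parts turns it into
  -- -v²τΔτ. The compact support of τ alone justifies this; v is not restricted.
  have ibp : ∀ i, ∫ x, (v x ^ 2 * τ x) * pderiv i (pderiv i τ) x =
      -∫ x, (2 * v x * τ x * pderiv i v x + v x ^ 2 * pderiv i τ x) * pderiv i τ x := by
    intro i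
    have hd : ∀ x, pderiv i (fun y => v y ^ 2 * τ y) x =
        2 * v x * τ x * pderiv i v x + v x ^ 2 * pderiv i τ x := by
      intro x
      have h1 := pderiv_mul ((hvd x).fun_pow 2) (hτd x) i
      have h2 := pderiv_mul (hvd x) (hvd x) i
      simp only [← pow_two] at h2
      rw [h1, h2]; ring
    have h := integral_mul_fderiv_eq_neg_fderiv_mul_of_integrable (μ := (volume : Measure E3))
      (f := fun y => v y ^ 2 * τ y) (g := pderiv i τ) (v := EuclideanSpace.single i 1) ?_ ?_ ?_
      (fun x _ => ((hvd x).fun_pow 2).fun_mul (hτd x))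
      (fun x _ => (hτ1 i).differentiable (by simp) x)
    · refine h.trans ?_
      congr 1
      exact integral_congr_ae (Eventually.of_forall fun x => congrArg (· * pderiv i τ x) (hd x))
    · change Integrable (fun x => pderiv i (fun y => v y ^ 2 * τ y) x * pderiv i τ x) volume
      simp only [hd]
      exact i2 i
    · exact i3 i
    · exact integrable_of_tsupport hcs (by fun_prop) fun x hx => by rw [z0 hx]; ring
  have hg : ∀ x, gradSq (fun y => τ y * v y) x = τ x * τ x * gradSq v x +
      ∑ i, (2 * v x * τ x * pderiv i v x + v x ^ 2 * pderiv i τ x) * pderiv i τ x := by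
    intro x
    simp only [gradSq, Finset.mul_sum, ← Finset.sum_add_distrib]
    refine Finset.sum_congr rfl fun i _ => ?_
    rw [pderiv_mul (hτd x) (hvd x)]; ring
  have hr : ∀ x, τ x ^ 2 * gradSq v x + v x ^ 2 * (-(τ x * euclLaplacian τ x)) =
      τ x * τ x * gradSq v x - ∑ i, (v x ^ 2 * τ x) * pderiv i (pderiv i τ) x := by
    intro x
    rw [euclLaplacian, ← Finset.mul_sum]; ring
  have i1 : Integrable (fun x => τ x * τ x * gradSq v x) :=
    integrable_of_tsupport hcs ((c0.mul c0).mul (continuous_gradSq (hv.of_le (by norm_num))))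
      fun x hx => by rw [z0 hx]; ring
  simp only [hg, hr]
  rw [integral_add i1 (integrable_finsetSum _ fun i _ => i2 i),
    integral_sub i1 (integrable_finsetSum _ fun i _ => i3 i),
    integral_finsetSum _ fun i _ => i2 i, integral_finsetSum _ fun i _ => i3 i]
  simp only [ibp, Finset.sum_neg_distrib, sub_neg_eq_add]

end Sobolev
section Truncation
open CoordGeometry

/-! ### Truncation of the conformal factor -/

theorem hasDerivAt_max_pow (n : ℕ) (s : ℝ) :
    HasDerivAt (fun s : ℝ => max s 0 ^ (n + 2)) ((n + 2) * max s 0 ^ (n + 1)) s := by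
  have hp : ∀ t : ℝ, HasDerivAt (fun s : ℝ => s ^ (n + 2)) ((n + 2) * t ^ (n + 1)) t := fun t => by
    have := hasDerivAt_pow (n + 2) t
    push_cast at this
    exact this
  rcases lt_trichotomy s 0 with hs | rfl | hs
  · rw [max_eq_right hs.le]
    have : (fun s : ℝ => max s 0 ^ (n + 2)) =ᶠ[𝓝 s] fun _ => 0 := by
      filter_upwards [Iio_mem_nhds hs] with t ht
      rw [max_eq_right (le_of_lt ht), zero_pow (by omega)]
    simpa using (hasDerivAt_const s (0 : ℝ)).congr_of_eventuallyEq this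
  · rw [← hasDerivWithinAt_univ, ← Iic_union_Ici (a := (0 : ℝ))]
    refine HasDerivWithinAt.union ?_ ?_
    · have h := hasDerivWithinAt_const (0 : ℝ) (Iic 0) (0 : ℝ)
      simp only [max_self, zero_pow (Nat.succ_ne_zero n), mul_zero]
      exact h.congr (fun t ht => by rw [max_eq_right ht, zero_pow (by omega)]) (by simp)
    · rw [max_self]
      exact (hp 0).hasDerivWithinAt.congr (fun t ht => by rw [max_eq_left ht]) (by simp)
  · rw [max_eq_left hs.le]
    refine (hp s).congr_of_eventuallyEq ?_
    filter_upwards [Ioi_mem_nhds hs] with t ht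
    rw [max_eq_left (le_of_lt ht)]

/-- The ground state substitution needs two continuous derivatives of the truncated weight, and the
cube of the positive part has them. -/
theorem contDiff_max_cube : ContDiff ℝ 2 (fun s : ℝ => max s 0 ^ 3) := by
  have h3 : ∀ s, HasDerivAt (fun s : ℝ => max s 0 ^ 3) (3 * max s 0 ^ 2) s := fun s => by
    have := hasDerivAt_max_pow 1 s
    norm_num at this
    exact this
  have h2 : ∀ s, HasDerivAt (fun s : ℝ => 3 * max s 0 ^ 2) (3 * (2 * max s 0)) s := fun s => by
    have := (hasDerivAt_max_pow 0 s).const_mul 3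
    norm_num at this
    convert! this using 1
  rw [show (2 : ℕ∞ω) = 1 + 1 by norm_num, contDiff_succ_iff_deriv]
  refine ⟨fun s => (h3 s).differentiableAt, fun h => by simp at h, ?_⟩
  rw [show deriv (fun s : ℝ => max s 0 ^ 3) = fun s => 3 * max s 0 ^ 2 from
    funext fun s => (h3 s).deriv, contDiff_one_iff_deriv]
  refine ⟨fun s => (h2 s).differentiableAt, ?_⟩
  rw [show deriv (fun s : ℝ => 3 * max s 0 ^ 2) = fun s => 3 * (2 * max s 0) from
    funext fun s => (h2 s).deriv]
  fun_prop

/-- A convex function that vanishes on `(0, δ]` and is close to the identity for small `δ`. -/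
def convexTrunc (δ t : ℝ) : ℝ := max (t - δ) 0 ^ 3 / t ^ 2

/-- The derivative of `convexTrunc`. -/
def convexTruncDeriv (δ t : ℝ) : ℝ := 3 * max (t - δ) 0 ^ 2 / t ^ 2 - 2 * max (t - δ) 0 ^ 3 / t ^ 3

/-- The second derivative of `convexTrunc`. -/
def convexTruncDeriv₂ (δ t : ℝ) : ℝ :=
  6 * max (t - δ) 0 / t ^ 2 - 12 * max (t - δ) 0 ^ 2 / t ^ 3 + 6 * max (t - δ) 0 ^ 3 / t ^ 4

theorem hasDerivAt_convexTrunc (δ : ℝ) {t : ℝ} (ht : 0 < t) :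
    HasDerivAt (convexTrunc δ) (convexTruncDeriv δ t) t ∧
    HasDerivAt (convexTruncDeriv δ) (convexTruncDeriv₂ δ t) t := by
  have hs : HasDerivAt (fun t => t - δ) 1 t := (hasDerivAt_id t).sub_const δ
  have h3 : HasDerivAt (fun t => max (t - δ) 0 ^ 3) (3 * max (t - δ) 0 ^ 2) t := by
    have := (hasDerivAt_max_pow 1 (t - δ)).comp t hs
    norm_num at this
    exact this
  have h2 : HasDerivAt (fun t => max (t - δ) 0 ^ 2) (2 * max (t - δ) 0) t := by
    have := (hasDerivAt_max_pow 0 (t - δ)).comp t hs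
    norm_num at this
    exact this
  have p2 : HasDerivAt (fun t : ℝ => t ^ 2) (2 * t) t := by simpa using hasDerivAt_pow 2 t
  have p3 : HasDerivAt (fun t : ℝ => t ^ 3) (3 * t ^ 2) t := by simpa using hasDerivAt_pow 3 t
  constructor
  · convert! h3.fun_div p2 (by positivity) using 1
    rw [convexTruncDeriv]
    field_simp
  · convert! ((h2.const_mul 3).fun_div p2 (by positivity)).fun_sub
      ((h3.const_mul 2).fun_div p3 (by positivity)) using 1
    rw [convexTruncDeriv₂]
    field_simp
    ring

/-- With m = max(t - δ, 0), which lies in [0, t], the derivatives are m²(3t - 2m)/t³ and 6m(t -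
m)²/t⁴. The bound by 1 amounts to t³ - 3tm² + 2m³ = (t - m)²(t + 2m) ≥ 0. -/
theorem convexTrunc_bounds {δ t : ℝ} (hδ : 0 < δ) (ht : 0 < t) :
    0 ≤ convexTrunc δ t ∧ convexTrunc δ t ≤ t ∧ 0 ≤ convexTruncDeriv δ t ∧
      convexTruncDeriv δ t ≤ 1 ∧ 0 ≤ convexTruncDeriv₂ δ t := by
  set m := max (t - δ) 0 with hm
  have hm0 : 0 ≤ m := le_max_right _ _
  have hmt : m ≤ t := max_le (by linarith) ht.le
  have e1 : convexTruncDeriv δ t = m ^ 2 * (3 * t - 2 * m) / t ^ 3 := by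
    rw [convexTruncDeriv, ← hm]; field_simp
  have e2 : convexTruncDeriv₂ δ t = 6 * m * (t - m) ^ 2 / t ^ 4 := by
    rw [convexTruncDeriv₂, ← hm]; field_simp; ring
  refine ⟨by rw [convexTrunc]; positivity, ?_, ?_, ?_, ?_⟩
  · rw [convexTrunc, div_le_iff₀ (by positivity), ← hm]
    calc m ^ 3 ≤ t ^ 3 := pow_le_pow_left₀ hm0 hmt 3
      _ = t * t ^ 2 := by ring
  · rw [e1]
    have : 0 ≤ 3 * t - 2 * m := by linarith
    positivity
  · rw [e1, div_le_one (by positivity)]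
    nlinarith [mul_nonneg (sq_nonneg (t - m)) (by linarith : 0 ≤ t + 2 * m)]
  · rw [e2]; positivity

theorem pderiv_comp_real {g : ℝ → ℝ} {g' : ℝ} {w : E3 → ℝ} {x : E3}
    (hg : HasDerivAt g g' (w x)) (hw : DifferentiableAt ℝ w x) (i : Fin 3) :
    pderiv i (fun y => g (w y)) x = g' * pderiv i w x := by
  have h := hg.comp_hasFDerivAt x hw.hasFDerivAt
  have h2 : HasFDerivAt (fun y => g (w y)) _ x := h
  rw [pderiv, h2.fderiv]; rfl

/-- The square root of the conformal factor. -/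
def rho (x : E3) : ℝ := √(ffun x)

theorem rho_pos (x : E3) : 0 < rho x := Real.sqrt_pos.2 (ffun_pos x)

theorem rho_sq (x : E3) : rho x ^ 2 = ffun x := Real.sq_sqrt (ffun_pos x).le

theorem contDiff_rho : ContDiff ℝ ∞ rho := contDiff_ffun.sqrt fun x => (ffun_pos x).ne'

theorem pderiv_rho (i : Fin 3) (x : E3) : pderiv i rho x = rho x * drift i x / 2 := by
  have h := pderiv_comp_real (w := ffun) (Real.hasDerivAt_sqrt (ffun_pos x).ne')
    (contDiff_ffun.differentiable (by simp) x) i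
  change pderiv i rho x = _ at h
  rw [h, pderiv_ffun]
  change 1 / (2 * rho x) * _ = _
  rw [← rho_sq]
  have := (rho_pos x).ne'
  field_simp

/-- The truncations of the square root of the conformal factor. -/
def truncRho (δ : ℝ) (x : E3) : ℝ := convexTrunc δ (rho x)

variable {δ : ℝ}

theorem contDiff_truncRho (δ : ℝ) : ContDiff ℝ 2 (truncRho δ) := by
  unfold truncRho convexTrunc
  have h : ContDiff ℝ 2 rho := contDiff_infty.1 contDiff_rho 2
  refine ContDiff.div ?_ (h.pow 2) fun x => (pow_pos (rho_pos x) 2).ne'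
  exact contDiff_max_cube.comp (h.sub contDiff_const)

/-- Decay towards the pole: it gives the truncations compact support and the limit metric finite
volume. -/
theorem ffun_mul_le (x : E3) : ffun x * ‖x‖ ^ 2 ≤ 8 := by
  rw [ffun, div_mul_eq_mul_div, div_le_iff₀ (by positivity)]
  nlinarith [sq_nonneg (‖x‖ ^ 2), sq_nonneg ‖x‖]

theorem hasCompactSupport_truncRho (hδ : 0 < δ) : HasCompactSupport (truncRho δ) := by
  refine HasCompactSupport.intro (isCompact_closedBall (0 : E3) (√8 / δ)) fun x hx => ?_
  rw [Metric.mem_closedBall, dist_zero_right, not_le, div_lt_iff₀ hδ] at hx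
  have h1 : rho x ≤ δ := by
    by_contra hlt
    rw [not_le] at hlt
    have h2 := ffun_mul_le x
    rw [← rho_sq, ← mul_pow] at h2
    have h3 : rho x * ‖x‖ ≤ √8 := Real.le_sqrt_of_sq_le h2
    have h4 : ‖x‖ * δ ≤ rho x * ‖x‖ := by
      rw [mul_comm]; exact mul_le_mul_of_nonneg_right hlt.le (norm_nonneg _)
    linarith
  rw [truncRho, convexTrunc, max_eq_right (by linarith)]
  simp

/-- For τ = g(ρ) one has Δτ = g''(ρ)|∇ρ|² + g'(ρ)Δρ. Convexity of g gives the first term the good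
sign; for the second, -Δρ = ρ · `potential`/8 is nonnegative and g g' ≤ ρ. -/
theorem neg_truncRho_mul_laplacian_le (hδ : 0 < δ) (x : E3) :
    -(truncRho δ x * euclLaplacian (truncRho δ) x) ≤ ffun x * potential x / 8 := by
  have hρd : Differentiable ℝ rho := contDiff_rho.differentiable (by simp)
  have hdd : ∀ i, Differentiable ℝ (drift i) := fun i => (contDiff_drift i).differentiable (by simp)
  have h1 : ∀ i, pderiv i (truncRho δ) =
      fun y => convexTruncDeriv δ (rho y) * (1 / 2 * (rho y * drift i y)) := fun i => by
    ext y
    have := pderiv_comp_real (hasDerivAt_convexTrunc δ (rho_pos y)).1 (hρd y) i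
    rw [pderiv_rho] at this
    change pderiv i (fun y => convexTrunc δ (rho y)) y = _
    rw [this]; ring
  have h2 : ∀ i, pderiv i (pderiv i (truncRho δ)) x =
      convexTruncDeriv₂ δ (rho x) * (rho x * drift i x / 2) ^ 2 +
      convexTruncDeriv δ (rho x) * (rho x / 4) * (drift i x ^ 2 + 2 * pderiv i (drift i) x) := by
    intro i
    rw [h1 i]
    have hc := (hasDerivAt_convexTrunc δ (rho_pos x)).2
    have d1 : DifferentiableAt ℝ (fun y => convexTruncDeriv δ (rho y)) x :=
      hc.differentiableAt.comp x (hρd x)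
    have d2 : DifferentiableAt ℝ (fun y => rho y * drift i y) x := (hρd x).fun_mul (hdd i x)
    rw [pderiv_mul d1 (d2.const_mul (1 / 2)), pderiv_comp_real hc (hρd x), pderiv_const_mul d2,
      pderiv_mul (hρd x) (hdd i x), pderiv_rho]
    ring
  obtain ⟨b1, b2, b3, b4, b5⟩ := convexTrunc_bounds hδ (rho_pos x)
  have h3 : euclLaplacian (truncRho δ) x =
      convexTruncDeriv₂ δ (rho x) * ∑ i, (rho x * drift i x / 2) ^ 2 -
      convexTruncDeriv δ (rho x) * (rho x / 8) * potential x := by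
    rw [euclLaplacian, ← potential_eq]
    simp only [h2, Finset.sum_add_distrib, ← Finset.mul_sum]
    ring
  have h4 : 0 ≤ ∑ i, (rho x * drift i x / 2) ^ 2 := Finset.sum_nonneg fun _ _ => sq_nonneg _
  have h5 : truncRho δ x = convexTrunc δ (rho x) := rfl
  have hN := potential_nonneg x
  have hρ := rho_pos x
  rw [h3, h5, ← rho_sq]
  have h6 : 0 ≤ convexTrunc δ (rho x) * (convexTruncDeriv₂ δ (rho x) *
    ∑ i, (rho x * drift i x / 2) ^ 2) := by positivity
  have h7 : convexTrunc δ (rho x) * convexTruncDeriv δ (rho x) ≤ rho x * 1 :=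
    mul_le_mul b2 b4 b3 hρ.le
  have h8 : (convexTrunc δ (rho x) * convexTruncDeriv δ (rho x)) * (rho x * potential x / 8) ≤
    (rho x * 1) * (rho x * potential x / 8) := mul_le_mul_of_nonneg_right h7 (by positivity)
  nlinarith

theorem truncRho_nonneg (hδ : 0 < δ) (x : E3) : 0 ≤ truncRho δ x :=
  (convexTrunc_bounds hδ (rho_pos x)).1

theorem truncRho_le (hδ : 0 < δ) (x : E3) : truncRho δ x ≤ rho x :=
  (convexTrunc_bounds hδ (rho_pos x)).2.1

theorem tendsto_truncRho (x : E3) : Tendsto (fun δ => truncRho δ x) (𝓝[>] 0) (𝓝 (rho x)) := by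
  have h : Continuous fun δ : ℝ => truncRho δ x := by
    unfold truncRho convexTrunc
    fun_prop
  have h2 := (h.tendsto 0).mono_left (nhdsWithin_le_nhds (s := Ioi 0))
  have h3 : truncRho 0 x = rho x := by
    have := (rho_pos x).ne'
    rw [truncRho, convexTrunc, sub_zero, max_eq_left (rho_pos x).le]
    field_simp
  rwa [h3] at h2

/-- The weighted Sobolev inequality: positivity of the Yamabe number of the limit metric. -/
theorem exists_weighted_sobolev : ∃ C, 0 < C ∧ ∀ v : E3 → ℝ, ContDiff ℝ 2 v →
    Integrable (fun x => ffun x ^ 3 * v x ^ 6) →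
    Integrable (fun x => ffun x * gradSq v x + ffun x * potential x / 8 * v x ^ 2) →
    (∫ x, ffun x ^ 3 * v x ^ 6) ^ (1 / 3 : ℝ) ≤
      C * ∫ x, (ffun x * gradSq v x + ffun x * potential x / 8 * v x ^ 2) := by
  obtain ⟨C, hC, hS⟩ := exists_sobolev
  refine ⟨C, hC, fun v hv h6 h2 => ?_⟩
  have step : ∀ δ : ℝ, 0 < δ → (∫ x, (truncRho δ x * v x) ^ 6) ^ (1 / 3 : ℝ) ≤
      C * ∫ x, (ffun x * gradSq v x + ffun x * potential x / 8 * v x ^ 2) := by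
    intro δ hδ
    have hcs := hasCompactSupport_truncRho hδ
    have hτ := contDiff_truncRho δ
    refine (hS (fun x => truncRho δ x * v x) ((hτ.mul hv).of_le (by norm_num))
      hcs.mul_right).trans (mul_le_mul_of_nonneg_left ?_ hC.le)
    rw [integral_gradSq_mul hτ hcs hv]
    refine integral_mono ?_ h2 fun x => ?_
    · refine integrable_of_tsupport hcs ?_ fun x hx => ?_
      · have hl : Continuous (euclLaplacian (truncRho δ)) := continuous_finsetSum _ fun i _ =>
          (contDiff_pderiv (contDiff_pderiv hτ (m := 1) (by norm_num) i) (m := 0) (by simp)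
            i).continuous
        have := continuous_gradSq (hv.of_le (by norm_num : (1 : ℕ∞ω) ≤ 2))
        have := hτ.continuous
        have := hv.continuous
        fun_prop
      · rw [image_eq_zero_of_notMem_tsupport hx]; ring
    · have a1 : truncRho δ x ^ 2 ≤ ffun x := by
        rw [← rho_sq]; exact pow_le_pow_left₀ (truncRho_nonneg hδ x) (truncRho_le hδ x) 2
      have a2 := neg_truncRho_mul_laplacian_le hδ x
      have a3 := mul_le_mul_of_nonneg_right a1 (gradSq_nonneg v x)
      have a4 := mul_le_mul_of_nonneg_left a2 (sq_nonneg (v x))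
      simp only
      linarith
  have e6 : ∀ x, ffun x ^ 3 * v x ^ 6 = (rho x * v x) ^ 6 := fun x => by
    rw [← rho_sq]; ring
  -- As δ → 0 the truncations tend to ρ from below, so the untruncated integrand dominates; the
  -- right side of `step` does not depend on δ.
  have hlim : Tendsto (fun δ : ℝ => ∫ x, (truncRho δ x * v x) ^ 6) (𝓝[>] 0)
      (𝓝 (∫ x, ffun x ^ 3 * v x ^ 6)) := by
    refine tendsto_integral_filter_of_dominated_convergence (fun x => ffun x ^ 3 * v x ^ 6)
      (Eventually.of_forall fun δ => ?_) ?_ h6 (Eventually.of_forall fun x => ?_)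
    · exact (((contDiff_truncRho δ).continuous.mul hv.continuous).pow 6).aestronglyMeasurable
    · filter_upwards [self_mem_nhdsWithin] with δ hδ
      refine Eventually.of_forall fun x => ?_
      rw [Real.norm_of_nonneg ((by decide : Even 6).pow_nonneg _), e6, mul_pow, mul_pow]
      exact mul_le_mul_of_nonneg_right
        (pow_le_pow_left₀ (truncRho_nonneg hδ x) (truncRho_le hδ x) 6)
        ((by decide : Even 6).pow_nonneg _)
    · rw [e6]
      exact ((tendsto_truncRho x).mul_const _).pow 6
  have hlim2 := hlim.rpow_const (p := (1 / 3 : ℝ)) (Or.inr (by norm_num))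
  exact le_of_tendsto hlim2 (by
    filter_upwards [self_mem_nhdsWithin] with δ hδ using step δ hδ)

end Truncation
section Energy
open CoordGeometry

/-! ### Positivity of the Yamabe number -/

variable {z : Fin 3 → Fin 3 → Fin 3 → Fin 3 → Fin 3 → ℝ} {η ε : ℝ}

theorem ffun_le_one (x : E3) : ffun x ≤ 1 := by
  by_contra h
  have h1 := ffun_sq_le_one x
  nlinarith

theorem half_le_ffun {x : E3} (hx : ‖x‖ ≤ 1) : 1 / 2 ≤ ffun x := by
  rw [ffun, div_le_div_iff₀ two_pos (by positivity)]
  have : ‖x‖ ^ 2 ≤ 1 := pow_le_one₀ (norm_nonneg _) hx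
  nlinarith [sq_nonneg ‖x‖]

theorem potential_le (x : E3) : potential x ≤ 5 * ‖x‖ ^ 2 := by
  rw [potential, div_le_iff₀ (by positivity), mul_comm (5 : ℝ), mul_assoc]
  refine mul_le_mul_of_nonneg_left ?_ (sq_nonneg _)
  have := sq_nonneg ‖x‖
  generalize ‖x‖ ^ 2 = n at *
  have h1 : 1 + 9 * n / 20 ≤ (1 + n / 4) * (1 + n / 2) := by nlinarith
  have h2 : (1 + n / 4) * (1 + n / 2) ≤ ((1 + n / 4) * (1 + n / 2)) ^ 2 :=
    le_self_pow₀ (by nlinarith) two_ne_zero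
  linarith

theorem integrable_ffun_cube : Integrable (fun x => ffun x ^ 3) := by
  have h := integrable_rpow_neg_one_add_norm_sq (E := E3) (μ := volume) (r := 6) (by
    simp; norm_num)
  -- From f|x|² ≤ 8 and f ≤ 1 one gets f(1 + |x|²) ≤ 9, and 729 = 9³. The resulting decay |x|⁻⁶ is
  -- integrable in dimension three.
  refine (h.const_mul 729).mono' (contDiff_ffun.continuous.pow 3).aestronglyMeasurable
    (Eventually.of_forall fun x => ?_)
  have h1 : ffun x * (1 + ‖x‖ ^ 2) ≤ 9 := by linarith [ffun_mul_le x, ffun_le_one x]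
  have hf := ffun_pos x
  rw [Real.norm_of_nonneg (by positivity), show (-6 / 2 : ℝ) = -((3 : ℕ) : ℝ) by norm_num,
    Real.rpow_neg (by positivity), Real.rpow_natCast, ← div_eq_mul_inv,
    le_div_iff₀ (by positivity), ← mul_pow]
  calc (ffun x * (1 + ‖x‖ ^ 2)) ^ 3 ≤ 9 ^ 3 := pow_le_pow_left₀ (by positivity) h1 3
    _ = 729 := by norm_num

/-- The volume density of the metrics of the family. -/
def famDensity (z : Fin 3 → Fin 3 → Fin 3 → Fin 3 → Fin 3 → ℝ) (ε : ℝ) (x : E3) : ℝ :=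
  √(family z ε x).det

/-- The integrand of the energy of a function for the metrics of the family. -/
def famEnergy (z : Fin 3 → Fin 3 → Fin 3 → Fin 3 → Fin 3 → ℝ) (ε : ℝ) (v : E3 → ℝ) (x : E3) : ℝ :=
  (8 * coordGradSq (family z ε) v x + scalarCurvature (family z ε) x * v x ^ 2) *
    famDensity z ε x

/-- The integrand of the energy of a function for the limit metric, divided by eight. -/
def limitEnergy (v : E3 → ℝ) (x : E3) : ℝ :=
  ffun x * gradSq v x + ffun x * potential x / 8 * v x ^ 2

theorem limitEnergy_nonneg (v : E3 → ℝ) (x : E3) : 0 ≤ limitEnergy v x := by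
  have := ffun_pos x
  have := potential_nonneg x
  have := gradSq_nonneg v x
  unfold limitEnergy; positivity

theorem det_smul_one_three (c : ℝ) : (c • (1 : Matrix (Fin 3) (Fin 3) ℝ)).det = c ^ 3 := by
  simp

theorem famDensity_outside (hε : 0 < ε) {x : E3} (hx : 2 * ε ≤ ‖x‖) :
    famDensity z ε x = ffun x ^ 3 := by
  rw [famDensity, family_eq_outside hε hx, det_smul_one_three, ← pow_mul,
    show 2 * 3 = 3 * 2 by norm_num, pow_mul, Real.sqrt_sq (pow_pos (ffun_pos x) 3).le]

/-- The inverse metric and the scalar curvature carry f⁻² and the volume f³, which leaves the weight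
f. The inequality is strict because the curvature depends on the metric in a neighbourhood. -/
theorem famEnergy_outside (hε : 0 < ε) (v : E3 → ℝ) {x : E3} (hx : 2 * ε < ‖x‖) :
    famEnergy z ε v x = 8 * limitEnergy v x := by
  have hev : family z ε =ᶠ[𝓝 x] fun y => ffun y ^ 2 • (1 : Matrix (Fin 3) (Fin 3) ℝ) := by
    filter_upwards [(isOpen_lt continuous_const continuous_norm).mem_nhds hx] with y hy
    exact family_eq_outside hε (le_of_lt hy)
  have hf := (ffun_pos x).ne'
  have hinv : (ffun x ^ 2 • (1 : Matrix (Fin 3) (Fin 3) ℝ))⁻¹ =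
      (ffun x ^ 2)⁻¹ • (1 : Matrix (Fin 3) (Fin 3) ℝ) := by
    apply Matrix.inv_eq_left_inv
    rw [Matrix.smul_mul, Matrix.mul_smul, smul_smul, one_mul, inv_mul_cancel₀ (pow_ne_zero 2 hf),
      one_smul]
  have hg : coordGradSq (family z ε) v x = (ffun x ^ 2)⁻¹ * gradSq v x := by
    rw [coordGradSq, family_eq_outside hε hx.le, hinv]
    simp [gradSq, Matrix.one_apply, Fin.sum_univ_three]
    ring
  rw [famEnergy, famDensity_outside hε hx.le, scalarCurvature_congr hev, scalarCurvature_limit,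
    hg, limitEnergy]
  field_simp

/-- On the small ball half of the Euclidean gradient term survives, hence 4 in place of 8. The
scalar curvature costs 2η/ε², the density being at most 2, and the potential term of `limitEnergy`
costs another η/ε² by 10ε⁴ ≤ η. -/
theorem le_famEnergy (hb : FamilyBounds z η ε) (hη : 10 * ε ^ 4 ≤ η) (v : E3 → ℝ) (x : E3) :
    4 * limitEnergy v x -
      (Metric.closedBall (0 : E3) (2 * ε)).indicator (fun x => 3 * (η / ε ^ 2) * v x ^ 2) x ≤
      famEnergy z ε v x := by
  have hε := hb.pos
  by_cases hx : ‖x‖ ≤ 2 * ε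
  · rw [indicator_of_mem (by simpa using hx)]
    have h1 := hb.grad_le x hx (fun i => pderiv i v x)
    have h2 := hb.scal_le x hx
    have h3 := hb.le_two x hx
    have h0 : 0 ≤ famDensity z ε x := Real.sqrt_nonneg _
    have hf := ffun_pos x
    have hf1 := ffun_le_one x
    have hg := gradSq_nonneg v x
    have hp := potential_nonneg x
    have hηε : 0 ≤ η / ε ^ 2 := (abs_nonneg _).trans h2
    have h4 : gradSq v x / 2 ≤ coordGradSq (family z ε) v x * famDensity z ε x := by
      rw [coordGradSq, famDensity, gradSq]
      linarith
    have h5 : -(2 * (η / ε ^ 2)) * v x ^ 2 ≤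
        scalarCurvature (family z ε) x * famDensity z ε x * v x ^ 2 := by
      refine mul_le_mul_of_nonneg_right ?_ (sq_nonneg _)
      have h6 : |scalarCurvature (family z ε) x * famDensity z ε x| ≤ (η / ε ^ 2) * 2 := by
        rw [abs_mul, abs_of_nonneg h0]
        exact mul_le_mul h2 h3 h0 hηε
      linarith [(abs_le.1 h6).1]
    have h7 : ffun x * potential x / 2 ≤ η / ε ^ 2 := by
      have h8 : potential x ≤ 20 * ε ^ 2 := by
        have := potential_le x
        have : ‖x‖ ^ 2 ≤ (2 * ε) ^ 2 := pow_le_pow_left₀ (norm_nonneg _) hx 2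
        linarith
      have h9 : ffun x * potential x ≤ 1 * (20 * ε ^ 2) := mul_le_mul hf1 h8 hp zero_le_one
      rw [le_div_iff₀ (by positivity)]
      nlinarith [pow_pos hε 2]
    have h10 := mul_le_mul_of_nonneg_right h7 (sq_nonneg (v x))
    have h11 : ffun x * gradSq v x ≤ gradSq v x := mul_le_of_le_one_left hg hf1
    rw [limitEnergy, famEnergy]
    nlinarith
  · rw [indicator_of_notMem (by simpa using hx), famEnergy_outside hε v (not_le.1 hx)]
    linarith [limitEnergy_nonneg v x]

/-- On the small ball |x| ≤ 1 and 1/8 ≤ f³ ≤ 1, while the density lies between 1/2 and 2 ≤ 16f³;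
elsewhere it equals f³. -/
theorem famDensity_bounds (hb : FamilyBounds z η ε) (hε : ε ≤ 1 / 2) (x : E3) :
    1 / 2 * ffun x ^ 3 ≤ famDensity z ε x ∧ famDensity z ε x ≤ 16 * ffun x ^ 3 := by
  have h0 := pow_pos (ffun_pos x) 3
  by_cases hx : ‖x‖ ≤ 2 * ε
  · have h1 := half_le_ffun (x := x) (by linarith)
    have h2 : (1 / 2) ^ 3 ≤ ffun x ^ 3 := pow_le_pow_left₀ (by norm_num) h1 3
    have h3 : ffun x ^ 3 ≤ 1 := pow_le_one₀ (ffun_pos x).le (ffun_le_one x)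
    have h4 := hb.half_le x hx
    have h5 := hb.le_two x hx
    unfold famDensity
    constructor <;> linarith
  · rw [famDensity_outside hb.pos (not_le.1 hx).le]
    constructor <;> linarith

theorem integral_weight_pos {v : E3 → ℝ} (hv0 : ∀ x, 0 < v x)
    (h6 : Integrable (fun x => ffun x ^ 3 * v x ^ 6)) : 0 < ∫ x, ffun x ^ 3 * v x ^ 6 := by
  have hpos : ∀ x, 0 < ffun x ^ 3 * v x ^ 6 := fun x =>
    mul_pos (pow_pos (ffun_pos x) 3) (pow_pos (hv0 x) 6)
  rw [integral_pos_iff_support_of_nonneg (fun x => (hpos x).le) h6]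
  have : Function.support (fun x => ffun x ^ 3 * v x ^ 6) = univ :=
    eq_univ_of_forall fun x => (hpos x).ne'
  rw [this]
  exact Measure.measure_univ_pos.2 (NeZero.ne _)

/-- A Hölder inequality on the small ball. -/
theorem integral_sq_closedBall_le {v : E3 → ℝ} (hv : Continuous v) (hv0 : ∀ x, 0 < v x)
    (hε : 0 < ε) (hε2 : ε ≤ 1 / 2) (h6 : Integrable (fun x => ffun x ^ 3 * v x ^ 6)) :
    ∫ x in Metric.closedBall (0 : E3) (2 * ε), v x ^ 2 ≤
      (8 + 16 * volume.real (Metric.ball (0 : E3) 1)) / 3 * ε ^ 2 *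
        (∫ x, ffun x ^ 3 * v x ^ 6) ^ (1 / 3 : ℝ) := by
  set B := Metric.closedBall (0 : E3) (2 * ε) with hB
  set J := ∫ x, ffun x ^ 3 * v x ^ 6 with hJ
  set Q := J ^ (1 / 3 : ℝ) with hQ
  have hpos : ∀ x, 0 < ffun x ^ 3 * v x ^ 6 := fun x =>
    mul_pos (pow_pos (ffun_pos x) 3) (pow_pos (hv0 x) 6)
  have hJ0 : 0 < J := integral_weight_pos hv0 h6
  have hQ0 : 0 < Q := Real.rpow_pos_of_pos hJ0 _
  have hQ3 : Q ^ 3 = J := by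
    rw [hQ, ← Real.rpow_natCast, ← Real.rpow_mul hJ0.le]; norm_num
  have hBc : IsCompact B := isCompact_closedBall _ _
  have i6 : IntegrableOn (fun x => v x ^ 6) B := (hv.pow 6).continuousOn.integrableOn_compact hBc
  have i2 : IntegrableOn (fun x => v x ^ 2) B := (hv.pow 2).continuousOn.integrableOn_compact hBc
  have iJ : ∫ x in B, v x ^ 6 ≤ 8 * J := by
    have h1 : ∫ x in B, v x ^ 6 ≤ ∫ x in B, 8 * (ffun x ^ 3 * v x ^ 6) := by
      refine setIntegral_mono_on i6 (h6.const_mul 8).integrableOn measurableSet_closedBall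
        fun x hx => ?_
      have hxn : ‖x‖ ≤ 1 := by
        rw [hB, mem_closedBall_zero_iff] at hx; linarith
      have h2 : (1 / 2) ^ 3 ≤ ffun x ^ 3 := pow_le_pow_left₀ (by norm_num) (half_le_ffun hxn) 3
      have h3 := pow_pos (hv0 x) 6
      nlinarith
    refine h1.trans ?_
    rw [hJ, ← integral_const_mul]
    exact setIntegral_le_integral (h6.const_mul 8) (Eventually.of_forall fun x =>
      mul_nonneg (by norm_num) (hpos x).le)
  -- Young's inequality t ≤ t³/(3s²) + 2s/3 with t = v² replaces Hölder's. The choice s = Q/ε makes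
  -- both terms of order ε²Q after integration over the ball.
  have hpt : ∀ x, v x ^ 2 ≤ ε ^ 2 / (3 * Q ^ 2) * v x ^ 6 + 2 / 3 * (Q / ε) := by
    intro x
    have hs : 0 < Q / ε := by positivity
    set s := Q / ε
    have e1 : ε ^ 2 / (3 * Q ^ 2) = 1 / (3 * s ^ 2) := by
      simp only [s]; field_simp
    rw [e1, show v x ^ 6 = (v x ^ 2) ^ 3 by ring]
    have ht : 0 ≤ v x ^ 2 := sq_nonneg _
    generalize v x ^ 2 = t at *
    rw [div_mul_eq_mul_div, one_mul, div_add' _ _ _ (by positivity), le_div_iff₀ (by positivity)]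
    nlinarith [mul_nonneg (sq_nonneg (t - s)) (by linarith : 0 ≤ t + 2 * s)]
  have hvol : volume.real B = (2 * ε) ^ 3 * volume.real (Metric.ball (0 : E3) 1) := by
    rw [Measure.real, Measure.real, hB, Measure.addHaar_closedBall _ _ (by positivity),
      ENNReal.toReal_mul, ENNReal.toReal_ofReal (by positivity)]
    simp
  calc ∫ x in B, v x ^ 2
      ≤ ∫ x in B, (ε ^ 2 / (3 * Q ^ 2) * v x ^ 6 + 2 / 3 * (Q / ε)) :=
        integral_mono i2 ((i6.const_mul _).add (integrableOn_const hBc.measure_ne_top)) hpt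
    _ = ε ^ 2 / (3 * Q ^ 2) * (∫ x in B, v x ^ 6) + volume.real B * (2 / 3 * (Q / ε)) := by
        rw [integral_add (i6.const_mul _) (integrableOn_const hBc.measure_ne_top),
          integral_const_mul, setIntegral_const, smul_eq_mul]
    _ ≤ ε ^ 2 / (3 * Q ^ 2) * (8 * J) + volume.real B * (2 / 3 * (Q / ε)) := by gcongr
    _ = _ := by
        rw [hvol, ← hQ3]
        field_simp
        ring

end Energy
-- Uniform lower bound for the Yamabe quotients
section Yamabe
open CoordGeometry

variable {z : Fin 3 → Fin 3 → Fin 3 → Fin 3 → Fin 3 → ℝ}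

/-- A positive lower bound for the Yamabe quotients of the family, in the chart. -/
theorem exists_famEnergy_bound : ∃ η > 0, ∃ c > 0, ∀ ε : ℝ, ε ≤ 1 / 2 → 10 * ε ^ 4 ≤ η →
    FamilyBounds z η ε → ∀ v : E3 → ℝ, ContDiff ℝ 2 v → (∀ x, 0 < v x) →
    Integrable (famEnergy z ε v) → Integrable (fun x => v x ^ 6 * famDensity z ε x) →
    c ≤ (∫ x, famEnergy z ε v x) / (∫ x, v x ^ 6 * famDensity z ε x) ^ (1 / 3 : ℝ) := by
  obtain ⟨C, hC, hS⟩ := exists_weighted_sobolev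
  set C₁ : ℝ := (8 + 16 * volume.real (Metric.ball (0 : E3) 1)) / 3 with hC₁
  have hC₁0 : 0 < C₁ := by
    have : 0 ≤ volume.real (Metric.ball (0 : E3) 1) := measureReal_nonneg
    positivity
  -- With this η the error on the small ball is at most 3Q/C, against 4Q/C from the weighted Sobolev
  -- inequality, so Q/C remains. The 3 in the second constant bounds the cube root of the factor 16
  -- in `famDensity_bounds`.
  refine ⟨1 / (C * C₁), by positivity, 1 / (3 * C), by positivity,
    fun ε hε hη hb v hv hv0 hE h6 => ?_⟩
  have hε0 := hb.pos
  have hd := famDensity_bounds hb hε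
  have hvc := hv.continuous
  have hf := contDiff_ffun.continuous
  have hv6 : ∀ x, 0 < v x ^ 6 := fun x => pow_pos (hv0 x) 6
  have hw : Integrable (fun x => ffun x ^ 3 * v x ^ 6) := by
    refine (h6.const_mul 2).mono' ((hf.pow 3).mul (hvc.pow 6)).aestronglyMeasurable
      (Eventually.of_forall fun x => ?_)
    rw [Real.norm_of_nonneg (mul_pos (pow_pos (ffun_pos x) 3) (hv6 x)).le]
    nlinarith [(hd x).1, hv6 x]
  set J := ∫ x, ffun x ^ 3 * v x ^ 6 with hJ
  have hJ0 : 0 < J := integral_weight_pos hv0 hw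
  set Q := J ^ (1 / 3 : ℝ) with hQ
  have hQ0 : 0 < Q := Real.rpow_pos_of_pos hJ0 _
  have hQ3 : Q ^ 3 = J := by
    rw [hQ, ← Real.rpow_natCast, ← Real.rpow_mul hJ0.le]; norm_num
  set B := Metric.closedBall (0 : E3) (2 * ε)
  set η := 1 / (C * C₁) with hη'
  have hi : Integrable (B.indicator (fun x => 3 * (η / ε ^ 2) * v x ^ 2)) := by
    rw [integrable_indicator_iff measurableSet_closedBall]
    exact ((hvc.pow 2).const_mul _).continuousOn.integrableOn_compact (isCompact_closedBall _ _)
  have hle := le_famEnergy hb hη v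
  have hLc : Continuous (limitEnergy v) :=
    (hf.mul (continuous_gradSq (hv.of_le (by norm_num)))).add
      (((hf.mul contDiff_potential.continuous).div_const 8).mul (hvc.pow 2))
  -- The limit energy density is nonnegative and bounded by the energy density of the family plus a
  -- compactly supported term, so integrability is inherited.
  have hL : Integrable (limitEnergy v) := by
    refine ((hE.add hi).div_const 4).mono' hLc.aestronglyMeasurable
      (Eventually.of_forall fun x => ?_)
    rw [Real.norm_of_nonneg (limitEnergy_nonneg v x), Pi.add_apply]
    linarith [hle x]
  have h1 : Q ≤ C * ∫ x, limitEnergy v x := hS v hv hw hL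
  have h2 : 4 * (∫ x, limitEnergy v x) - 3 * (η / ε ^ 2) * ∫ x in B, v x ^ 2 ≤
      ∫ x, famEnergy z ε v x := by
    have := integral_mono ((hL.const_mul 4).sub hi) hE hle
    rwa [integral_sub' (hL.const_mul 4) hi, integral_const_mul,
      integral_indicator measurableSet_closedBall, integral_const_mul] at this
  have h3 : ∫ x in B, v x ^ 2 ≤ C₁ * ε ^ 2 * Q := integral_sq_closedBall_le hvc hv0 hε0 hε hw
  have h4 : Q / C ≤ ∫ x, famEnergy z ε v x := by
    have h5 : 3 * (η / ε ^ 2) * ∫ x in B, v x ^ 2 ≤ 3 * (Q / C) := by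
      calc 3 * (η / ε ^ 2) * ∫ x in B, v x ^ 2 ≤ 3 * (η / ε ^ 2) * (C₁ * ε ^ 2 * Q) :=
            mul_le_mul_of_nonneg_left h3 (by positivity)
        _ = 3 * (Q / C) := by rw [hη']; field_simp
    have h6 : Q / C ≤ ∫ x, limitEnergy v x := by
      rw [div_le_iff₀ hC]; linarith
    linarith
  set K := ∫ x, v x ^ 6 * famDensity z ε x with hK
  have hK1 : 1 / 2 * J ≤ K := by
    rw [hJ, hK, ← integral_const_mul]
    exact integral_mono (hw.const_mul _) h6 fun x => by
      have := mul_le_mul_of_nonneg_left (hd x).1 (hv6 x).le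
      dsimp only
      linarith
  have hK2 : K ≤ 16 * J := by
    rw [hJ, hK, ← integral_const_mul]
    exact integral_mono h6 (hw.const_mul _) fun x => by
      have := mul_le_mul_of_nonneg_left (hd x).2 (hv6 x).le
      dsimp only
      linarith
  have hK0 : 0 < K := by linarith
  have hKQ : K ^ (1 / 3 : ℝ) ≤ 3 * Q := by
    have h7 : K ≤ (3 * Q) ^ (3 : ℝ) := by
      rw [show (3 : ℝ) = ((3 : ℕ) : ℝ) by norm_num, Real.rpow_natCast]
      push_cast
      rw [mul_pow, hQ3]
      linarith
    calc K ^ (1 / 3 : ℝ) ≤ ((3 * Q) ^ (3 : ℝ)) ^ (1 / 3 : ℝ) :=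
          Real.rpow_le_rpow hK0.le h7 (by norm_num)
      _ = 3 * Q := by rw [← Real.rpow_mul (by positivity)]; norm_num
  rw [le_div_iff₀ (Real.rpow_pos_of_pos hK0 _)]
  calc 1 / (3 * C) * K ^ (1 / 3 : ℝ) ≤ 1 / (3 * C) * (3 * Q) :=
        mul_le_mul_of_nonneg_left hKQ (by positivity)
    _ = Q / C := by field_simp
    _ ≤ _ := h4

/-! ### From the chart to the manifold -/

variable {S : Type*} [TopologicalSpace S] [ChartedSpace (EuclideanSpace ℝ (Fin 3)) S]
  [IsManifold (𝓡 3) ∞ S] [T2Space S] [CompactSpace S] [MeasurableSpace S] [BorelSpace S]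
  (Ψ : S ≃ₘ⟮𝓡 3, 𝓡 3⟯ (Metric.sphere (0 : EuclideanSpace ℝ (Fin 4)) 1))
  (v₀ : Metric.sphere (0 : E4) 1)

theorem continuous_stereoChart_symm : Continuous (stereoChart Ψ v₀).symm := by
  rw [← continuousOn_univ, ← stereoChart_target Ψ v₀]
  exact (stereoChart Ψ v₀).continuousOn_symm

theorem contDiff_comp_stereoChart_symm {u : S → ℝ} (hu : ContMDiff (𝓡 3) 𝓘(ℝ, ℝ) ∞ u) :
    ContDiff ℝ ∞ (fun x => u ((stereoChart Ψ v₀).symm x)) := by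
  rw [← contDiffOn_univ, ← stereoChart_target Ψ v₀, ← contMDiffOn_iff_contDiffOn]
  exact hu.comp_contMDiffOn (contMDiffOn_symm_of_mem_maximalAtlas (stereoChart_mem Ψ v₀))

variable (hz : HasRiemannDerivSymmetries z)

theorem volDensity_familyMetric {η ε : ℝ} (hb : FamilyBounds z η ε) :
    volDensity (familyMetric Ψ v₀ hz hb) (stereoChart Ψ v₀) = famDensity z ε := by
  ext x
  rw [volDensity, chartCoeff_familyMetric, famDensity]

-- A continuous function is bounded by compactness, and the density is dominated by the integrable
-- 16f³.
include hz in
theorem integrable_comp_stereoChart {η ε : ℝ} (hb : FamilyBounds z η ε) (hε : ε ≤ 1 / 2) {F : S → ℝ} (hF : Continuous F) :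
    Integrable (fun x => F ((stereoChart Ψ v₀).symm x) * famDensity z ε x) := by
  have hc := continuous_volDensity (familyMetric Ψ v₀ hz hb) (stereoChart_mem Ψ v₀)
    (stereoChart_target Ψ v₀)
  rw [volDensity_familyMetric] at hc
  have hd : Integrable (famDensity z ε) :=
    (integrable_ffun_cube.const_mul 16).mono' hc.aestronglyMeasurable
      (Eventually.of_forall fun x => by
        rw [famDensity, Real.norm_of_nonneg (Real.sqrt_nonneg _)]
        exact (famDensity_bounds hb hε x).2)
  obtain ⟨c, hc⟩ := isCompact_univ.exists_bound_of_continuousOn hF.continuousOn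
  exact hd.bdd_mul (c := c) (hF.comp (continuous_stereoChart_symm Ψ v₀)).aestronglyMeasurable
    (Eventually.of_forall fun x => hc _ (mem_univ _))

theorem yamabeIntegrand_eq_famEnergy {η ε : ℝ} (hb : FamilyBounds z η ε) {u : S → ℝ} (hu : ContMDiff (𝓡 3) 𝓘(ℝ, ℝ) ∞ u) (x : E3) :
    (8 * gradNormSq (familyMetric Ψ v₀ hz hb) u ((stereoChart Ψ v₀).symm x) +
        scalarCurv (familyMetric Ψ v₀ hz hb) ((stereoChart Ψ v₀).symm x) *
          u ((stereoChart Ψ v₀).symm x) ^ 2) * famDensity z ε x =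
      famEnergy z ε (fun x => u ((stereoChart Ψ v₀).symm x)) x := by
  have hx : x ∈ (stereoChart Ψ v₀).target := by rw [stereoChart_target]; trivial
  have hs := (stereoChart Ψ v₀).map_target hx
  have hG : chartCoeff (familyMetric Ψ v₀ hz hb).inner (stereoChart Ψ v₀) = family z ε :=
    funext fun x => chartCoeff_familyMetric Ψ v₀ hz hb x
  rw [gradNormSq_eq _ (stereoChart_mem Ψ v₀) hs ((hu _).mdifferentiableAt (by simp)),
    scalarCurv_eq _ (stereoChart_mem Ψ v₀) hs, hG, (stereoChart Ψ v₀).right_inv hx, famEnergy]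

/-- The Yamabe numbers of the family are positive. -/
theorem exists_yamabeNumber_pos : ∃ η > 0, ∀ ε : ℝ, ε ≤ 1 / 2 → 10 * ε ^ 4 ≤ η →
    ∀ hb : FamilyBounds z η ε, 0 < yamabeNumber (familyMetric Ψ v₀ hz hb) := by
  obtain ⟨η, hη, c, hc, H⟩ := exists_famEnergy_bound (z := z)
  refine ⟨η, hη, fun ε hε hεη hb => hc.trans_le ?_⟩
  refine le_csInf ⟨_, fun _ => 1, contMDiff_const, fun _ => one_pos, rfl⟩ ?_
  rintro _ ⟨u, hu, hu0, rfl⟩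
  set h := familyMetric Ψ v₀ hz hb with hh
  have hN : ((stereoChart Ψ v₀).source)ᶜ ⊆ {Ψ.symm v₀} := by
    rw [stereoChart_source, compl_compl]
  have hF : Continuous fun p => 8 * gradNormSq h u p + scalarCurv h p * u p ^ 2 :=
    ((continuous_gradNormSq h hu).const_mul 8).add
      ((continuous_scalarCurv h).mul (hu.continuous.pow 2))
  have hE := integrable_comp_stereoChart Ψ v₀ hz hb hε hF
  simp only [hh, yamabeIntegrand_eq_famEnergy Ψ v₀ hz hb hu] at hE
  have h6c : Continuous fun p => u p ^ 6 := hu.continuous.pow 6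
  have h6 := integrable_comp_stereoChart Ψ v₀ hz hb hε h6c
  have key := H ε hε hεη hb (fun x => u ((stereoChart Ψ v₀).symm x))
    (contDiff_infty.1 (contDiff_comp_stereoChart_symm Ψ v₀ hu) 2) (fun x => hu0 _) hE h6
  rw [yamabeQuotient, integral_riemVolume h (stereoChart_mem Ψ v₀) (stereoChart_target Ψ v₀) hN hF,
    integral_riemVolume h (stereoChart_mem Ψ v₀) (stereoChart_target Ψ v₀) hN
      h6c, hh, volDensity_familyMetric]
  simp only [yamabeIntegrand_eq_famEnergy Ψ v₀ hz hb hu]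
  exact key

end Yamabe
end

/-! ### Choice of the pole, of the constants and of the family -/

theorem mainTheorem5
    {S : Type*} [TopologicalSpace S] [ChartedSpace (EuclideanSpace ℝ (Fin 3)) S]
    [IsManifold (𝓡 3) ∞ S] [MeasurableSpace S] [BorelSpace S]
    (Ψ : S ≃ₘ⟮𝓡 3, 𝓡 3⟯ (Metric.sphere (0 : EuclideanSpace ℝ (Fin 4)) 1))
    (z : Fin 3 → Fin 3 → Fin 3 → Fin 3 → Fin 3 → ℝ) (hz : HasRiemannDerivSymmetries z) :
    ∃ (i : S) (w : S → ℝ) (e : OpenPartialHomeomorph S (EuclideanSpace ℝ (Fin 3)))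
      (ε₀ : ℝ) (h : ℝ → SmoothMetric S),
      i ∈ e.source ∧
      ContMDiff (𝓡 3) 𝓘(ℝ, ℝ) ∞ w ∧ (∀ p, 0 < w p) ∧ 0 < ε₀ ∧
      (∀ ε ∈ Ioo 0 ε₀,
        (IsNormalChartOn (h ε) i ε e ∧
          ∀ x ∈ Metric.ball (0 : EuclideanSpace ℝ (Fin 3)) ε, ∀ α β : Fin 3,
            chartCoeff (h ε).inner e x α β = cubicMetric z x α β) ∧
        (∀ p ∉ metricBall (h ε) i (2 * ε),
          (h ε).inner p = conformalRescale w (roundMetric Ψ) p) ∧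
        0 < yamabeNumber (h ε)) ∧
      TendstoC2 (fun ε => (h ε).inner) (𝓝[>] 0) (conformalRescale w (roundMetric Ψ)) := by
  classical
  have : T2Space S := Ψ.toHomeomorph.symm.t2Space
  have : CompactSpace S := Ψ.toHomeomorph.symm.compactSpace
  let v : Metric.sphere (0 : EuclideanSpace ℝ (Fin 4)) 1 := ⟨EuclideanSpace.single 0 1, by simp⟩
  -- The smallness η required of the scaled curvature does not depend on ε, so it is fixed first and
  -- ε₀ is chosen afterwards. Any unit vector could serve as the pole `v`.
  obtain ⟨η, hη, hY⟩ := exists_yamabeNumber_pos Ψ v hz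
  have hb := eventually_familyBounds hz hη
  have h10 : ∀ᶠ ε : ℝ in 𝓝[>] 0, 10 * ε ^ 4 ≤ η := by
    have : Tendsto (fun ε : ℝ => 10 * ε ^ 4) (𝓝[>] 0) (𝓝 (10 * 0 ^ 4)) :=
      (Continuous.tendsto (by fun_prop) 0).mono_left nhdsWithin_le_nhds
    exact this.eventually_le_const (by norm_num; exact hη)
  obtain ⟨ε₀, hε₀, hsub⟩ := mem_nhdsGT_iff_exists_Ioo_subset.1
    (hb.and (h10.and (Ioc_mem_nhdsGT (one_half_pos (α := ℝ)))))
  -- Below ε₀ the first alternative always applies; the limit metric is a default value for the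
  -- remaining ε.
  let h : ℝ → SmoothMetric S := fun ε =>
    if hε : FamilyBounds z η ε then familyMetric Ψ v hz hε else limitMetric Ψ v
  have hh : ∀ {ε : ℝ} (hε : FamilyBounds z η ε), h ε = familyMetric Ψ v hz hε :=
    fun hε => dif_pos hε
  refine ⟨Ψ.symm (-v), heightFactor Ψ v, stereoChart Ψ v, ε₀, h, ?_, contMDiff_heightFactor Ψ v,
    heightFactor_pos Ψ v, hε₀, fun ε hε => ?_,
    tendstoC2_family Ψ v hz (hb.mono fun ε hε => ⟨hε, hh hε⟩)⟩
  · rw [← stereoChart_symm_zero]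
    exact (stereoChart Ψ v).map_target (by rw [stereoChart_target]; trivial)
  · obtain ⟨h1, h2, h3⟩ := hsub hε
    rw [hh h1]
    exact ⟨⟨familyMetric_isNormalChartOn Ψ v hz h1,
      fun x hx α β => chartCoeff_familyMetric_ball Ψ v hz h1 hx α β⟩,
      fun p hp => familyMetric_eq_limit_outside Ψ v hz h1 hp, hY ε h3.2 h2 h1⟩
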